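/- \textbf{Conventions.} Let $n,m\ge 1$, and let functions on $\mathbb{R}^n$ be real- or complex-valued. $B=B(y,r)$ is an open ball, $\lambda B=B(y,\lambda r)$. A weight is a locally integrable, a.e. positive function, and $\omega(E)=\int_E\omega$. $A_p$ ($1\le p<\infty$) is the Muckenhoupt class and $A_\infty=\bigcup_{1\le p<\infty}A_p$. For $1\le t_1,\dots,t_m<\infty$, $1/t=\sum_j1/t_j$, the weights $\vec\omega=(\omega_1,\dots,\omega_m)$ belong to $A_{\vec t}$ if $$\sup_B\Big(\frac1{|B|}\int_B\nu_{\vec\omega}\Big)^{1/t}\prod_{j=1}^m\Big(\frac1{|B|}\int_B\omega_j^{1-t_j'}\Big)^{1/t_j'}<\infty,\qquad \nu_{\vec\omega}=\prod_{j=1}^m\omega_j^{t/t_j}$$ (the $j$-th factor is $(\operatorname{ess\,inf}_B\omega_j)^{-1}$ if $t_j=1$). $\|b\|_{BMO}=\sup_B\frac1{|B|}\int_B|b-b_B|$ for locally integrable $b$, where $b_B=\frac1{|B|}\int_Bb$. For $0<q\le\alpha\le p\le\infty$, $q,\alpha<\infty$, the amalgam space $(L^q(\omega),L^p)^\alpha$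 consists of the measurable $f$ with $$\|f\|_{(L^q(\omega),L^p)^\alpha}=\sup_{r>0}\Big\|\,\omega(B(y,r))^{\frac1\alpha-\frac1q-\frac1p}\,\|f\chi_{B(y,r)}\|_{L^q(\omega)}\Big\|_{L^p(\mathbb{R}^n,dy)}<\infty .$$ \textbf{Exponents and weights.} Let $1\le s<q_j\le\alpha_j<p_j\le\infty$ ($j=1,\dots,m$), $\frac1q=\sum_j\frac1{q_j}$, $\frac1p=\sum_j\frac1{p_j}$, $\frac1\alpha=\sum_j\frac1{\alpha_j}$ and $\frac p{p_j}=\frac q{q_j}=\frac\alpha{\alpha_j}$, where the first equation is read as $\frac1{p_j}=\frac q{q_j}\cdot\frac1p$, with $1/\infty=0$. Let $\vec\omega\in A_{\vec Q/s}\cap(A_\infty)^m$, $\vec Q/s=(q_1/s,\dots,q_m/s)$, and $\nu_{\vec\omega}=\prod_j\omega_j^{q/q_j}$. \textbf{Operators.} For each $j$ let $D_j$ be a linear space of measurable, locally $s$-integrable functions that contains $f\chi_B$ whenever $f\in D_j$ and $B$ is a ball. Let $\mathcal T$ be an operator on $D_1\times\dots\times D_m$ with measurable values that is either (a) $m$-linear,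 with values in the scalar-valued functions modulo null sets, or (b) $m$-sublinear, that is, $[0,\infty]$-valued, pointwise subadditive in each argument and pointwise absolutely homogeneous in each argument. Suppose that for some $C_1$, for all $f_j\in D_j$, all balls $B$, all non-empty $\sigma\subset\{1,\dots,m\}$ with complement $\sigma^c$, and a.e. $x\in B$, $$|\mathcal T(\vec f^{\,\sigma})(x)|\le C_1\prod_{j\in\sigma^c}\Big(\frac1{|2B|}\int_{2B}|f_j|^s\Big)^{1/s}\sum_{k=1}^\infty\frac{k}{2^{nk|\sigma^c|}}\prod_{j\in\sigma}\Big(\frac1{|2^{k+1}B|}\int_{2^{k+1}B\setminus2^kB}|f_j|^s\Big)^{1/s},$$ where $\vec f^{\,\sigma}$ has the entries $f_j\chi_{\mathbb{R}^n\setminus2B}$ for $j\in\sigma$ and $f_j\chi_{2B}$ for $j\in\sigma^c$. For $\vec b=(b_1,\dots,b_m)\in BMO^m$, the multilinear commutator $\mathcal T_{\Sigma\vec b}$ is defined on the tuples $\vec f$ with $f_j,\,b_jf_j\in D_j$ for all $j$, in case (a) by $$\mathcal T_{\Sigma\vec b}(\vec f)=\sum_{j=1}^m\big(b_j\,\mathcal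 T(\vec f)-\mathcal T(f_1,\dots,b_jf_j,\dots,f_m)\big),$$ and in case (b) by $$\mathcal T_{\Sigma\vec b}(\vec f)(x)=\sum_{j=1}^m\mathcal T\big(f_1,\dots,(b_j(x)-b_j)f_j,\dots,f_m\big)(x),$$ where it is assumed that these functions of $x$ are measurable. \textbf{Theorem.} For every $C_0$ there is a constant $C$ that depends only on $n$, $m$, the exponents, $\vec\omega$, $C_0$ and $C_1$ with the following property. Let $D_j$, $\mathcal T$ and $\vec b\in BMO^m$ be as above, and suppose that $\mathcal T_{\Sigma\vec b}$ is bounded from $L^{q_1}(\omega_1)\times\dots\times L^{q_m}(\omega_m)$ to $L^q(\nu_{\vec\omega})$ with $$\|\mathcal T_{\Sigma\vec b}(\vec f)\|_{L^q(\nu_{\vec\omega})}\le C_0\sum_{j=1}^m\|b_j\|_{BMO}\prod_{j=1}^m\|f_j\|_{L^{q_j}(\omega_j)}$$ for all $f_j\in L^{q_j}(\omega_j)$ for which $\mathcal T_{\Sigma\vec b}(\vec f)$ is defined. Then $\mathcal T_{\Sigma\vec b}$ is bounded from $(L^{q_1}(\omega_1),L^{p_1})^{\alpha_1}\times\dots\times(L^{q_m}(\omega_m),L^{p_m})^{\alpha_m}$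 to $(L^q(\nu_{\vec\omega}),L^p)^\alpha$: for all $f_j\in(L^{q_j}(\omega_j),L^{p_j})^{\alpha_j}$ for which $\mathcal T_{\Sigma\vec b}(\vec f)$ is defined, $\mathcal T_{\Sigma\vec b}(\vec f)\in(L^q(\nu_{\vec\omega}),L^p)^\alpha$ and $$\|\mathcal T_{\Sigma\vec b}(\vec f)\|_{(L^q(\nu_{\vec\omega}),L^p)^\alpha}\le C\sum_{j=1}^m\|b_j\|_{BMO}\prod_{j=1}^m\|f_j\|_{(L^{q_j}(\omega_j),L^{p_j})^{\alpha_j}} .$$ -/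

import Mathlib

open MeasureTheory Metric Set
open scoped ENNReal NNReal

noncomputable section

namespace Amalgam

/-- The underlying space `ℝⁿ`. -/
abbrev Rn (n : ℕ) := EuclideanSpace ℝ (Fin n)

section Weights

variable {n m : ℕ}

/-- A weight: a locally integrable function that is positive almost everywhere. -/
def IsWeight (w : Rn n → ℝ) : Prop :=
  LocallyIntegrable w volume ∧ ∀ᵐ x, 0 < w x

/-- `w(E) = ∫_E w`. -/
def wMeas (w : Rn n → ℝ) (E : Set (Rn n)) : ℝ≥0∞ :=
  ∫⁻ x in E, ENNReal.ofReal (w x)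

/-- The factor `(|B|⁻¹ ∫_B w^{1-p'})^{1/p'}` with `p' = p/(p-1)`, read as
`(ess inf_B w)⁻¹ = ess sup_B w⁻¹` when `p = 1`. -/
def dualFactor (p : ℝ) (w : Rn n → ℝ) (B : Set (Rn n)) : ℝ≥0∞ :=
  if p = 1 then essSup (fun x => (ENNReal.ofReal (w x))⁻¹) (volume.restrict B)
  else (⨍⁻ x in B, ENNReal.ofReal (w x) ^ (1 - p / (p - 1)) ∂volume) ^ (1 / (p / (p - 1)))

/-- The Muckenhoupt class `A_p`, `1 ≤ p < ∞`. -/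
def MemAp (p : ℝ) (w : Rn n → ℝ) : Prop :=
  IsWeight w ∧ ∃ C : ℝ≥0, ∀ (y : Rn n) (r : ℝ), 0 < r →
    (⨍⁻ x in ball y r, ENNReal.ofReal (w x) ∂volume) ^ (1 / p) * dualFactor p w (ball y r) ≤ C

/-- `A_∞ = ⋃_{1 ≤ p < ∞} A_p`. -/
def MemAinfty (w : Rn n → ℝ) : Prop := ∃ p : ℝ, 1 ≤ p ∧ MemAp p w

/-- `ν_w = ∏ⱼ wⱼ^{p/pⱼ}`. -/
def nuWeight (p : ℝ) (P : Fin m → ℝ) (w : Fin m → Rn n → ℝ) (x : Rn n) : ℝ :=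
  ∏ j, w j x ^ (p / P j)

/-- The multiple weight class `A_P`, where `P = (p₁, …, p_m)` and `1/p = ∑ⱼ 1/pⱼ`. -/
def MemMultiAp (p : ℝ) (P : Fin m → ℝ) (w : Fin m → Rn n → ℝ) : Prop :=
  (∀ j, IsWeight (w j)) ∧ ∃ C : ℝ≥0, ∀ (y : Rn n) (r : ℝ), 0 < r →
    (⨍⁻ x in ball y r, ENNReal.ofReal (nuWeight p P w x) ∂volume) ^ (1 / p) *
      ∏ j, dualFactor (P j) (w j) (ball y r) ≤ C

end Weights

section Norms

variable {n : ℕ} {ε : Type*} [ENorm ε]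

/-- The (quasi)norm of `L^q(w)`, `0 < q < ∞`. -/
def wLqNorm (q : ℝ) (w : Rn n → ℝ) (f : Rn n → ε) : ℝ≥0∞ :=
  (∫⁻ x, ‖f x‖ₑ ^ q * ENNReal.ofReal (w x)) ^ (1 / q)

/-- `‖f χ_E‖_{L^q(w)}`. -/
def wLqNormOn (q : ℝ) (w : Rn n → ℝ) (E : Set (Rn n)) (f : Rn n → ε) : ℝ≥0∞ :=
  (∫⁻ x in E, ‖f x‖ₑ ^ q * ENNReal.ofReal (w x)) ^ (1 / q)

/-- The quasinorm of the weighted amalgam space `(L^q(w), L^p)^α`: the supremum over `r > 0` of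
the `L^p(dy)` norms (an essential supremum if `p = ∞`) of
`w(B(y,r))^{1/α - 1/q - 1/p} ‖f χ_{B(y,r)}‖_{L^q(w)}`. -/
def amalgamNorm (q : ℝ) (w : Rn n → ℝ) (p : ℝ≥0∞) (α : ℝ) (f : Rn n → ε) : ℝ≥0∞ :=
  ⨆ (r : ℝ) (_ : 0 < r),
    eLpNorm (fun y : Rn n =>
      wMeas w (ball y r) ^ (1 / α - 1 / q - (p⁻¹).toReal) * wLqNormOn q w (ball y r) f) p volume

variable [TopologicalSpace ε]

/-- Membership in `L^q(w)`. -/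
def MemWLq (q : ℝ) (w : Rn n → ℝ) (f : Rn n → ε) : Prop :=
  AEStronglyMeasurable f volume ∧ wLqNorm q w f < ∞

/-- Membership in the weighted amalgam space `(L^q(w), L^p)^α`. -/
def MemAmalgam (q : ℝ) (w : Rn n → ℝ) (p : ℝ≥0∞) (α : ℝ) (f : Rn n → ε) : Prop :=
  AEStronglyMeasurable f volume ∧ amalgamNorm q w p α f < ∞

end Norms

section Operators

variable {𝕜 : Type*} [RCLike 𝕜] {n m : ℕ}

/-- `‖b‖_{BMO} = sup_B |B|⁻¹ ∫_B |b - b_B|`. -/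
def bmoNorm (b : Rn n → 𝕜) : ℝ≥0∞ :=
  ⨆ (y : Rn n) (r : ℝ) (_ : 0 < r),
    ⨍⁻ x in ball y r, ‖b x - ⨍ z in ball y r, b z ∂volume‖ₑ ∂volume

/-- Membership in `BMO(ℝⁿ)`. -/
def MemBMO (b : Rn n → 𝕜) : Prop :=
  LocallyIntegrable b volume ∧ bmoNorm b < ∞

/-- Domains of `m`-(sub)linear operators: the `j`-th argument ranges over a linear space `D j` of
measurable, locally `s`-integrable functions which is stable under multiplication by
characteristic functions of balls. -/
structure IsDomain (s : ℝ) (D : Fin m → Submodule 𝕜 (Rn n → 𝕜)) : Prop where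
  meas : ∀ j, ∀ f ∈ D j, AEStronglyMeasurable f volume
  loc : ∀ j, ∀ f ∈ D j, ∀ (y : Rn n) (r : ℝ), ∫⁻ x in ball y r, ‖f x‖ₑ ^ s < ∞
  cut : ∀ j, ∀ f ∈ D j, ∀ (y : Rn n) (r : ℝ), (ball y r).indicator f ∈ D j

/-- `T` is `m`-linear on `∏ⱼ D j`, with measurable functions (modulo null sets) as values. -/
structure IsMultilinearOp (D : Fin m → Submodule 𝕜 (Rn n → 𝕜))
    (T : (Fin m → Rn n → 𝕜) → Rn n → 𝕜) : Prop where
  meas : ∀ f : Fin m → Rn n → 𝕜, (∀ i, f i ∈ D i) → AEStronglyMeasurable (T f) volume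
  add : ∀ f : Fin m → Rn n → 𝕜, (∀ i, f i ∈ D i) → ∀ j, ∀ g ∈ D j, ∀ h ∈ D j, ∀ᵐ x,
    T (Function.update f j (g + h)) x = T (Function.update f j g) x + T (Function.update f j h) x
  smul : ∀ f : Fin m → Rn n → 𝕜, (∀ i, f i ∈ D i) → ∀ j, ∀ g ∈ D j, ∀ c : 𝕜, ∀ᵐ x,
    T (Function.update f j (c • g)) x = c * T (Function.update f j g) x

/-- `T` (which stands for the modulus of the operator) is `m`-sublinear on `∏ⱼ D j`, pointwise,
with nonnegative measurable functions as values. -/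
structure IsSublinearOp (D : Fin m → Submodule 𝕜 (Rn n → 𝕜))
    (T : (Fin m → Rn n → 𝕜) → Rn n → ℝ≥0∞) : Prop where
  meas : ∀ f : Fin m → Rn n → 𝕜, (∀ i, f i ∈ D i) → AEStronglyMeasurable (T f) volume
  add : ∀ f : Fin m → Rn n → 𝕜, (∀ i, f i ∈ D i) → ∀ j, ∀ g ∈ D j, ∀ h ∈ D j, ∀ x,
    T (Function.update f j (g + h)) x ≤ T (Function.update f j g) x + T (Function.update f j h) x
  smul : ∀ f : Fin m → Rn n → 𝕜, (∀ i, f i ∈ D i) → ∀ j, ∀ g ∈ D j, ∀ (c : 𝕜) (x : Rn n),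
    T (Function.update f j (c • g)) x = ‖c‖ₑ * T (Function.update f j g) x

/-- The tuple with `fⱼ χ_{ℝⁿ∖2B}` for `j ∈ σ` and `fⱼ χ_{2B}` for `j ∉ σ`, `B = B(y,r)`. -/
def splitAt (σ : Finset (Fin m)) (y : Rn n) (r : ℝ) (f : Fin m → Rn n → 𝕜) :
    Fin m → Rn n → 𝕜 :=
  fun j => if j ∈ σ then (ball y (2 * r))ᶜ.indicator (f j) else (ball y (2 * r)).indicator (f j)

/-- The local pointwise size condition. The term `k = 0` of the series vanishes. -/
def SizeCondition {ε : Type*} [ENorm ε] (s : ℝ) (C₁ : ℝ≥0)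
    (D : Fin m → Submodule 𝕜 (Rn n → 𝕜)) (T : (Fin m → Rn n → 𝕜) → Rn n → ε) : Prop :=
  ∀ f : Fin m → Rn n → 𝕜, (∀ i, f i ∈ D i) →
  ∀ (y : Rn n) (r : ℝ), 0 < r → ∀ σ : Finset (Fin m), σ.Nonempty →
  ∀ᵐ x, x ∈ ball y r →
    ‖T (splitAt σ y r f) x‖ₑ ≤
      C₁ * (∏ j ∈ σᶜ, (⨍⁻ z in ball y (2 * r), ‖f j z‖ₑ ^ s ∂volume) ^ (1 / s)) *
        ∑' k : ℕ, ((k : ℝ≥0∞) / 2 ^ (n * k * σᶜ.card)) *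
          ∏ j ∈ σ, ((volume (ball y (2 ^ (k + 1) * r)))⁻¹ *
            ∫⁻ z in ball y (2 ^ (k + 1) * r) \ ball y (2 ^ k * r), ‖f j z‖ₑ ^ s) ^ (1 / s)

/-- The tuples on which the commutator with `b = (b₁, …, b_m)` is defined. -/
def CommDomain (D : Fin m → Submodule 𝕜 (Rn n → 𝕜)) (b f : Fin m → Rn n → 𝕜) : Prop :=
  ∀ j, f j ∈ D j ∧ b j * f j ∈ D j

/-- The multilinear commutator of an `m`-linear operator:
`T_{Σb}(f) = ∑ⱼ (bⱼ T(f) - T(f₁, …, bⱼ fⱼ, …, f_m))`. -/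
def commLin (T : (Fin m → Rn n → 𝕜) → Rn n → 𝕜) (b f : Fin m → Rn n → 𝕜) (x : Rn n) : 𝕜 :=
  ∑ j, (b j x * T f x - T (Function.update f j (b j * f j)) x)

/-- The multilinear commutator of an `m`-sublinear operator:
`T_{Σb}(f)(x) = ∑ⱼ T(f₁, …, (bⱼ(x) - bⱼ) fⱼ, …, f_m)(x)`. -/
def commSub (T : (Fin m → Rn n → 𝕜) → Rn n → ℝ≥0∞) (b f : Fin m → Rn n → 𝕜) (x : Rn n) :
    ℝ≥0∞ :=
  ∑ j, T (Function.update f j (fun z => (b j x - b j z) * f j z)) x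

/-- `S` is bounded from `∏ⱼ L^{qⱼ}(wⱼ)` to `L^q(v)` with constant `K`, where only tuples
in the domain `𝒟` of `S` are considered. -/
def BoundedLebesgue {ε : Type*} [ENorm ε] [TopologicalSpace ε]
    (𝒟 : (Fin m → Rn n → 𝕜) → Prop) (S : (Fin m → Rn n → 𝕜) → Rn n → ε)
    (Q : Fin m → ℝ) (w : Fin m → Rn n → ℝ) (q : ℝ) (v : Rn n → ℝ) (K : ℝ≥0∞) : Prop :=
  ∀ f, 𝒟 f → (∀ j, MemWLq (Q j) (w j) (f j)) →
    AEStronglyMeasurable (S f) volume ∧ wLqNorm q v (S f) ≤ K * ∏ j, wLqNorm (Q j) (w j) (f j)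

/-- `S` is bounded from `∏ⱼ (L^{qⱼ}(wⱼ), L^{pⱼ})^{αⱼ}` to `(L^q(v), L^p)^α` with constant `K`,
where only tuples in the domain `𝒟` of `S` are considered. -/
def BoundedAmalgam {ε : Type*} [ENorm ε] [TopologicalSpace ε]
    (𝒟 : (Fin m → Rn n → 𝕜) → Prop) (S : (Fin m → Rn n → 𝕜) → Rn n → ε)
    (Q : Fin m → ℝ) (w : Fin m → Rn n → ℝ) (P : Fin m → ℝ≥0∞) (A : Fin m → ℝ)
    (q : ℝ) (v : Rn n → ℝ) (p : ℝ≥0∞) (α : ℝ) (K : ℝ≥0∞) : Prop :=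
  ∀ f, 𝒟 f → (∀ j, MemAmalgam (Q j) (w j) (P j) (A j) (f j)) →
    MemAmalgam q v p α (S f) ∧
      amalgamNorm q v p α (S f) ≤ K * ∏ j, amalgamNorm (Q j) (w j) (P j) (A j) (f j)

end Operators

end Amalgam

end

/-!
Fix a ball `B = B(y,r)` and split every `fⱼ` into `fⱼ χ_{2B}` and `fⱼ χ_{ℝⁿ∖2B}`. Expanding the
operator in each argument bounds the commutator on `B` by its value on the tuple of the local parts
`fⱼ χ_{2B}`, to which the assumed boundedness on Lebesgue spaces applies, and by the terms
`|bⱼ - (bⱼ)_B| |T(f^σ)|` and `|T((…, (bⱼ - (bⱼ)_B) fⱼ, …)^σ)|` with `σ ≠ ∅`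
(`IsMultilinearOp.isCommutatorBound`, `IsSublinearOp.isCommutatorBound`). This expansion is all that
is used of the operator from then on, so that linear and sublinear operators are treated together.

The size condition bounds the latter terms by `∑ₖ k ∏ⱼ (avg_{2^{k+1}B} |fⱼ|^s)^{1/s}`, with one
factor `bⱼ - (bⱼ)_B` inserted where it occurs (`SizeCondition.le_tsum`). By Hölder's inequality and
the `A_{Q/s}` condition the product of averages over a ball `B'` is at most
`C ν(B')^{-1/q} ∏ⱼ ‖fⱼ χ_{B'}‖`, and a factor `b - c` costs `‖b‖_{BMO} + |b_{B'} - c|`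
(`prod_ballAvg_le`); for `c = b_B` and `B' = 2^{k+1}B` this is `O(k) ‖b‖_{BMO}`. The factor `b - c`
requires the John–Nirenberg inequality with respect to the dual weights `wⱼ^{1-(qⱼ/s)'}`, and the
factor `bⱼ - (bⱼ)_B` outside of the operator requires it with respect to `ν`.

These weights are of class `A_∞` in the quantitative sense of `IsAInfty`, which follows from Hölder's
inequality for the factorization of `1` into powers of `ν` and of the dual weights
(`MemMultiAp.isAInfty`). The weighted John–Nirenberg inequality is proved directly, without the
reverse Hölder inequality: `A_∞` implies that a subset of at most half of the volume of a dyadic cube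
has at most the proportion `θ < 1` of its measure, and the usual stopping time argument then gives
exponential decay of the level sets with respect to that measure
(`IsNestedPartition.measure_level_le`, `weighted_john_nirenberg`).

Finally, the local estimate is multiplied by `ν(B)^e` with `e = 1/α - 1/q - 1/p ≤ 0`. The
inequality `∏ⱼ wⱼ(B)^{q/qⱼ} ≤ C ν(B)`, where `wⱼ ∈ A_∞` enters (`prod_measure_ball_le`), turns
`ν(2^{k+1}B)^e` into a product of powers of the `wⱼ(2^{k+1}B)`, and the reverse doubling of `ν`
together with `1/α - 1/p > 0` provides a geometric factor `λ^k` (`rpow_mul_tailSum_le`). Taking the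
`L^p` norm in `y` with Hölder's inequality gives the theorem
(`boundedAmalgam_of_isCommutatorBound`).
-/

open MeasureTheory Metric Set
open scoped ENNReal NNReal

namespace Amalgam


/-! ### Balls and measures of Muckenhoupt type -/

section Balls

variable {n : ℕ}

lemma volume_ball_mul (y y' : Rn n) {c : ℝ} (hc : 0 < c) (r : ℝ) :
    volume (ball y (c * r)) = ENNReal.ofReal c ^ n * volume (ball y' r) := by
  rw [Measure.addHaar_ball_mul_of_pos volume y hc, ← Measure.addHaar_ball_center volume y' r,
    finrank_euclideanSpace_fin, ENNReal.ofReal_pow hc.le]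

lemma volume_ball_ne_zero (y : Rn n) {r : ℝ} (hr : 0 < r) : volume (ball y r) ≠ 0 :=
  (measure_ball_pos volume y hr).ne'

lemma volume_ball_ne_top (y : Rn n) (r : ℝ) : volume (ball y r) ≠ ∞ :=
  measure_ball_lt_top.ne

/-- A quantitative form of the `A_∞` property of a measure `μ`, symmetric enough to be read off
from a single application of Hölder's inequality: `|E| / |B| ≤ C (μ(E) / μ(B))^κ` for all balls
`B` and all measurable `E ⊆ B`. -/
structure IsAInfty (μ : Measure (Rn n)) : Prop where
  ac : μ ≪ volume
  pos : ∀ (y : Rn n) (r : ℝ), 0 < r → μ (ball y r) ≠ 0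
  fin : ∀ (y : Rn n) (r : ℝ), μ (ball y r) ≠ ∞
  cond : ∃ (C : ℝ≥0) (κ : ℝ), 0 < κ ∧ ∀ (y : Rn n) (r : ℝ), 0 < r → ∀ E ⊆ ball y r,
    MeasurableSet E → volume E * μ (ball y r) ^ κ ≤ C * volume (ball y r) * μ E ^ κ

namespace IsAInfty

variable {μ : Measure (Rn n)}

/-- Subsets of a ball which carry a fixed proportion of its volume carry a fixed proportion of its
`μ`-measure. -/
lemma measure_ball_le (h : IsAInfty μ) (δ : ℝ≥0) :
    ∃ K : ℝ≥0, ∀ (y : Rn n) (r : ℝ), 0 < r → ∀ E ⊆ ball y r, MeasurableSet E →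
      volume (ball y r) ≤ δ * volume E → μ (ball y r) ≤ K * μ E := by
  obtain ⟨C, κ, hκ, hC⟩ := h.cond
  refine ⟨(δ * C) ^ (1 / κ), fun y r hr E hE hEm hδ => ?_⟩
  have hB0 := volume_ball_ne_zero y hr
  have hBt := volume_ball_ne_top y r
  have h1 : volume (ball y r) * μ (ball y r) ^ κ ≤ volume (ball y r) * (δ * C * μ E ^ κ) :=
    calc volume (ball y r) * μ (ball y r) ^ κ ≤ δ * volume E * μ (ball y r) ^ κ := by gcongr
      _ = δ * (volume E * μ (ball y r) ^ κ) := by ring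
      _ ≤ δ * (C * volume (ball y r) * μ E ^ κ) := mul_le_mul_right (hC y r hr E hE hEm) _
      _ = _ := by ring
  have h2 := (ENNReal.mul_le_mul_iff_right hB0 hBt).1 h1
  have h3 := ENNReal.rpow_le_rpow h2 (z := 1 / κ) (by positivity)
  rw [ENNReal.mul_rpow_of_nonneg _ _ (by positivity), ← ENNReal.rpow_mul, ← ENNReal.rpow_mul,
    mul_one_div_cancel hκ.ne', ENNReal.rpow_one, ENNReal.rpow_one] at h3
  rw [ENNReal.coe_rpow_of_nonneg _ (by positivity)]
  exact_mod_cast h3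

lemma doubling (h : IsAInfty μ) {c : ℝ} (hc : 1 ≤ c) :
    ∃ K : ℝ≥0, ∀ (y : Rn n) (r : ℝ), 0 < r → μ (ball y (c * r)) ≤ K * μ (ball y r) := by
  obtain ⟨K, hK⟩ := h.measure_ball_le (Real.toNNReal c ^ n)
  have hc0 : 0 < c := by linarith
  refine ⟨K, fun y r hr => hK y _ (by positivity) _ (ball_subset_ball (by nlinarith))
    measurableSet_ball ?_⟩
  rw [volume_ball_mul y y hc0]
  simp [ENNReal.ofReal]

/-- If a set `Q` is comparable to a ball, then removing a subset of at most half of its volume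
leaves a fixed proportion of its `μ`-measure. -/
lemma half (h : IsAInfty μ) (δ : ℝ≥0) :
    ∃ θ : ℝ≥0, θ < 1 ∧ ∀ (y : Rn n) (r : ℝ), 0 < r → ∀ Q ⊆ ball y r, MeasurableSet Q →
      volume (ball y r) ≤ δ * volume Q → ∀ E ⊆ Q, MeasurableSet E → 2 * volume E ≤ volume Q →
      μ E ≤ θ * μ Q := by
  obtain ⟨K, hK⟩ := h.measure_ball_le (δ * 2)
  refine ⟨1 - (K + 1)⁻¹, tsub_lt_self one_pos (by positivity),
    fun y r hr Q hQ hQm hδ E hE hEm h2 => ?_⟩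
  have hEt : volume E ≠ ∞ := ne_top_of_le_ne_top (volume_ball_ne_top y r)
    (measure_mono (hE.trans hQ))
  have hd : volume Q = volume E + volume (Q \ E) := by
    rw [← measure_inter_add_sdiff Q hEm, inter_eq_self_of_subset_right hE]
  have hμd : μ Q = μ E + μ (Q \ E) := by
    rw [← measure_inter_add_sdiff Q hEm, inter_eq_self_of_subset_right hE]
  have h3 : volume Q ≤ 2 * volume (Q \ E) := by
    have : volume E ≤ volume (Q \ E) := by
      rw [hd, two_mul] at h2
      exact (ENNReal.add_le_add_iff_left hEt).1 h2
    rw [hd, two_mul]; gcongr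
  have h4 := hK y r hr (Q \ E) (sdiff_subset.trans hQ) (hQm.diff hEm) (by
    push_cast
    rw [mul_assoc]
    exact hδ.trans (by gcongr))
  have h5 : μ Q ≤ (K + 1 : ℝ≥0) * μ (Q \ E) :=
    (measure_mono hQ).trans (h4.trans (by gcongr; simp))
  have h6 : ((K + 1)⁻¹ : ℝ≥0) * μ Q ≤ μ (Q \ E) := by
    calc (((K + 1)⁻¹ : ℝ≥0) : ℝ≥0∞) * μ Q
        ≤ ((K + 1)⁻¹ : ℝ≥0) * ((K + 1 : ℝ≥0) * μ (Q \ E)) := by gcongr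
      _ = μ (Q \ E) := by
        rw [← mul_assoc, ← ENNReal.coe_mul, inv_mul_cancel₀ (by positivity), ENNReal.coe_one,
          one_mul]
  have hQt : μ Q ≠ ∞ := ne_top_of_le_ne_top (h.fin y r) (measure_mono hQ)
  rw [ENNReal.coe_sub, ENNReal.coe_one, ENNReal.sub_mul (fun _ _ => hQt), one_mul]
  refine ENNReal.le_sub_of_add_le_right (ENNReal.mul_ne_top ENNReal.coe_ne_top hQt) ?_
  rw [hμd] at h6 ⊢
  gcongr

/-- Reverse doubling: `μ(B(y,r)) ≤ θ μ(B(y,2r))` with `θ < 1`. -/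
lemma reverse_doubling (h : IsAInfty μ) (hn : 1 ≤ n) :
    ∃ θ : ℝ≥0, θ < 1 ∧ ∀ (y : Rn n) (r : ℝ), 0 < r → ∀ k : ℕ,
      μ (ball y r) ≤ θ ^ k * μ (ball y (2 ^ k * r)) := by
  obtain ⟨θ, hθ, H⟩ := h.half 1
  refine ⟨θ, hθ, fun y r hr k => ?_⟩
  induction k with
  | zero => simp
  | succ k ih =>
    refine ih.trans ?_
    rw [pow_succ, mul_assoc]
    gcongr
    have := H y (2 * (2 ^ k * r)) (by positivity) _ subset_rfl measurableSet_ball (by simp)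
      (ball y (2 ^ k * r)) (ball_subset_ball (by nlinarith [show 0 < 2 ^ k * r by positivity]))
      measurableSet_ball (by
        rw [volume_ball_mul y y two_pos]
        gcongr
        simpa using pow_le_pow_right₀ (a := (2 : ℝ≥0∞)) (by norm_num) hn)
    rwa [← mul_assoc, ← pow_succ'] at this
end IsAInfty

end Balls


/-! ### The John–Nirenberg inequality for nested partitions -/

section Nested

variable {X ι F : Type*} [MeasurableSpace X] [NormedAddCommGroup F]

/-- A sequence of measurable partitions of `X`, each of which refines the preceding one. -/
structure IsNestedPartition (Q : ℕ → ι → Set X) : Prop where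
  meas : ∀ k z, MeasurableSet (Q k z)
  disj : ∀ k z z' x, x ∈ Q k z → x ∈ Q k z' → z = z'
  cover : ∀ k x, ∃ z, x ∈ Q k z
  nest : ∀ k z, ∃ z', Q (k + 1) z ⊆ Q k z'

namespace IsNestedPartition

variable {Q : ℕ → ι → Set X}

lemma exists_superset (hQ : IsNestedPartition Q) {k l : ℕ} (hkl : k ≤ l) (u : ι) :
    ∃ z, Q l u ⊆ Q k z := by
  induction l, hkl using Nat.le_induction generalizing u with
  | base => exact ⟨u, subset_rfl⟩
  | succ l _ ih =>
    obtain ⟨z, hz⟩ := hQ.nest l u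
    obtain ⟨z', hz'⟩ := ih z
    exact ⟨z', hz.trans hz'⟩

lemma subset_of_mem (hQ : IsNestedPartition Q) {k l : ℕ} (hkl : k ≤ l) {u z : ι} {x : X}
    (hx : x ∈ Q l u) (hx' : x ∈ Q k z) : Q l u ⊆ Q k z := by
  obtain ⟨z', hz'⟩ := hQ.exists_superset hkl u
  rwa [hQ.disj k z z' x hx' (hz' hx)]

/-- The John–Nirenberg inequality, with respect to a measure `μ` whose only relation to the
underlying measure `ν` is that a set occupying at most half of a cell (as measured by `ν`) has at
most the proportion `θ` of its `μ`-measure. The level set at height `(N + 1) L` over a cell is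
contained, up to a null set, in the union of the maximal subcells on which `‖b - c‖` has average
larger than `2 M`; these fill at most half of the cell, and on each of them the level set is
controlled by the one at height `N L`. -/
theorem measure_level_le [Countable ι] (hQ : IsNestedPartition Q) {ν μ : Measure X}
    (hν0 : ∀ k z, ν (Q k z) ≠ 0) (hνt : ∀ k z, ν (Q k z) ≠ ∞) {K θ M : ℝ≥0} (hM : 0 < M)
    (hchild : ∀ k z z', Q (k + 1) z ⊆ Q k z' → ν (Q k z') ≤ K * ν (Q (k + 1) z))
    (hhalf : ∀ k z, ∀ E ⊆ Q k z, MeasurableSet E → 2 * ν E ≤ ν (Q k z) → μ E ≤ θ * μ (Q k z))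
    {b : X → F} (hb : AEStronglyMeasurable b ν) {c : ℕ → ι → F}
    (hosc : ∀ k z, ∫⁻ x in Q k z, ‖b x - c k z‖ₑ ∂ν ≤ M * ν (Q k z))
    (hdiff : ∀ᵐ x ∂μ, ∀ (a : F) (k : ℕ) (lam : ℝ≥0), (∀ l, k ≤ l → ∀ z, x ∈ Q l z →
      ∫⁻ y in Q l z, ‖b y - a‖ₑ ∂ν ≤ lam * ν (Q l z)) → ‖b x - a‖ₑ ≤ lam)
    (N k : ℕ) (z : ι) :
    μ {x ∈ Q k z | ((N * ((2 * K + 2) * M) : ℝ≥0) : ℝ≥0∞) < ‖b x - c k z‖ₑ} ≤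
      θ ^ N * μ (Q k z) := by
  induction N generalizing k z with
  | zero => simpa using measure_mono (sep_subset _ _)
  | succ N ih =>
    set I : Set (ℕ × ι) := {p | k ≤ p.1 ∧ Q p.1 p.2 ⊆ Q k z ∧
      ((2 * M : ℝ≥0) : ℝ≥0∞) * ν (Q p.1 p.2) < ∫⁻ y in Q p.1 p.2, ‖b y - c k z‖ₑ ∂ν ∧
      ∀ l u, k ≤ l → l < p.1 → Q p.1 p.2 ⊆ Q l u →
        ∫⁻ y in Q l u, ‖b y - c k z‖ₑ ∂ν ≤ (2 * M : ℝ≥0) * ν (Q l u)}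
    have hdisj : Pairwise (Function.onFun Disjoint fun p : I => Q p.1.1 p.1.2) := by
      have key : ∀ p q : I, p ≠ q → p.1.1 ≤ q.1.1 → Disjoint (Q p.1.1 p.1.2) (Q q.1.1 q.1.2) := by
        rintro ⟨⟨l, u⟩, hp⟩ ⟨⟨l', u'⟩, hq⟩ hpq hle
        refine Set.disjoint_left.2 fun x hx hx' => ?_
        rcases hle.eq_or_lt with h | h
        · simp only at h
          subst h
          exact hpq (by rw [Subtype.mk.injEq, hQ.disj l u u' x hx hx'])
        · exact (hp.2.2.1.trans_le (hq.2.2.2 l u hp.1 h (hQ.subset_of_mem hle hx' hx))).false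
      intro p q hpq
      rcases le_total p.1.1 q.1.1 with h | h
      · exact key p q hpq h
      · exact (key q p hpq.symm h).symm
    have hUm : MeasurableSet (⋃ p : I, Q p.1.1 p.1.2) := .iUnion fun p => hQ.meas _ _
    have hUsub : (⋃ p : I, Q p.1.1 p.1.2) ⊆ Q k z := iUnion_subset fun p => p.2.2.1
    -- the selected cells fill at most half of `Q k z`
    have hU : μ (⋃ p : I, Q p.1.1 p.1.2) ≤ θ * μ (Q k z) := by
      refine hhalf k z _ hUsub hUm ?_
      have hM' : (M : ℝ≥0∞) ≠ 0 := by simpa using hM.ne'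
      refine (ENNReal.mul_le_mul_iff_right hM' ENNReal.coe_ne_top).1 ?_
      calc (M : ℝ≥0∞) * (2 * ν (⋃ p : I, Q p.1.1 p.1.2))
          = ∑' p : I, ((2 * M : ℝ≥0) : ℝ≥0∞) * ν (Q p.1.1 p.1.2) := by
            rw [measure_iUnion hdisj fun p => hQ.meas _ _, ENNReal.tsum_mul_left]
            push_cast; ring
        _ ≤ ∑' p : I, ∫⁻ y in Q p.1.1 p.1.2, ‖b y - c k z‖ₑ ∂ν :=
            ENNReal.tsum_le_tsum fun p => p.2.2.2.1.le
        _ = ∫⁻ y in ⋃ p : I, Q p.1.1 p.1.2, ‖b y - c k z‖ₑ ∂ν :=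
            (lintegral_iUnion (fun p : I => hQ.meas _ _) hdisj _).symm
        _ ≤ ∫⁻ y in Q k z, ‖b y - c k z‖ₑ ∂ν := lintegral_mono_set hUsub
        _ ≤ M * ν (Q k z) := hosc k z
    -- the constants attached to a selected cell and to `Q k z` are close
    have hc : ∀ p : I, ‖c p.1.1 p.1.2 - c k z‖ₑ ≤ ((2 * K + 2) * M : ℝ≥0) := by
      rintro ⟨⟨l, u⟩, hkl, hsub, hgt, hanc⟩
      simp only at hkl hsub hgt hanc ⊢
      have hlt : k < l := by
        refine lt_of_le_of_ne hkl fun h => ?_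
        subst h
        obtain ⟨x, hx⟩ := nonempty_of_measure_ne_zero (hν0 k u)
        rw [hQ.disj k u z x hx (hsub hx)] at hgt
        refine (hgt.trans_le ((hosc k z).trans ?_)).false
        gcongr
        exact_mod_cast le_mul_of_one_le_left hM.le one_le_two
      obtain ⟨l, rfl⟩ : ∃ l', l = l' + 1 := ⟨l - 1, by omega⟩
      obtain ⟨v, hv⟩ := hQ.nest l u
      have h1 : ∫⁻ y in Q (l + 1) u, ‖b y - c k z‖ₑ ∂ν ≤ (2 * M : ℝ≥0) * (K * ν (Q (l + 1) u)) :=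
        (lintegral_mono_set hv).trans ((hanc l v (by omega) (by omega) hv).trans
          (mul_le_mul_right (hchild l u v hv) _))
      have h2 : ‖c (l + 1) u - c k z‖ₑ * ν (Q (l + 1) u) ≤
          ((2 * K + 2) * M : ℝ≥0) * ν (Q (l + 1) u) := by
        calc ‖c (l + 1) u - c k z‖ₑ * ν (Q (l + 1) u)
            = ∫⁻ y in Q (l + 1) u, ‖c (l + 1) u - c k z‖ₑ ∂ν := by simp
          _ ≤ ∫⁻ y in Q (l + 1) u, (‖b y - c (l + 1) u‖ₑ + ‖b y - c k z‖ₑ) ∂ν := by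
              refine lintegral_mono fun y => ?_
              rw [show c (l + 1) u - c k z = (b y - c k z) - (b y - c (l + 1) u) by abel,
                add_comm ‖b y - c (l + 1) u‖ₑ]
              exact enorm_sub_le (E := F)
          _ = ∫⁻ y in Q (l + 1) u, ‖b y - c (l + 1) u‖ₑ ∂ν + ∫⁻ y in Q (l + 1) u, ‖b y - c k z‖ₑ ∂ν :=
              lintegral_add_left' (hb.restrict.sub aestronglyMeasurable_const).enorm _
          _ ≤ M * ν (Q (l + 1) u) + (2 * M : ℝ≥0) * (K * ν (Q (l + 1) u)) := by
              gcongr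
              exact hosc _ _
          _ = ((2 * K + 1) * M : ℝ≥0) * ν (Q (l + 1) u) := by push_cast; ring
          _ ≤ _ := by gcongr; norm_num
      exact (ENNReal.mul_le_mul_iff_left (hν0 _ _) (hνt _ _)).1 h2
    have hcov : {x ∈ Q k z | (((N + 1 : ℕ) * ((2 * K + 2) * M) : ℝ≥0) : ℝ≥0∞) < ‖b x - c k z‖ₑ}
        ≤ᵐ[μ] ⋃ p : I, {x ∈ Q p.1.1 p.1.2 |
          ((N * ((2 * K + 2) * M) : ℝ≥0) : ℝ≥0∞) < ‖b x - c p.1.1 p.1.2‖ₑ} := by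
      filter_upwards [hdiff] with x hx hmem
      obtain ⟨hxQ, hxlt⟩ := hmem
      have hex : ∃ l, k ≤ l ∧ ∃ u, x ∈ Q l u ∧
          ((2 * M : ℝ≥0) : ℝ≥0∞) * ν (Q l u) < ∫⁻ y in Q l u, ‖b y - c k z‖ₑ ∂ν := by
        by_contra! hcon
        refine (hxlt.trans_le ((hx (c k z) k (2 * M) fun l hl u hu => hcon l hl u hu).trans ?_)).false
        rw [ENNReal.coe_le_coe]
        calc 2 * M = (0 + 1) * ((0 + 2) * M) := by ring
          _ ≤ ((N + 1 : ℕ) : ℝ≥0) * ((2 * K + 2) * M) := by push_cast; gcongr <;> positivity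
      classical
      obtain ⟨hkl, u, hu, hgt⟩ := Nat.find_spec hex
      have hp : (Nat.find hex, u) ∈ I := by
        refine ⟨hkl, hQ.subset_of_mem hkl hu hxQ, hgt, fun l v hl hlt hsub => ?_⟩
        by_contra! hcon
        exact Nat.find_min hex hlt ⟨hl, v, hsub hu, hcon⟩
      refine mem_iUnion.2 ⟨⟨_, hp⟩, hu, ?_⟩
      have h1 : ‖b x - c k z‖ₑ ≤ ‖b x - c (Nat.find hex) u‖ₑ + ((2 * K + 2) * M : ℝ≥0) := by
        refine le_trans ?_ (add_le_add_right (hc ⟨_, hp⟩) _)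
        rw [show b x - c k z = (b x - c (Nat.find hex) u) + (c (Nat.find hex) u - c k z) by abel]
        exact enorm_add_le _ _
      have h2 := hxlt.trans_le h1
      rw [Nat.cast_succ, add_mul, one_mul, ENNReal.coe_add] at h2
      exact (ENNReal.add_lt_add_iff_right ENNReal.coe_ne_top).1 h2
    calc _ ≤ μ (⋃ p : I, {x ∈ Q p.1.1 p.1.2 |
          ((N * ((2 * K + 2) * M) : ℝ≥0) : ℝ≥0∞) < ‖b x - c p.1.1 p.1.2‖ₑ}) := measure_mono_ae hcov
      _ ≤ ∑' p : I, μ {x ∈ Q p.1.1 p.1.2 |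
          ((N * ((2 * K + 2) * M) : ℝ≥0) : ℝ≥0∞) < ‖b x - c p.1.1 p.1.2‖ₑ} := measure_iUnion_le _
      _ ≤ ∑' p : I, θ ^ N * μ (Q p.1.1 p.1.2) := ENNReal.tsum_le_tsum fun p => ih _ _
      _ = θ ^ N * μ (⋃ p : I, Q p.1.1 p.1.2) := by
        rw [ENNReal.tsum_mul_left, measure_iUnion hdisj fun p => hQ.meas _ _]
      _ ≤ θ ^ N * (θ * μ (Q k z)) := by gcongr
      _ = θ ^ (N + 1) * μ (Q k z) := by ring

end IsNestedPartition

/-- Exponential decay of the distribution function bounds all moments. -/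
lemma lintegral_rpow_le_of_level {μ : Measure X} {S : Set X} (hS : MeasurableSet S)
    {g : X → ℝ≥0∞} (hg : AEMeasurable g μ) (hgt : ∀ x, g x ≠ ∞) {L θ : ℝ≥0} (hL : 0 < L)
    (h : ∀ N : ℕ, μ {x ∈ S | ((N * L : ℝ≥0) : ℝ≥0∞) < g x} ≤ θ ^ N * μ S) {u : ℝ} (hu : 0 < u) :
    ∫⁻ x in S, g x ^ u ∂μ ≤ (∑' N : ℕ, ((N + 1 : ℕ) : ℝ≥0∞) ^ u * θ ^ N) * L ^ u * μ S := by
  have hm : ∀ N : ℕ, NullMeasurableSet {x | ((N * L : ℝ≥0) : ℝ≥0∞) < g x} (μ.restrict S) :=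
    fun N => nullMeasurableSet_lt aemeasurable_const hg.restrict
  calc ∫⁻ x in S, g x ^ u ∂μ
      ≤ ∫⁻ x in S, ∑' N : ℕ, {x | ((N * L : ℝ≥0) : ℝ≥0∞) < g x}.indicator
          (fun _ => (((N + 1 : ℕ) : ℝ≥0∞) * L) ^ u) x ∂μ := by
        refine lintegral_mono fun x => ?_
        rcases eq_or_ne (g x) 0 with h0 | h0
        · simp [h0, hu]
        lift g x to ℝ≥0 using hgt x with t ht
        have ht0 : 0 < t := pos_iff_ne_zero.2 (by simpa using h0)
        obtain ⟨N, hN⟩ : ∃ N : ℕ, ⌈t / L⌉₊ = N + 1 :=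
          ⟨⌈t / L⌉₊ - 1, by have := Nat.ceil_pos.2 (div_pos ht0 hL); omega⟩
        refine le_trans ?_ (ENNReal.le_tsum N)
        have h1 : (N : ℝ≥0) < t / L := Nat.lt_ceil.1 (by omega)
        have h2 : t / L ≤ (N + 1 : ℕ) := by rw [← hN]; exact Nat.le_ceil _
        rw [indicator_of_mem]
        · refine ENNReal.rpow_le_rpow ?_ hu.le
          rw [div_le_iff₀ hL] at h2
          exact_mod_cast h2
        · rw [mem_ofPred_eq, ← ht]
          rw [lt_div_iff₀ hL] at h1
          exact_mod_cast h1
    _ = ∑' N : ℕ, (((N + 1 : ℕ) : ℝ≥0∞) * L) ^ u *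
          (μ.restrict S) {x | ((N * L : ℝ≥0) : ℝ≥0∞) < g x} := by
        rw [lintegral_tsum fun N => (aemeasurable_const.indicator₀ (hm N))]
        simp_rw [lintegral_indicator_const₀ (hm _)]
    _ ≤ ∑' N : ℕ, (((N + 1 : ℕ) : ℝ≥0∞) ^ u * θ ^ N) * (L ^ u * μ S) := by
        refine ENNReal.tsum_le_tsum fun N => ?_
        rw [Measure.restrict_apply' hS, inter_comm, ENNReal.mul_rpow_of_nonneg _ _ hu.le]
        calc _ ≤ ((N + 1 : ℕ) : ℝ≥0∞) ^ u * L ^ u * (θ ^ N * μ S) := mul_le_mul_right (h N) _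
          _ = _ := by ring
    _ = _ := by rw [ENNReal.tsum_mul_right, mul_assoc]

lemma summable_moment {θ : ℝ≥0} (hθ : θ < 1) (u : ℝ) :
    ∑' N : ℕ, ((N + 1 : ℕ) : ℝ≥0∞) ^ u * (θ : ℝ≥0∞) ^ N ≠ ∞ := by
  have h1 : Summable fun N : ℕ => ((N + 1 : ℕ) : ℝ) ^ (⌈u⌉₊ : ℕ) * (θ : ℝ) ^ N := by
    rcases eq_or_ne θ 0 with rfl | h0
    · refine summable_of_ne_finset_zero (s := {0}) fun N hN => ?_
      simp at hN
      simp [hN]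
    have := (summable_nat_add_iff 1).2 (summable_pow_mul_geometric_of_norm_lt_one ⌈u⌉₊
      (r := (θ : ℝ)) (by simpa using hθ))
    refine (this.mul_left ((θ : ℝ)⁻¹)).congr fun N => ?_
    have : (θ : ℝ) ≠ 0 := by exact_mod_cast h0
    field_simp
    ring
  have h2 : Summable fun N : ℕ => ((N + 1 : ℕ) : ℝ≥0) ^ (⌈u⌉₊ : ℕ) * θ ^ N := by
    rw [← NNReal.summable_coe]; push_cast at h1 ⊢; exact h1
  refine ne_top_of_le_ne_top (ENNReal.tsum_coe_ne_top_iff_summable.2 h2)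
    (ENNReal.tsum_le_tsum fun N => ?_)
  push_cast
  gcongr
  rw [← ENNReal.rpow_natCast]
  exact ENNReal.rpow_le_rpow_of_exponent_le (by simp) (Nat.le_ceil u)

end Nested


/-! ### Dyadic grids and the weighted John–Nirenberg inequality -/

section Grid

variable {n : ℕ}

/-- The cells of generation `k` of the dyadic grid of mesh `ℓ` that has `a` as a vertex. -/
def gridCell (a : Rn n) (ℓ : ℝ) (k : ℕ) (z : Fin n → ℤ) : Set (Rn n) :=
  {x | ∀ i, ⌊2 ^ k * ((x i - a i) / ℓ)⌋ = z i}

/-- The centre of a grid cell. -/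
noncomputable def gridCenter (a : Rn n) (ℓ : ℝ) (k : ℕ) (z : Fin n → ℤ) : Rn n :=
  WithLp.toLp 2 fun i => a i + (z i + 1 / 2) * (ℓ / 2 ^ k)

lemma isNestedPartition_gridCell (a : Rn n) (ℓ : ℝ) : IsNestedPartition (gridCell a ℓ) where
  meas k z := by
    simp only [gridCell, ofPred_forall]
    refine .iInter fun i => ?_
    have : Measurable fun x : Rn n => ⌊2 ^ k * ((x i - a i) / ℓ)⌋ := by
      refine Int.measurable_floor.comp ?_
      fun_prop
    exact this (measurableSet_singleton _)
  disj k z z' x hx hx' := funext fun i => (hx i).symm.trans (hx' i)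
  cover k x := ⟨_, fun i => rfl⟩
  nest k z := by
    refine ⟨fun i => z i / 2, fun x hx i => ?_⟩
    simp only [← hx i]
    have := Int.floor_div_natCast (2 ^ (k + 1) * ((x i - a i) / ℓ)) 2
    push_cast at this
    rw [← this]
    congr 1
    ring

lemma ball_subset_gridCell (a : Rn n) {ℓ : ℝ} (hℓ : 0 < ℓ) (k : ℕ) (z : Fin n → ℤ) :
    ball (gridCenter a ℓ k z) (ℓ / 2 ^ k / 2) ⊆ gridCell a ℓ k z := by
  intro x hx i
  have h1 : |x i - gridCenter a ℓ k z i| < ℓ / 2 ^ k / 2 := by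
    refine lt_of_le_of_lt ?_ (mem_ball_iff_norm.1 hx)
    simpa using PiLp.norm_apply_le (x - gridCenter a ℓ k z) i
  have h2 : gridCenter a ℓ k z i = a i + (z i + 1 / 2) * (ℓ / 2 ^ k) := rfl
  rw [h2] at h1
  have hd : 0 < ℓ / 2 ^ k := by positivity
  have h3 : 2 ^ k * ((x i - a i) / ℓ) = (x i - a i) / (ℓ / 2 ^ k) := by field_simp
  rw [abs_lt] at h1
  rw [Int.floor_eq_iff, h3, le_div_iff₀ hd, div_lt_iff₀ hd]
  constructor <;> nlinarith

lemma gridCell_subset_ball (hn : 1 ≤ n) (a : Rn n) {ℓ : ℝ} (hℓ : 0 < ℓ) (k : ℕ)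
    (z : Fin n → ℤ) :
    gridCell a ℓ k z ⊆ ball (gridCenter a ℓ k z) (2 * n * (ℓ / 2 ^ k / 2)) := by
  intro x hx
  have hd : 0 < ℓ / 2 ^ k := by positivity
  have h1 : ∀ i, ‖(x - gridCenter a ℓ k z) i‖ ≤ ℓ / 2 ^ k / 2 := by
    intro i
    have h2 : gridCenter a ℓ k z i = a i + (z i + 1 / 2) * (ℓ / 2 ^ k) := rfl
    have h3 : 2 ^ k * ((x i - a i) / ℓ) = (x i - a i) / (ℓ / 2 ^ k) := by field_simp
    have h4 := hx i
    rw [Int.floor_eq_iff, h3, le_div_iff₀ hd, div_lt_iff₀ hd] at h4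
    rw [PiLp.sub_apply, h2, Real.norm_eq_abs, abs_le]
    constructor <;> nlinarith
  have hn' : (1 : ℝ) ≤ n := by exact_mod_cast hn
  have h5 : ‖x - gridCenter a ℓ k z‖ ≤ n * (ℓ / 2 ^ k / 2) := by
    rw [EuclideanSpace.norm_eq]
    refine Real.sqrt_le_iff.2 ⟨by positivity, ?_⟩
    calc ∑ i, ‖(x - gridCenter a ℓ k z) i‖ ^ 2 ≤ ∑ i : Fin n, (ℓ / 2 ^ k / 2) ^ 2 := by
          gcongr with i; exact h1 i
      _ = n * (ℓ / 2 ^ k / 2) ^ 2 := by simp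
      _ ≤ n * n * (ℓ / 2 ^ k / 2) ^ 2 := by gcongr; nlinarith
      _ = _ := by ring
  rw [mem_ball_iff_norm]
  refine h5.trans_lt ?_
  nlinarith [mul_pos (by linarith : (0 : ℝ) < n) hd]

/-- Grid cells are comparable to balls. -/
lemma volume_ball_le_gridCell (a : Rn n) {ℓ : ℝ} (hℓ : 0 < ℓ) (k : ℕ)
    (z : Fin n → ℤ) (y : Rn n) {c : ℝ} (hc : 0 < c) :
    volume (ball y (c * (ℓ / 2 ^ k / 2))) ≤
      ((Real.toNNReal c ^ n : ℝ≥0) : ℝ≥0∞) * volume (gridCell a ℓ k z) := by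
  rw [volume_ball_mul y (gridCenter a ℓ k z) hc]
  push_cast
  exact mul_le_mul_right (measure_mono (ball_subset_gridCell a hℓ k z)) _

end Grid

section Oscillation

variable {𝕜 : Type*} [RCLike 𝕜] {n : ℕ}

lemma lintegral_sub_average_le (b : Rn n → 𝕜) (y : Rn n) {r : ℝ} (hr : 0 < r) :
    ∫⁻ x in ball y r, ‖b x - ⨍ z in ball y r, b z‖ₑ ≤ bmoNorm b * volume (ball y r) := by
  have h : ⨍⁻ x in ball y r, ‖b x - ⨍ z in ball y r, b z ∂volume‖ₑ ∂volume ≤ bmoNorm b := by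
    refine le_trans ?_ (le_iSup _ y)
    refine le_trans ?_ (le_iSup _ r)
    exact le_iSup_of_le hr le_rfl
  rw [setLAverage_eq] at h
  rwa [ENNReal.div_le_iff (volume_ball_ne_zero y hr) (volume_ball_ne_top y r)] at h

lemma integrableOn_ball {b : Rn n → 𝕜} (hb : LocallyIntegrable b volume) (y : Rn n) (r : ℝ) :
    IntegrableOn b (ball y r) volume :=
  (hb.integrableOn_isCompact (isCompact_closedBall y r)).mono_set ball_subset_closedBall

/-- A mean value differs from a constant `c` by at most the mean oscillation about `c`. -/
lemma enorm_average_sub_mul_le {b : Rn n → 𝕜} (hb : LocallyIntegrable b volume) (y : Rn n) (r : ℝ)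
    (c : 𝕜) :
    ‖(⨍ z in ball y r, b z) - c‖ₑ * volume (ball y r) ≤ ∫⁻ x in ball y r, ‖b x - c‖ₑ := by
  have hBt := volume_ball_ne_top y r
  have hi := integrableOn_ball hb y r
  have h1 : (volume.real (ball y r)) • ((⨍ z in ball y r, b z) - c) =
      ∫ x in ball y r, (b x - c) := by
    rw [integral_sub hi (integrableOn_const hBt), smul_sub, measure_smul_setAverage _ hBt,
      setIntegral_const]
  have h2 := enorm_integral_le_lintegral_enorm (μ := volume.restrict (ball y r))
    (fun x => b x - c)
  rw [← h1, enorm_smul] at h2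
  refine le_trans (le_of_eq ?_) h2
  rw [mul_comm]
  congr 1
  rw [Real.enorm_eq_ofReal measureReal_nonneg, ofReal_measureReal hBt]

/-- The mean values over a ball and over a larger ball. -/
lemma enorm_average_sub_average_le {b : Rn n → 𝕜} (hb : LocallyIntegrable b volume) {y y' : Rn n}
    {r c : ℝ} (hr : 0 < r) (hc : 0 < c) (h : ball y r ⊆ ball y' (c * r)) :
    ‖(⨍ z in ball y r, b z) - ⨍ z in ball y' (c * r), b z‖ₑ ≤ ENNReal.ofReal c ^ n * bmoNorm b := by
  have h1 := (enorm_average_sub_mul_le hb y r (⨍ z in ball y' (c * r), b z)).trans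
    ((lintegral_mono_set h).trans (lintegral_sub_average_le b y' (by positivity)))
  rw [volume_ball_mul y' y hc, ← mul_assoc] at h1
  rw [mul_comm (ENNReal.ofReal c ^ n)]
  exact (ENNReal.mul_le_mul_iff_left (volume_ball_ne_zero y hr) (volume_ball_ne_top y r)).1 h1

lemma enorm_average_sub_average_pow_le {b : Rn n → 𝕜} (hb : LocallyIntegrable b volume) (y : Rn n)
    {r : ℝ} (hr : 0 < r) (k : ℕ) :
    ‖(⨍ z in ball y r, b z) - ⨍ z in ball y (2 ^ k * r), b z‖ₑ ≤ k * (2 ^ n * bmoNorm b) := by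
  induction k with
  | zero => simp
  | succ k ih =>
    have h1 := enorm_average_sub_average_le hb (y := y) (y' := y) (r := 2 ^ k * r) (c := 2)
      (by positivity) two_pos (ball_subset_ball (by nlinarith [show 0 < 2 ^ k * r by positivity]))
    rw [← mul_assoc, ← pow_succ'] at h1
    rw [← sub_add_sub_cancel _ (⨍ z in ball y (2 ^ k * r), b z) _]
    refine (enorm_add_le _ _).trans ?_
    rw [Nat.cast_succ, add_mul, one_mul]
    gcongr
    simpa using h1

/-- Lebesgue points for averages over grid cells. -/
lemma ae_enorm_sub_le_of_gridCell (hn : 1 ≤ n) {b : Rn n → 𝕜} (hb : LocallyIntegrable b volume)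
    (a : Rn n) {ℓ : ℝ} (hℓ : 0 < ℓ) :
    ∀ᵐ x, ∀ (d : 𝕜) (k : ℕ) (lam : ℝ≥0), (∀ l, k ≤ l → ∀ z, x ∈ gridCell a ℓ l z →
      ∫⁻ y in gridCell a ℓ l z, ‖b y - d‖ₑ ≤ lam * volume (gridCell a ℓ l z)) →
      ‖b x - d‖ₑ ≤ lam := by
  filter_upwards [IsUnifLocDoublingMeasure.ae_tendsto_average_norm_sub volume hb 1]
    with x hx d k lam H
  have hn' : (0 : ℝ) < n := by exact_mod_cast hn
  set δ : ℕ → ℝ := fun l => 4 * n * (ℓ / 2 ^ l / 2) with hδ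
  have hδpos : ∀ l, 0 < δ l := fun l => by positivity
  have hδlim : Filter.Tendsto δ Filter.atTop (nhdsWithin 0 (Ioi 0)) := by
    refine tendsto_nhdsWithin_iff.2 ⟨?_, Filter.Eventually.of_forall hδpos⟩
    have := (tendsto_pow_atTop_nhds_zero_of_lt_one (r := (1 / 2 : ℝ)) (by norm_num)
      (by norm_num)).const_mul (4 * n * (ℓ / 2))
    rw [mul_zero] at this
    refine this.congr fun l => ?_
    simp only [hδ, one_div, inv_pow]
    ring
  have hlim := hx (fun _ => x) δ hδlim (Filter.Eventually.of_forall fun l => by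
    simp [(hδpos l).le])
  have hlim' : Filter.Tendsto (fun l => ((4 * n : ℝ) ^ n) *
      ⨍ y in closedBall x (δ l), ‖b y - b x‖) Filter.atTop (nhds 0) := by
    simpa using hlim.const_mul ((4 * n : ℝ) ^ n)
  refine ENNReal.le_of_forall_pos_le_add fun ε hε _ => ?_
  obtain ⟨l, hlε, hkl⟩ := ((hlim'.eventually_le_const (show (0 : ℝ) < ε from hε)).and
    (Filter.eventually_ge_atTop k)).exists
  obtain ⟨z, hz⟩ := (isNestedPartition_gridCell a ℓ).cover l x
  set Q := gridCell a ℓ l z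
  have hcc : volume (closedBall x (δ l)) = volume (ball x (δ l)) :=
    Measure.addHaar_closedBall volume x (hδpos l).le |>.trans
      (Measure.addHaar_ball_of_pos volume x (hδpos l)).symm
  have hct : volume (closedBall x (δ l)) ≠ ∞ := measure_closedBall_lt_top.ne
  have hc0 : volume (closedBall x (δ l)) ≠ 0 := by
    rw [hcc]; exact volume_ball_ne_zero x (hδpos l)
  have hQsub : Q ⊆ closedBall x (δ l) := by
    intro y hy
    have h1 := gridCell_subset_ball hn a hℓ l z hy
    have h2 := gridCell_subset_ball hn a hℓ l z hz
    rw [mem_closedBall]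
    rw [mem_ball] at h1 h2
    rw [dist_comm] at h2
    refine (dist_triangle _ _ _).trans ((add_lt_add h1 h2).le.trans (le_of_eq ?_))
    simp only [hδ]
    ring
  have hQvol : volume (closedBall x (δ l)) ≤ ((Real.toNNReal (4 * n) ^ n : ℝ≥0) : ℝ≥0∞) * volume Q := by
    rw [hcc]
    exact volume_ball_le_gridCell a hℓ l z x (by positivity)
  have hQ0 : volume Q ≠ 0 := fun h => hc0 (by simpa [h] using hQvol)
  have hQt : volume Q ≠ ∞ := ne_top_of_le_ne_top hct (measure_mono hQsub)
  have hint : IntegrableOn (fun y => ‖b y - b x‖) (closedBall x (δ l)) volume :=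
    ((hb.integrableOn_isCompact (isCompact_closedBall x _)).sub (integrableOn_const hct)).norm
  have hosc : ∫⁻ y in Q, ‖b y - b x‖ₑ ≤ ε * volume Q := by
    calc ∫⁻ y in Q, ‖b y - b x‖ₑ ≤ ∫⁻ y in closedBall x (δ l), ‖b y - b x‖ₑ :=
          lintegral_mono_set hQsub
      _ = ENNReal.ofReal (∫ y in closedBall x (δ l), ‖b y - b x‖) := by
          rw [ofReal_integral_eq_lintegral_ofReal hint
            (Filter.Eventually.of_forall fun _ => norm_nonneg _)]
          simp
      _ = volume (closedBall x (δ l)) *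
          ENNReal.ofReal (⨍ y in closedBall x (δ l), ‖b y - b x‖) := by
          rw [← measure_smul_setAverage _ hct, smul_eq_mul, ENNReal.ofReal_mul measureReal_nonneg,
            ofReal_measureReal hct]
      _ ≤ (((Real.toNNReal (4 * n) ^ n : ℝ≥0) : ℝ≥0∞) * volume Q) *
          ENNReal.ofReal (⨍ y in closedBall x (δ l), ‖b y - b x‖) := by gcongr
      _ = ENNReal.ofReal ((4 * n : ℝ) ^ n * ⨍ y in closedBall x (δ l), ‖b y - b x‖) *
          volume Q := by
          rw [ENNReal.ofReal_mul (by positivity), ENNReal.ofReal_pow (by positivity)]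
          push_cast
          rw [show ((Real.toNNReal (4 * n) : ℝ≥0) : ℝ≥0∞) = ENNReal.ofReal (4 * n) from rfl,
            mul_assoc, mul_assoc, mul_comm (volume Q)]
      _ ≤ ε * volume Q := by
          gcongr
          exact ENNReal.ofReal_le_of_le_toReal (by simpa using hlε)
  refine (ENNReal.mul_le_mul_iff_left hQ0 hQt).1 ?_
  calc ‖b x - d‖ₑ * volume Q = ∫⁻ y in Q, ‖b x - d‖ₑ := by simp
    _ ≤ ∫⁻ y in Q, (‖b y - d‖ₑ + ‖b y - b x‖ₑ) := by
        refine lintegral_mono fun y => ?_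
        rw [show b x - d = (b y - d) - (b y - b x) by abel]
        exact enorm_sub_le
    _ = (∫⁻ y in Q, ‖b y - d‖ₑ) + ∫⁻ y in Q, ‖b y - b x‖ₑ :=
        lintegral_add_left' (hb.aestronglyMeasurable.restrict.sub aestronglyMeasurable_const).enorm _
    _ ≤ lam * volume Q + ε * volume Q := add_le_add (H l hkl z hz) hosc
    _ = (lam + ε) * volume Q := by ring

end Oscillation


lemma add_rpow_le (a b : ℝ≥0∞) {u : ℝ} (hu : 0 ≤ u) :
    (a + b) ^ u ≤ 2 ^ u * (a ^ u + b ^ u) := by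
  wlog hab : a ≤ b generalizing a b
  · rw [add_comm a, add_comm (a ^ u)]
    exact this b a (le_of_not_ge hab)
  calc (a + b) ^ u ≤ (2 * b) ^ u := ENNReal.rpow_le_rpow (by rw [two_mul]; gcongr) hu
    _ = 2 ^ u * b ^ u := ENNReal.mul_rpow_of_nonneg _ _ hu
    _ ≤ _ := by gcongr; exact le_add_self

section WeightedJN

variable {n : ℕ}

/-- The John–Nirenberg inequality with respect to a measure of class `A_∞`. -/
theorem weighted_john_nirenberg (𝕜 : Type*) [RCLike 𝕜] (hn : 1 ≤ n) {μ : Measure (Rn n)}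
    (h : IsAInfty μ) {u : ℝ} (hu : 0 < u) :
    ∃ K : ℝ≥0, ∀ b : Rn n → 𝕜, MemBMO b → ∀ (y : Rn n) (r : ℝ), 0 < r →
      (∫⁻ x in ball y r, ‖b x - ⨍ z in ball y r, b z‖ₑ ^ u ∂μ) ^ (1 / u) ≤
        K * bmoNorm b * μ (ball y r) ^ (1 / u) := by
  have hn' : (1 : ℝ) ≤ n := by exact_mod_cast hn
  set δ : ℝ≥0 := Real.toNNReal (2 * n) ^ n with hδ
  set Kc : ℝ≥0 := Real.toNNReal (4 * n) ^ n
  have hδ0 : 0 < δ := pow_pos (Real.toNNReal_pos.2 (by linarith)) _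
  obtain ⟨θ, hθ, hhalf⟩ := h.half δ
  obtain ⟨Kd, hKd⟩ := h.doubling (c := 2 * n) (by linarith)
  set S : ℝ≥0∞ := ∑' N : ℕ, ((N + 1 : ℕ) : ℝ≥0∞) ^ u * (θ : ℝ≥0∞) ^ N
  have hS : S ≠ ∞ := summable_moment hθ u
  set T : ℝ≥0∞ := (2 ^ u * (S * (2 * Kc + 2 : ℝ≥0) ^ u * Kd + 1)) ^ (1 / u) * δ with hT
  have hTt : T ≠ ∞ := by
    refine ENNReal.mul_ne_top (ENNReal.rpow_ne_top_of_nonneg (by positivity) ?_)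
      ENNReal.coe_ne_top
    refine ENNReal.mul_ne_top (ENNReal.rpow_ne_top_of_nonneg hu.le (by simp)) ?_
    refine ENNReal.add_ne_top.2 ⟨ENNReal.mul_ne_top (ENNReal.mul_ne_top hS
      (ENNReal.rpow_ne_top_of_nonneg hu.le ENNReal.coe_ne_top)) ENNReal.coe_ne_top, by simp⟩
  obtain ⟨T₀, hT₀⟩ : ∃ T₀ : ℝ≥0, (T₀ : ℝ≥0∞) = T := ⟨T.toNNReal, ENNReal.coe_toNNReal hTt⟩
  refine ⟨T₀, fun b ⟨hb, hbt⟩ y r hr => ?_⟩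
  have hμt := h.fin y r
  -- the inequality is first proved with `‖b‖ + ε` in place of `‖b‖`, which may vanish
  have main : ∀ ε : ℝ≥0, 0 < ε →
      (∫⁻ x in ball y r, ‖b x - ⨍ z in ball y r, b z‖ₑ ^ u ∂μ) ^ (1 / u) ≤
        T₀ * (bmoNorm b + ε) * μ (ball y r) ^ (1 / u) := by
    intro ε hε
    lift bmoNorm b to ℝ≥0 using hbt.ne with β hβ
    set M : ℝ≥0 := δ * (β + ε) with hMdef
    have hM : 0 < M := mul_pos hδ0 (by positivity)
    set a : Rn n := WithLp.toLp 2 fun i => y i - r with ha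
    set ℓ : ℝ := 2 * r with hℓ'
    have hℓ : 0 < ℓ := by positivity
    set c : ℕ → (Fin n → ℤ) → 𝕜 := fun k z =>
      ⨍ x in ball (gridCenter a ℓ k z) (2 * n * (ℓ / 2 ^ k / 2)), b x with hc
    have hrad : ∀ k : ℕ, 0 < 2 * n * (ℓ / 2 ^ k / 2) := fun k => by positivity
    have hcell0 : ∀ k z, volume (gridCell a ℓ k z) ≠ 0 := fun k z =>
      ((measure_ball_pos volume _ (by positivity)).trans_le
        (measure_mono (ball_subset_gridCell a hℓ k z))).ne'
    have hcellt : ∀ k z, volume (gridCell a ℓ k z) ≠ ∞ := fun k z =>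
      ne_top_of_le_ne_top (volume_ball_ne_top _ _)
        (measure_mono (gridCell_subset_ball hn a hℓ k z))
    have hlevel := fun N => (isNestedPartition_gridCell a ℓ).measure_level_le hcell0 hcellt
      (μ := μ) (K := Kc) (θ := θ) hM (b := b) (c := c)
      (fun k z z' _ => by
        refine (measure_mono (gridCell_subset_ball hn a hℓ k z')).trans ?_
        have := volume_ball_le_gridCell a hℓ (k + 1) z (gridCenter a ℓ k z')
          (c := 4 * n) (by positivity)
        rwa [show 4 * (n : ℝ) * (ℓ / 2 ^ (k + 1) / 2) = 2 * n * (ℓ / 2 ^ k / 2) by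
          rw [pow_succ]; field_simp; ring] at this)
      (fun k z => hhalf _ _ (hrad k) _ (gridCell_subset_ball hn a hℓ k z)
        ((isNestedPartition_gridCell a ℓ).meas k z)
        (volume_ball_le_gridCell a hℓ k z _ (by positivity)))
      hb.aestronglyMeasurable
      (fun k z => by
        refine (lintegral_mono_set (gridCell_subset_ball hn a hℓ k z)).trans
          ((lintegral_sub_average_le b _ (hrad k)).trans ?_)
        rw [← hβ, hMdef]
        calc (β : ℝ≥0∞) * volume (ball (gridCenter a ℓ k z) (2 * n * (ℓ / 2 ^ k / 2)))
            ≤ (β + ε : ℝ≥0) * (δ * volume (gridCell a ℓ k z)) := by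
              gcongr
              · simp
              · exact volume_ball_le_gridCell a hℓ k z _ (by positivity)
          _ = _ := by push_cast; ring)
      (h.ac.ae_le (ae_enorm_sub_le_of_gridCell hn hb a hℓ)) N 0 0
    have hcenter : gridCenter a ℓ 0 0 = y := by
      ext i
      simp only [gridCenter, ha, hℓ', Pi.zero_apply]
      push_cast
      ring
    have hrad0 : 2 * n * (ℓ / 2 ^ 0 / 2) = 2 * n * r := by rw [hℓ']; ring
    have hBQ : ball y r ⊆ gridCell a ℓ 0 0 := by
      have := ball_subset_gridCell a hℓ 0 0
      rwa [hcenter, show ℓ / 2 ^ 0 / 2 = r by rw [hℓ']; ring] at this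
    have hQB : gridCell a ℓ 0 0 ⊆ ball y (2 * n * r) := by
      have := gridCell_subset_ball hn a hℓ 0 0
      rwa [hcenter, hrad0] at this
    have hc0 : c 0 0 = ⨍ z in ball y (2 * n * r), b z := by
      simp only [hc]
      rw [hcenter, hrad0]
    have hmom := lintegral_rpow_le_of_level ((isNestedPartition_gridCell a ℓ).meas 0 0)
      (μ := μ) (g := fun x => ‖b x - c 0 0‖ₑ)
      ((hb.aestronglyMeasurable.mono_ac h.ac).sub aestronglyMeasurable_const).enorm
      (fun x => enorm_ne_top) (L := (2 * Kc + 2) * M) (by positivity) hlevel hu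
    have hshift : ‖c 0 0 - ⨍ z in ball y r, b z‖ₑ ≤ M := by
      rw [← enorm_neg, neg_sub, hc0]
      refine (enorm_average_sub_average_le hb hr (by positivity)
        (ball_subset_ball (by nlinarith))).trans ?_
      rw [← hβ, hMdef, hδ]
      push_cast
      rw [show ((Real.toNNReal (2 * n) : ℝ≥0) : ℝ≥0∞) = ENNReal.ofReal (2 * n) from rfl]
      gcongr
      exact le_self_add
    have hB : ∫⁻ x in ball y r, ‖b x - ⨍ z in ball y r, b z‖ₑ ^ u ∂μ ≤
        2 ^ u * (S * (2 * Kc + 2 : ℝ≥0) ^ u * Kd + 1) * M ^ u * μ (ball y r) := by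
      calc ∫⁻ x in ball y r, ‖b x - ⨍ z in ball y r, b z‖ₑ ^ u ∂μ
          ≤ ∫⁻ x in ball y r, 2 ^ u * (‖b x - c 0 0‖ₑ ^ u + M ^ u) ∂μ := by
            refine lintegral_mono fun x => ?_
            refine le_trans ?_ ((add_rpow_le _ _ hu.le).trans
              (mul_le_mul_right (add_le_add_right (ENNReal.rpow_le_rpow hshift hu.le) _) _))
            refine ENNReal.rpow_le_rpow ?_ hu.le
            rw [← sub_add_sub_cancel (b x) (c 0 0)]
            exact enorm_add_le _ _
        _ = 2 ^ u * ((∫⁻ x in ball y r, ‖b x - c 0 0‖ₑ ^ u ∂μ) + M ^ u * μ (ball y r)) := by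
            rw [lintegral_const_mul' _ _ (ENNReal.rpow_ne_top_of_nonneg hu.le (by simp)),
              lintegral_add_right _ measurable_const, setLIntegral_const]
        _ ≤ 2 ^ u * (S * ((2 * Kc + 2 : ℝ≥0) ^ u * M ^ u) * (Kd * μ (ball y r)) +
              M ^ u * μ (ball y r)) := by
            gcongr
            refine (lintegral_mono_set hBQ).trans (hmom.trans ?_)
            rw [ENNReal.coe_mul, ENNReal.mul_rpow_of_nonneg _ _ hu.le]
            gcongr
            exact (measure_mono hQB).trans (hKd y r hr)
        _ = _ := by ring
    refine (ENNReal.rpow_le_rpow hB (z := 1 / u) (by positivity)).trans (le_of_eq ?_)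
    rw [ENNReal.mul_rpow_of_nonneg _ _ (by positivity),
      ENNReal.mul_rpow_of_nonneg _ _ (by positivity), ← ENNReal.rpow_mul (M : ℝ≥0∞),
      mul_one_div_cancel hu.ne', ENNReal.rpow_one, hT₀, hT, hMdef]
    push_cast
    ring
  have hlim : Filter.Tendsto (fun ε : ℝ≥0 => T₀ * (bmoNorm b + ε) * μ (ball y r) ^ (1 / u))
      (nhdsWithin 0 (Ioi 0)) (nhds (T₀ * (bmoNorm b + (0 : ℝ≥0)) * μ (ball y r) ^ (1 / u))) := by
    have h1 : Filter.Tendsto (fun ε : ℝ≥0 => bmoNorm b + (ε : ℝ≥0∞)) (nhdsWithin 0 (Ioi 0))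
        (nhds (bmoNorm b + (0 : ℝ≥0))) :=
      ((ENNReal.continuous_coe.tendsto 0).mono_left nhdsWithin_le_nhds).const_add _
    refine ENNReal.Tendsto.mul_const (ENNReal.Tendsto.const_mul h1 (.inr ENNReal.coe_ne_top))
      (.inr (ENNReal.rpow_ne_top_of_nonneg (by positivity) hμt))
  rw [ENNReal.coe_zero, add_zero] at hlim
  exact ge_of_tendsto hlim (by filter_upwards [self_mem_nhdsWithin] with ε hε using main ε hε)

end WeightedJN


/-! ### Consequences of the weight conditions -/

section JN

variable {n : ℕ}

/-- The weighted John–Nirenberg inequality for oscillations about an arbitrary constant. -/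
lemma weighted_john_nirenberg_const (𝕜 : Type*) [RCLike 𝕜] (hn : 1 ≤ n) {μ : Measure (Rn n)}
    (h : IsAInfty μ) {u : ℝ} (hu : 0 < u) :
    ∃ K : ℝ≥0, ∀ b : Rn n → 𝕜, MemBMO b → ∀ (y : Rn n) (r : ℝ), 0 < r → ∀ c : 𝕜,
      (∫⁻ x in ball y r, ‖b x - c‖ₑ ^ u ∂μ) ^ (1 / u) ≤
        K * (bmoNorm b + ‖(⨍ z in ball y r, b z) - c‖ₑ) * μ (ball y r) ^ (1 / u) := by
  obtain ⟨K, hK⟩ := weighted_john_nirenberg 𝕜 hn h hu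
  set K' : ℝ≥0 := 2 * 2 ^ (1 / u) * (K + 1) with hK'
  refine ⟨K', fun b hb y r hr c => ?_⟩
  set a := ⨍ z in ball y r, b z
  have hu' : 0 ≤ 1 / u := by positivity
  have h1 : ∫⁻ x in ball y r, ‖b x - c‖ₑ ^ u ∂μ ≤
      2 ^ u * ((∫⁻ x in ball y r, ‖b x - a‖ₑ ^ u ∂μ) + ‖a - c‖ₑ ^ u * μ (ball y r)) := by
    calc ∫⁻ x in ball y r, ‖b x - c‖ₑ ^ u ∂μ
        ≤ ∫⁻ x in ball y r, 2 ^ u * (‖b x - a‖ₑ ^ u + ‖a - c‖ₑ ^ u) ∂μ := by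
          refine lintegral_mono fun x => ?_
          refine le_trans (ENNReal.rpow_le_rpow ?_ hu.le) (add_rpow_le _ _ hu.le)
          rw [← sub_add_sub_cancel (b x) a]
          exact enorm_add_le _ _
      _ = _ := by
          rw [lintegral_const_mul' _ _ (ENNReal.rpow_ne_top_of_nonneg hu.le (by simp)),
            lintegral_add_right _ measurable_const, setLIntegral_const]
  have hroot : ∀ z : ℝ≥0∞, (z ^ u) ^ (1 / u) = z := fun z => by
    rw [← ENNReal.rpow_mul, mul_one_div_cancel hu.ne', ENNReal.rpow_one]
  calc (∫⁻ x in ball y r, ‖b x - c‖ₑ ^ u ∂μ) ^ (1 / u)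
      ≤ (2 ^ u * ((∫⁻ x in ball y r, ‖b x - a‖ₑ ^ u ∂μ) +
          ‖a - c‖ₑ ^ u * μ (ball y r))) ^ (1 / u) := ENNReal.rpow_le_rpow h1 hu'
    _ ≤ 2 * (2 ^ (1 / u) * ((∫⁻ x in ball y r, ‖b x - a‖ₑ ^ u ∂μ) ^ (1 / u) +
          (‖a - c‖ₑ ^ u * μ (ball y r)) ^ (1 / u))) := by
        rw [ENNReal.mul_rpow_of_nonneg _ _ hu', hroot]
        gcongr
        exact add_rpow_le _ _ hu'
    _ ≤ 2 * (2 ^ (1 / u) * ((K + 1) * bmoNorm b * μ (ball y r) ^ (1 / u) +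
          (K + 1) * ‖a - c‖ₑ * μ (ball y r) ^ (1 / u))) := by
        rw [ENNReal.mul_rpow_of_nonneg _ _ hu', hroot]
        gcongr
        · refine (hK b hb y r hr).trans ?_
          gcongr
          exact le_self_add
        · exact le_mul_of_one_le_left zero_le le_add_self
    _ = _ := by
        rw [hK']
        push_cast
        rw [ENNReal.coe_rpow_of_nonneg _ hu']
        push_cast
        ring

end JN

section Weights

variable {n m : ℕ}

lemma prod_rpow_exponent {ι : Type*} {s : Finset ι} {x : ℝ≥0∞} (h0 : x ≠ 0) (ht : x ≠ ∞)
    (f : ι → ℝ) : ∏ i ∈ s, x ^ f i = x ^ ∑ i ∈ s, f i := by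
  classical
  induction s using Finset.induction_on with
  | empty => simp
  | insert i s hi ih => rw [Finset.prod_insert hi, Finset.sum_insert hi, ih,
      ENNReal.rpow_add _ _ h0 ht]

/-- The measure with density `w ^ ε` with respect to Lebesgue measure. -/
noncomputable def powMeasure (w : Rn n → ℝ) (ε : ℝ) : Measure (Rn n) :=
  volume.withDensity fun x => ENNReal.ofReal (w x) ^ ε

lemma powMeasure_apply (w : Rn n → ℝ) (ε : ℝ) {E : Set (Rn n)} (hE : MeasurableSet E) :
    powMeasure w ε E = ∫⁻ x in E, ENNReal.ofReal (w x) ^ ε := withDensity_apply _ hE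

lemma powMeasure_one_apply (w : Rn n → ℝ) {E : Set (Rn n)} (hE : MeasurableSet E) :
    powMeasure w 1 E = wMeas w E := by
  rw [powMeasure_apply _ _ hE, wMeas]
  simp

lemma IsWeight.aemeasurable {w : Rn n → ℝ} (hw : IsWeight w) :
    AEMeasurable (fun x => ENNReal.ofReal (w x)) volume :=
  hw.1.aestronglyMeasurable.aemeasurable.ennreal_ofReal

lemma ofReal_nuWeight (t : ℝ) (τ : Fin m → ℝ) {w : Fin m → Rn n → ℝ} (hθ : ∀ j, 0 ≤ t / τ j)
    (hw : ∀ j, IsWeight (w j)) :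
    ∀ᵐ x, ENNReal.ofReal (nuWeight t τ w x) = ∏ j, ENNReal.ofReal (w j x) ^ (t / τ j) := by
  filter_upwards [ae_all_iff.2 fun j => (hw j).2] with x hx
  rw [nuWeight, ENNReal.ofReal_prod_of_nonneg fun j _ => Real.rpow_nonneg (hx j).le _]
  exact Finset.prod_congr rfl fun j _ => (ENNReal.ofReal_rpow_of_nonneg (hx j).le (hθ j)).symm

lemma aemeasurable_nuWeight (t : ℝ) (τ : Fin m → ℝ) {w : Fin m → Rn n → ℝ}
    (hw : ∀ j, IsWeight (w j)) :
    AEMeasurable (fun x => ENNReal.ofReal (nuWeight t τ w x)) volume := by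
  refine AEMeasurable.ennreal_ofReal ?_
  unfold nuWeight
  exact Finset.aemeasurable_fun_prod _ fun j _ =>
    (hw j).1.aestronglyMeasurable.aemeasurable.pow_const _

/-- Hölder's inequality for the factorization `1 = ν^a ∏ⱼ (wⱼ^{εⱼ})^{βⱼ}`. -/
lemma volume_le_prod_powMeasure {t : ℝ} {τ : Fin m → ℝ} {w : Fin m → Rn n → ℝ}
    (hθ : ∀ j, 0 ≤ t / τ j) (hw : ∀ j, IsWeight (w j)) {a : ℝ} {β ε : Fin m → ℝ} (ha : 0 ≤ a)
    (hβ : ∀ j, 0 ≤ β j) (hsum : a + ∑ j, β j = 1) (hε : ∀ j, t / τ j * a + ε j * β j = 0)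
    {E : Set (Rn n)} (hE : MeasurableSet E) :
    volume E ≤ powMeasure (nuWeight t τ w) 1 E ^ a * ∏ j, powMeasure (w j) (ε j) E ^ β j := by
  have h := ENNReal.lintegral_mul_prod_norm_pow_le (μ := volume.restrict E) Finset.univ
    (g := fun x => ENNReal.ofReal (nuWeight t τ w x))
    (f := fun j x => ENNReal.ofReal (w j x) ^ ε j)
    (aemeasurable_nuWeight t τ hw).restrict
    (fun j _ => ((hw j).aemeasurable.pow_const _).restrict) a hsum ha (fun j _ => hβ j)
  rw [powMeasure_one_apply _ hE]
  simp_rw [powMeasure_apply _ _ hE]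
  refine le_trans (le_of_eq ?_) h
  rw [← setLIntegral_one]
  refine lintegral_congr_ae (ae_restrict_of_ae ?_)
  filter_upwards [ofReal_nuWeight t τ hθ hw, ae_all_iff.2 fun j => (hw j).2] with x hx hpos
  rw [hx, ← ENNReal.prod_rpow_of_nonneg ha, ← Finset.prod_mul_distrib]
  refine (Finset.prod_eq_one fun j _ => ?_).symm
  rw [← ENNReal.rpow_mul, ← ENNReal.rpow_mul, ← ENNReal.rpow_add _ _ (by simpa using hpos j)
    ENNReal.ofReal_ne_top, hε j, ENNReal.rpow_zero]

/-- If `|E| ≤ ∏ᵢ μᵢ(E)^{aᵢ}` for all measurable `E`, with an inequality in the opposite direction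
for balls, then every `μᵢ` is of class `A_∞`. -/
lemma isAInfty_of_prod {ι : Type*} [Fintype ι] {μ : ι → Measure (Rn n)} {a : ι → ℝ}
    (ha : ∀ i, 0 < a i) (hac : ∀ i, μ i ≪ volume)
    (h1 : ∀ E, MeasurableSet E → volume E ≤ ∏ i, μ i E ^ a i) {C : ℝ≥0}
    (h2 : ∀ (y : Rn n) (r : ℝ), 0 < r → ∏ i, μ i (ball y r) ^ a i ≤ C * volume (ball y r))
    (i : ι) : IsAInfty (μ i) := by
  classical
  have hne : ∀ y : Rn n, ∀ r, 0 < r → ∀ k, μ k (ball y r) ^ a k ≠ 0 := by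
    intro y r hr k hk
    have := h1 (ball y r) measurableSet_ball
    rw [Finset.prod_eq_zero (Finset.mem_univ k) hk] at this
    exact volume_ball_ne_zero y hr (le_antisymm this zero_le)
  have hsplit : ∀ E, ∏ k, μ k E ^ a k =
      μ i E ^ a i * ∏ k ∈ Finset.univ.erase i, μ k E ^ a k := fun E =>
    (Finset.mul_prod_erase _ _ (Finset.mem_univ i)).symm
  refine ⟨hac i, fun y r hr h0 => hne y r hr i (by simp [h0, ha i]), fun y r htop => ?_,
    C, a i, ha i, fun y r hr E hE hEm => ?_⟩
  · rcases le_or_gt r 0 with hr | hr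
    · simp [ball_eq_empty.2 hr] at htop
    have := h2 y r hr
    rw [hsplit, htop, ENNReal.top_rpow_of_pos (ha i), ENNReal.top_mul
      (Finset.prod_ne_zero_iff.2 fun k _ => hne y r hr k), top_le_iff] at this
    exact ENNReal.mul_ne_top ENNReal.coe_ne_top (volume_ball_ne_top y r) this
  · calc volume E * μ i (ball y r) ^ a i
        ≤ (μ i E ^ a i * ∏ k ∈ Finset.univ.erase i, μ k (ball y r) ^ a k) *
          μ i (ball y r) ^ a i := by
          gcongr
          refine (h1 E hEm).trans ?_
          rw [hsplit]
          gcongr with k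
          exact (ha k).le
      _ = μ i E ^ a i * ∏ k, μ k (ball y r) ^ a k := by rw [hsplit (ball y r)]; ring
      _ ≤ μ i E ^ a i * (C * volume (ball y r)) := mul_le_mul_right (h2 y r hr) _
      _ = _ := by ring

section MultiAp

variable {t : ℝ} {τ : Fin m → ℝ} {w : Fin m → Rn n → ℝ}

/-- The condition `A_τ`, in terms of measures of balls instead of averages. -/
lemma MemMultiAp.prod_le (h : MemMultiAp t τ w) (ht : 0 < t) (hτ : ∀ j, 1 < τ j)
    (hsum : 1 / t = ∑ j, 1 / τ j) :
    ∃ C : ℝ≥0, ∀ (y : Rn n) (r : ℝ), 0 < r →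
      powMeasure (nuWeight t τ w) 1 (ball y r) ^ (1 / t) *
        ∏ j, powMeasure (w j) (1 - τ j / (τ j - 1)) (ball y r) ^ (1 - 1 / τ j) ≤
      C * volume (ball y r) ^ m := by
  obtain ⟨hw, C, hC⟩ := h
  refine ⟨C, fun y r hr => ?_⟩
  have hB0 := volume_ball_ne_zero y hr
  have hBt := volume_ball_ne_top y r
  have he : ∀ j, 1 / (τ j / (τ j - 1)) = 1 - 1 / τ j := fun j => by
    have := hτ j
    have h1 : τ j - 1 ≠ 0 := by linarith
    have h2 : τ j ≠ 0 := by linarith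
    field_simp
  have he0 : ∀ j, 0 ≤ 1 - 1 / τ j := fun j => by
    have := hτ j
    rw [sub_nonneg, div_le_one (by linarith)]
    exact this.le
  set v := volume (ball y r)
  have h1 := hC y r hr
  simp_rw [dualFactor, if_neg (hτ _).ne', he, setLAverage_eq] at h1
  have hdiv : ∀ (x : ℝ≥0∞) (e : ℝ), 0 ≤ e → x ^ e = (x / v) ^ e * v ^ e := fun x e he => by
    rw [← ENNReal.mul_rpow_of_nonneg _ _ he, ENNReal.div_mul_cancel hB0 hBt]
  have hv : v ^ (1 / t) * ∏ j, v ^ (1 - 1 / τ j) = v ^ m := by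
    rw [prod_rpow_exponent hB0 hBt, ← ENNReal.rpow_add _ _ hB0 hBt, Finset.sum_sub_distrib, ← hsum]
    simp
  rw [powMeasure_one_apply _ measurableSet_ball, wMeas, hdiv _ _ (by positivity), ← hv]
  simp_rw [powMeasure_apply _ _ measurableSet_ball, fun j => hdiv
    (∫⁻ x in ball y r, ENNReal.ofReal (w j x) ^ (1 - τ j / (τ j - 1))) _ (he0 j),
    Finset.prod_mul_distrib]
  rw [mul_mul_mul_comm]
  gcongr

lemma dual_exponent_pos {x : ℝ} (hx : 1 < x) : 0 < 1 - 1 / x := by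
  rw [sub_pos, div_lt_one (by linarith)]
  exact hx

/-- The weight `ν` and the dual weights `wⱼ^{1 - τⱼ'}` of a tuple in `A_τ` are of class `A_∞`. -/
lemma MemMultiAp.isAInfty (h : MemMultiAp t τ w) (hm : 1 ≤ m) (ht : 0 < t) (hτ : ∀ j, 1 < τ j)
    (hsum : 1 / t = ∑ j, 1 / τ j) :
    IsAInfty (powMeasure (nuWeight t τ w) 1) ∧
      ∀ j, IsAInfty (powMeasure (w j) (1 - τ j / (τ j - 1))) := by
  obtain ⟨C, hC⟩ := h.prod_le ht hτ hsum
  have hm' : (0 : ℝ) < m := by exact_mod_cast hm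
  have hτ0 : ∀ j, 0 < τ j := fun j => by linarith [hτ j]
  set μ : Option (Fin m) → Measure (Rn n) := fun i =>
    i.elim (powMeasure (nuWeight t τ w) 1) fun j => powMeasure (w j) (1 - τ j / (τ j - 1)) with hμ
  set a : Option (Fin m) → ℝ := fun i => i.elim (1 / t / m) fun j => (1 - 1 / τ j) / m with ha
  have hapos : ∀ i, 0 < a i := by
    rintro (_ | j)
    · simp only [ha, Option.elim]; positivity
    · simp only [ha, Option.elim]; exact div_pos (dual_exponent_pos (hτ j)) hm'
  have key := isAInfty_of_prod (μ := μ) (a := a) hapos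
    (by rintro (_ | j) <;> exact withDensity_absolutelyContinuous _ _)
    (fun E hE => by
      rw [Fintype.prod_option]
      refine volume_le_prod_powMeasure (fun j => (div_pos ht (hτ0 j)).le) h.1 (hapos none).le
        (fun j => (hapos (some j)).le) ?_ (fun j => ?_) hE
      · simp only [ha, Option.elim]
        rw [← Finset.sum_div, Finset.sum_sub_distrib, ← hsum]
        simp
        field_simp
        ring
      · simp only [ha, Option.elim]
        have h1 : τ j - 1 ≠ 0 := by linarith [hτ j]
        have h2 : τ j ≠ 0 := (hτ0 j).ne'
        field_simp
        ring)
    (C := C ^ (1 / (m : ℝ)))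
    (fun y r hr => by
      rw [Fintype.prod_option]
      simp only [ha, hμ, Option.elim]
      have h1 := ENNReal.rpow_le_rpow (hC y r hr) (z := 1 / (m : ℝ)) (by positivity)
      rw [ENNReal.mul_rpow_of_nonneg _ _ (by positivity),
        ENNReal.mul_rpow_of_nonneg _ _ (by positivity),
        ← ENNReal.prod_rpow_of_nonneg (by positivity), ← ENNReal.rpow_natCast,
        ← ENNReal.rpow_mul, ← ENNReal.rpow_mul, mul_one_div_cancel hm'.ne', ENNReal.rpow_one] at h1
      simp_rw [← ENNReal.rpow_mul, mul_one_div] at h1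
      rwa [ENNReal.coe_rpow_of_nonneg _ (by positivity)])
  exact ⟨key none, fun j => key (some j)⟩

end MultiAp

/-- An `A_∞` weight satisfies `w(B) (∫_B w^{1-p'})^{p-1} ≤ C |B|^p` for some `p > 1`. -/
lemma MemAinfty.exists_one_lt {w : Rn n → ℝ} (h : MemAinfty w) :
    ∃ (p : ℝ) (C : ℝ≥0), 1 < p ∧ ∀ (y : Rn n) (r : ℝ), 0 < r →
      powMeasure w 1 (ball y r) * powMeasure w (1 - p / (p - 1)) (ball y r) ^ (p - 1) ≤
        C * volume (ball y r) ^ p := by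
  obtain ⟨p, hp, hw, C, hC⟩ := h
  rcases hp.eq_or_lt with rfl | hp
  · -- for `p = 1` the exponent `2` will do
    refine ⟨2, C, one_lt_two, fun y r hr => ?_⟩
    have hB0 := volume_ball_ne_zero y hr
    have hBt := volume_ball_ne_top y r
    have h1 := hC y r hr
    rw [dualFactor, if_pos rfl, div_one, ENNReal.rpow_one, setLAverage_eq] at h1
    rw [powMeasure_one_apply _ measurableSet_ball, powMeasure_apply _ _ measurableSet_ball, wMeas]
    have h2 : ∫⁻ x in ball y r, ENNReal.ofReal (w x) ^ (1 - 2 / (2 - 1) : ℝ) ≤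
        essSup (fun x => (ENNReal.ofReal (w x))⁻¹) (volume.restrict (ball y r)) *
          volume (ball y r) := by
      rw [← setLIntegral_const]
      refine lintegral_mono_ae ?_
      filter_upwards [ENNReal.ae_le_essSup (μ := volume.restrict (ball y r))
        fun x => (ENNReal.ofReal (w x))⁻¹] with x hx
      rw [show (1 - 2 / (2 - 1) : ℝ) = -1 by norm_num, ENNReal.rpow_neg_one]
      exact hx
    rw [show (2 - 1 : ℝ) = 1 by norm_num, ENNReal.rpow_one]
    rw [show (2 - 1 : ℝ) = 1 by norm_num] at h2
    set v := volume (ball y r)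
    set S := essSup (fun x => (ENNReal.ofReal (w x))⁻¹) (volume.restrict (ball y r))
    calc (∫⁻ x in ball y r, ENNReal.ofReal (w x)) *
          ∫⁻ x in ball y r, ENNReal.ofReal (w x) ^ (1 - 2 / 1 : ℝ)
        ≤ ((∫⁻ x in ball y r, ENNReal.ofReal (w x)) / v * v) * (S * v) := by
          rw [ENNReal.div_mul_cancel hB0 hBt]
          gcongr
      _ = ((∫⁻ x in ball y r, ENNReal.ofReal (w x)) / v * S) * (v * v) := by ring
      _ ≤ C * (v * v) := by gcongr
      _ = _ := by rw [ENNReal.rpow_two, sq]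
  · refine ⟨p, C ^ p, hp, fun y r hr => ?_⟩
    have hp0 : 0 < p := by linarith
    have hp1 : p - 1 ≠ 0 := by linarith
    have hB0 := volume_ball_ne_zero y hr
    have hBt := volume_ball_ne_top y r
    have h1 := ENNReal.rpow_le_rpow (hC y r hr) hp0.le
    rw [dualFactor, if_neg hp.ne', ENNReal.mul_rpow_of_nonneg _ _ hp0.le, ← ENNReal.rpow_mul,
      ← ENNReal.rpow_mul, one_div_mul_cancel hp0.ne', ENNReal.rpow_one,
      show 1 / (p / (p - 1)) * p = p - 1 by field_simp, setLAverage_eq, setLAverage_eq] at h1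
    rw [powMeasure_one_apply _ measurableSet_ball, powMeasure_apply _ _ measurableSet_ball, wMeas]
    set v := volume (ball y r)
    set A := ∫⁻ x in ball y r, ENNReal.ofReal (w x)
    set S := ∫⁻ x in ball y r, ENNReal.ofReal (w x) ^ (1 - p / (p - 1))
    calc A * S ^ (p - 1) = (A / v * v) * (S / v * v) ^ (p - 1) := by
          rw [ENNReal.div_mul_cancel hB0 hBt, ENNReal.div_mul_cancel hB0 hBt]
      _ = (A / v * (S / v) ^ (p - 1)) * (v ^ (1 : ℝ) * v ^ (p - 1)) := by
          rw [ENNReal.mul_rpow_of_nonneg _ _ (by linarith), ENNReal.rpow_one]; ring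
      _ ≤ C ^ p * (v ^ (1 : ℝ) * v ^ (p - 1)) := by gcongr
      _ = _ := by
          rw [← ENNReal.rpow_add _ _ hB0 hBt, add_sub_cancel,
            ENNReal.coe_rpow_of_nonneg _ hp0.le]

/-- For `A_∞` weights, `∏ⱼ wⱼ(B)^{θⱼ} ≤ C ν(B)` with `ν = ∏ⱼ wⱼ^{θⱼ}`: Hölder's inequality
can be reversed. -/
lemma prod_measure_ball_le {t : ℝ} {τ : Fin m → ℝ} {w : Fin m → Rn n → ℝ}
    (hw : ∀ j, MemAinfty (w j)) (hθ : ∀ j, 0 < t / τ j) (hsum : ∑ j, t / τ j = 1) :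
    ∃ C : ℝ≥0, ∀ (y : Rn n) (r : ℝ), 0 < r →
      ∏ j, wMeas (w j) (ball y r) ^ (t / τ j) ≤ C * wMeas (nuWeight t τ w) (ball y r) := by
  have hw' : ∀ j, IsWeight (w j) := fun j => (hw j).choose_spec.2.1
  choose p C hp hC using fun j => (hw j).exists_one_lt
  refine ⟨∏ j, C j ^ (t / τ j), fun y r hr => ?_⟩
  simp_rw [← powMeasure_one_apply _ measurableSet_ball]
  have hp1 : ∀ j, 0 < p j - 1 := fun j => by linarith [hp j]
  set D : ℝ := 1 + ∑ j, t / τ j * (p j - 1) with hD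
  have hD0 : 0 < D := by
    have : 0 ≤ ∑ j, t / τ j * (p j - 1) :=
      Finset.sum_nonneg fun j _ => (mul_pos (hθ j) (hp1 j)).le
    linarith
  have h1 := volume_le_prod_powMeasure (t := t) (τ := τ) (w := w) (a := 1 / D)
    (β := fun j => t / τ j * (p j - 1) / D) (ε := fun j => 1 - p j / (p j - 1))
    (fun j => (hθ j).le) hw' (by positivity)
    (fun j => (div_pos (mul_pos (hθ j) (hp1 j)) hD0).le)
    (by rw [← Finset.sum_div, ← add_div, ← hD, div_self hD0.ne'])
    (fun j => by
      have := (hp1 j).ne'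
      field_simp
      ring)
    (measurableSet_ball (x := y) (ε := r))
  have hB0 := volume_ball_ne_zero y hr
  have hBt := volume_ball_ne_top y r
  set v := volume (ball y r)
  set N := powMeasure (nuWeight t τ w) 1 (ball y r)
  have h2 : v ^ D ≤ N * ∏ j, powMeasure (w j) (1 - p j / (p j - 1)) (ball y r) ^
      (t / τ j * (p j - 1)) := by
    refine (ENNReal.rpow_le_rpow h1 hD0.le).trans (le_of_eq ?_)
    rw [ENNReal.mul_rpow_of_nonneg _ _ hD0.le, ← ENNReal.prod_rpow_of_nonneg hD0.le,
      ← ENNReal.rpow_mul, one_div_mul_cancel hD0.ne', ENNReal.rpow_one]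
    simp_rw [← ENNReal.rpow_mul, div_mul_cancel₀ _ hD0.ne']
  have hvD0 : v ^ D ≠ 0 := by simp [hB0, hBt]
  have hvDt : v ^ D ≠ ∞ := ENNReal.rpow_ne_top_of_nonneg hD0.le hBt
  have hDsum : ∑ j, p j * (t / τ j) = D := by
    have : ∑ j, p j * (t / τ j) = ∑ j, t / τ j + ∑ j, t / τ j * (p j - 1) := by
      rw [← Finset.sum_add_distrib]
      exact Finset.sum_congr rfl fun j _ => by ring
    rw [this, hsum]
  refine (ENNReal.mul_le_mul_iff_right hvD0 hvDt).1 ?_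
  calc v ^ D * ∏ j, powMeasure (w j) 1 (ball y r) ^ (t / τ j)
      ≤ (N * ∏ j, powMeasure (w j) (1 - p j / (p j - 1)) (ball y r) ^ (t / τ j * (p j - 1))) *
          ∏ j, powMeasure (w j) 1 (ball y r) ^ (t / τ j) := by gcongr
    _ = N * ∏ j, (powMeasure (w j) 1 (ball y r) *
          powMeasure (w j) (1 - p j / (p j - 1)) (ball y r) ^ (p j - 1)) ^ (t / τ j) := by
        rw [mul_assoc, ← Finset.prod_mul_distrib]
        congr 1
        refine Finset.prod_congr rfl fun j _ => ?_
        rw [ENNReal.mul_rpow_of_nonneg _ _ (hθ j).le, ← ENNReal.rpow_mul, mul_comm (t / τ j),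
          mul_comm]
    _ ≤ N * ∏ j, (C j * v ^ p j) ^ (t / τ j) := by
        refine mul_le_mul_right (Finset.prod_le_prod' fun j _ => ?_) _
        exact ENNReal.rpow_le_rpow (hC j y r hr) (hθ j).le
    _ = v ^ D * (((∏ j, C j ^ (t / τ j) : ℝ≥0) : ℝ≥0∞) * N) := by
        rw [ENNReal.ofNNReal_finsetProd, ← hDsum, ← prod_rpow_exponent hB0 hBt]
        simp_rw [fun j => ENNReal.mul_rpow_of_nonneg (C j) (v ^ p j) (hθ j).le,
          Finset.prod_mul_distrib, ← ENNReal.rpow_mul,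
          fun j => ENNReal.coe_rpow_of_nonneg (C j) (hθ j).le]
        ring

end Weights


/-! ### Averages controlled by weighted norms -/

section Averages

variable {𝕜 : Type*} [RCLike 𝕜] {n m : ℕ}

/-- The `L^s` average of `f` over the ball `B(y,r)`. -/
noncomputable def ballAvg (s : ℝ) (f : Rn n → 𝕜) (y : Rn n) (r : ℝ) : ℝ≥0∞ :=
  (⨍⁻ z in ball y r, ‖f z‖ₑ ^ s ∂volume) ^ (1 / s)

/-- Hölder's inequality for `|f g|^s = (|f|^s w^{1/τ}) (|g|^s w^{-1/τ})` with `τ = Q / s`. -/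
lemma ballAvg_mul_le {s Q : ℝ} (hs : 0 < s) (hQ : s < Q) {w : Rn n → ℝ} (hw : IsWeight w)
    {f g : Rn n → 𝕜} (hf : AEStronglyMeasurable f volume) (hg : AEStronglyMeasurable g volume)
    (y : Rn n) (r : ℝ) :
    ballAvg s (g * f) y r ≤ (volume (ball y r) ^ (1 / s))⁻¹ * wLqNormOn Q w (ball y r) f *
      ((∫⁻ x in ball y r, ‖g x‖ₑ ^ (s * (Q / s / (Q / s - 1)))
        ∂powMeasure w (1 - Q / s / (Q / s - 1))) ^ (1 / (s * (Q / s / (Q / s - 1))))) := by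
  set τ := Q / s with hτdef
  have hτ : 1 < τ := (one_lt_div hs).2 hQ
  have hτ0 : 0 < τ := by linarith
  have hτ1 : τ - 1 ≠ 0 := by linarith
  have hconj : τ.HolderConjugate (τ / (τ - 1)) := Real.HolderConjugate.conjExponent hτ
  have hWm := hw.aemeasurable
  set B := ball y r
  have hH := ENNReal.lintegral_mul_le_Lp_mul_Lq (volume.restrict B) hconj
    (f := fun x => ‖f x‖ₑ ^ s * ENNReal.ofReal (w x) ^ (1 / τ))
    (g := fun x => ‖g x‖ₑ ^ s * ENNReal.ofReal (w x) ^ (-(1 / τ)))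
    ((hf.enorm.pow_const _).mul (hWm.pow_const _)).restrict
    ((hg.enorm.pow_const _).mul (hWm.pow_const _)).restrict
  have h1 : ∫⁻ x in B, ‖(g * f) x‖ₑ ^ s = ∫⁻ x in B,
      ((fun x => ‖f x‖ₑ ^ s * ENNReal.ofReal (w x) ^ (1 / τ)) *
        fun x => ‖g x‖ₑ ^ s * ENNReal.ofReal (w x) ^ (-(1 / τ))) x := by
    refine lintegral_congr_ae (ae_restrict_of_ae ?_)
    filter_upwards [hw.2] with x hx
    simp only [Pi.mul_apply]
    rw [mul_mul_mul_comm, ← ENNReal.rpow_add _ _ (by simpa using hx) ENNReal.ofReal_ne_top,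
      add_neg_cancel, ENNReal.rpow_zero, mul_one, enorm_mul, ENNReal.mul_rpow_of_nonneg _ _ hs.le,
      mul_comm]
  have h2 : ∫⁻ x in B, (‖f x‖ₑ ^ s * ENNReal.ofReal (w x) ^ (1 / τ)) ^ τ =
      ∫⁻ x in B, ‖f x‖ₑ ^ Q * ENNReal.ofReal (w x) := by
    refine lintegral_congr fun x => ?_
    rw [ENNReal.mul_rpow_of_nonneg _ _ hτ0.le, ← ENNReal.rpow_mul, ← ENNReal.rpow_mul,
      one_div_mul_cancel hτ0.ne', ENNReal.rpow_one, hτdef, mul_div_cancel₀ _ hs.ne']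
  have h3 : ∫⁻ x in B, (‖g x‖ₑ ^ s * ENNReal.ofReal (w x) ^ (-(1 / τ))) ^ (τ / (τ - 1)) =
      ∫⁻ x in B, ‖g x‖ₑ ^ (s * (τ / (τ - 1))) ∂powMeasure w (1 - τ / (τ - 1)) := by
    have hfin : ∀ᵐ x ∂volume.restrict B, ENNReal.ofReal (w x) ^ (1 - τ / (τ - 1)) < ∞ := by
      refine ae_restrict_of_ae ?_
      filter_upwards [hw.2] with x hx
      exact (ENNReal.rpow_ne_top_of_ne_zero (by simpa using hx) ENNReal.ofReal_ne_top).lt_top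
    rw [powMeasure, restrict_withDensity measurableSet_ball,
      lintegral_withDensity_eq_lintegral_mul_non_measurable₀ _ (hWm.pow_const _).restrict hfin]
    refine lintegral_congr fun x => ?_
    rw [Pi.mul_apply, ENNReal.mul_rpow_of_nonneg _ _ hconj.symm.nonneg, ← ENNReal.rpow_mul,
      ← ENNReal.rpow_mul, mul_comm, show -(1 / τ) * (τ / (τ - 1)) = 1 - τ / (τ - 1) by
        field_simp; ring]
  rw [← h1, h2, h3] at hH
  have h4 := ENNReal.rpow_le_rpow hH (z := 1 / s) (by positivity)
  rw [ENNReal.mul_rpow_of_nonneg _ _ (by positivity), ← ENNReal.rpow_mul, ← ENNReal.rpow_mul,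
    show 1 / τ * (1 / s) = 1 / Q by rw [hτdef]; field_simp,
    show 1 / (τ / (τ - 1)) * (1 / s) = 1 / (s * (τ / (τ - 1))) by field_simp] at h4
  rw [ballAvg, setLAverage_eq, ENNReal.div_rpow_of_nonneg _ _ (by positivity), div_eq_mul_inv,
    mul_comm, mul_assoc]
  exact mul_le_mul_right h4 _

variable {s q : ℝ} {Q : Fin m → ℝ} {w : Fin m → Rn n → ℝ}

lemma nuWeight_div (q : ℝ) (Q : Fin m → ℝ) (w : Fin m → Rn n → ℝ) (hs : s ≠ 0) :
    nuWeight (q / s) (fun j => Q j / s) w = nuWeight q Q w := by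
  ext x
  exact Finset.prod_congr rfl fun j _ => by rw [div_div_div_cancel_right₀ hs]

lemma one_div_div_eq_sum (hq : 1 / q = ∑ j, 1 / Q j) : 1 / (q / s) = ∑ j, 1 / (Q j / s) := by
  simp_rw [one_div_div, ← mul_one_div s, ← Finset.mul_sum, ← hq]

lemma MemMultiAp.isAInfty_nuWeight (hw : MemMultiAp (q / s) (fun j => Q j / s) w) (hm : 1 ≤ m)
    (hs : 0 < s) (hsQ : ∀ j, s < Q j) (hq0 : 0 < q) (hq : 1 / q = ∑ j, 1 / Q j) :
    IsAInfty (powMeasure (nuWeight q Q w) 1) := by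
  rw [← nuWeight_div q Q w hs.ne']
  exact (hw.isAInfty hm (by positivity) (fun j => (one_lt_div hs).2 (hsQ j))
    (one_div_div_eq_sum hq)).1

/-- The product of the averages of `f₁, …, f_m`, one of which may carry a factor `b - c` with
`b ∈ BMO`, is controlled by weighted norms on the same ball. -/
theorem prod_ballAvg_le (𝕜 : Type*) [RCLike 𝕜] (hn : 1 ≤ n) (hm : 1 ≤ m) (hs : 1 ≤ s)
    (hsQ : ∀ j, s < Q j) (hq0 : 0 < q) (hq : 1 / q = ∑ j, 1 / Q j)
    (hw : MemMultiAp (q / s) (fun j => Q j / s) w) :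
    ∃ K : ℝ≥0, ∀ f : Fin m → Rn n → 𝕜, (∀ j, AEStronglyMeasurable (f j) volume) →
      ∀ (y : Rn n) (r : ℝ), 0 < r →
      (∏ j, ballAvg s (f j) y r ≤ K * (wMeas (nuWeight q Q w) (ball y r) ^ (-(1 / q)) *
          ∏ j, wLqNormOn (Q j) (w j) (ball y r) (f j))) ∧
      ∀ (i : Fin m) (b : Rn n → 𝕜), MemBMO b → ∀ c : 𝕜,
        ∏ j, ballAvg s (Function.update f i ((fun x => b x - c) * f i) j) y r ≤
          K * ((bmoNorm b + ‖(⨍ z in ball y r, b z) - c‖ₑ) *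
            (wMeas (nuWeight q Q w) (ball y r) ^ (-(1 / q)) *
              ∏ j, wLqNormOn (Q j) (w j) (ball y r) (f j))) := by
  have hs0 : 0 < s := by linarith
  have ht : 0 < q / s := by positivity
  have hτ : ∀ j, 1 < Q j / s := fun j => (one_lt_div hs0).2 (hsQ j)
  have hsum : 1 / (q / s) = ∑ j, 1 / (Q j / s) := one_div_div_eq_sum hq
  obtain ⟨hν, hσ⟩ := hw.isAInfty hm ht hτ hsum
  obtain ⟨C, hC⟩ := hw.prod_le ht hτ hsum
  rw [nuWeight_div q Q w hs0.ne'] at hν hC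
  have hu : ∀ j, 0 < s * (Q j / s / (Q j / s - 1)) := fun j => by
    have := hτ j
    have : 0 < Q j / s - 1 := by linarith
    have : 0 < Q j / s := by linarith
    positivity
  choose J hJ using fun j => weighted_john_nirenberg_const 𝕜 hn (hσ j) (hu j)
  have hue : ∀ j, 1 / (s * (Q j / s / (Q j / s - 1))) = (1 - 1 / (Q j / s)) * (1 / s) := by
    intro j
    have h1 : Q j / s ≠ 0 := by linarith [hτ j]
    have h2 : Q j / s - 1 ≠ 0 := by linarith [hτ j]
    generalize Q j / s = x at h1 h2
    field_simp
  simp_rw [hue] at hJ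
  set Kc : ℝ≥0 := C ^ (1 / s) with hKc
  refine ⟨Kc * (1 + ∑ j, J j), fun f hf y r hr => ?_⟩
  set B := ball y r
  have hB0 : volume B ≠ 0 := volume_ball_ne_zero y hr
  have hBt : volume B ≠ ∞ := volume_ball_ne_top y r
  set σ : Fin m → ℝ≥0∞ := fun j => powMeasure (w j) (1 - Q j / s / (Q j / s - 1)) B
  set N : Fin m → ℝ≥0∞ := fun j => wLqNormOn (Q j) (w j) B (f j)
  set V := wMeas (nuWeight q Q w) B with hV
  have hV0 : V ≠ 0 := by
    rw [hV, ← powMeasure_one_apply _ measurableSet_ball]; exact hν.pos y r hr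
  have hVt : V ≠ ∞ := by
    rw [hV, ← powMeasure_one_apply _ measurableSet_ball]; exact hν.fin y r
  -- each average is bounded by `G j`; the `A_τ` condition bounds the product of the `G j`
  set G : Fin m → ℝ≥0∞ := fun j =>
    (volume B ^ (1 / s))⁻¹ * N j * σ j ^ ((1 - 1 / (Q j / s)) * (1 / s)) with hG
  have hGprod : ∏ j, G j ≤ Kc * (V ^ (-(1 / q)) * ∏ j, N j) := by
    have h1 : ∏ j, σ j ^ (1 - 1 / (Q j / s)) ≤ V ^ (-(1 / (q / s))) * (C * volume B ^ m) := by
      have h0 := hC y r hr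
      rw [powMeasure_one_apply _ measurableSet_ball] at h0
      calc ∏ j, σ j ^ (1 - 1 / (Q j / s))
          = V ^ (-(1 / (q / s))) * (V ^ (1 / (q / s)) * ∏ j, σ j ^ (1 - 1 / (Q j / s))) := by
            rw [← mul_assoc, ← ENNReal.rpow_add _ _ hV0 hVt, neg_add_cancel, ENNReal.rpow_zero,
              one_mul]
        _ ≤ _ := mul_le_mul_right h0 _
    have h2 := ENNReal.rpow_le_rpow h1 (z := 1 / s) (by positivity)
    rw [← ENNReal.prod_rpow_of_nonneg (by positivity),
      ENNReal.mul_rpow_of_nonneg _ _ (by positivity),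
      ENNReal.mul_rpow_of_nonneg _ _ (by positivity), ← ENNReal.rpow_mul,
      show -(1 / (q / s)) * (1 / s) = -(1 / q) by field_simp] at h2
    simp_rw [← ENNReal.rpow_mul] at h2
    have h3 : (volume B ^ m) ^ (1 / s) = (volume B ^ (1 / s)) ^ m := by
      rw [← ENNReal.rpow_natCast, ← ENNReal.rpow_natCast, ← ENNReal.rpow_mul, ← ENNReal.rpow_mul,
        mul_comm]
    have hv0 : volume B ^ (1 / s) ≠ 0 := by simp [hB0, hBt]
    have hvt : volume B ^ (1 / s) ≠ ∞ := ENNReal.rpow_ne_top_of_nonneg (by positivity) hBt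
    simp only [hG]
    rw [Finset.prod_mul_distrib, Finset.prod_mul_distrib, Finset.prod_const, Finset.card_univ,
      Fintype.card_fin]
    calc _ ≤ (volume B ^ (1 / s))⁻¹ ^ m * (∏ j, N j) *
          (V ^ (-(1 / q)) * (C ^ (1 / s) * (volume B ^ m) ^ (1 / s))) := by gcongr
      _ = ((volume B ^ (1 / s))⁻¹ * volume B ^ (1 / s)) ^ m * (C ^ (1 / s) *
          (V ^ (-(1 / q)) * ∏ j, N j)) := by rw [h3]; ring
      _ = _ := by
        rw [ENNReal.inv_mul_cancel hv0 hvt, one_pow, one_mul, hKc,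
          ENNReal.coe_rpow_of_nonneg _ (by positivity)]
  have hplain : ∀ j, ballAvg s (f j) y r ≤ G j := by
    intro j
    have h1 := ballAvg_mul_le hs0 (hsQ j) (hw.1 j) (hf j)
      (aestronglyMeasurable_const (b := (1 : 𝕜))) y r
    have h2 : (fun _ => (1 : 𝕜)) * f j = f j := by ext; simp
    rw [h2] at h1
    refine h1.trans (le_of_eq ?_)
    simp only [enorm_one, ENNReal.one_rpow, lintegral_const, one_mul, Measure.restrict_apply_univ,
      hue]
    rfl
  have hosc : ∀ j (b : Rn n → 𝕜), MemBMO b → ∀ c : 𝕜,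
      ballAvg s ((fun x => b x - c) * f j) y r ≤
        J j * (bmoNorm b + ‖(⨍ z in B, b z) - c‖ₑ) * G j := by
    intro j b hb c
    refine (ballAvg_mul_le hs0 (hsQ j) (hw.1 j) (hf j)
      (hb.1.aestronglyMeasurable.sub aestronglyMeasurable_const) y r).trans ?_
    have h1 := hJ j b hb y r hr c
    rw [hue]
    calc _ ≤ (volume B ^ (1 / s))⁻¹ * N j * (J j * (bmoNorm b + ‖(⨍ z in B, b z) - c‖ₑ) *
          σ j ^ ((1 - 1 / (Q j / s)) * (1 / s))) := mul_le_mul_right h1 _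
      _ = _ := by simp only [hG]; ring
  refine ⟨(Finset.prod_le_prod' fun j _ => hplain j).trans (hGprod.trans ?_),
    fun i b hb c => ?_⟩
  · gcongr
    exact le_mul_of_one_le_right zero_le (le_add_of_nonneg_right zero_le)
  · set O := bmoNorm b + ‖(⨍ z in B, b z) - c‖ₑ
    rw [← Finset.mul_prod_erase _ _ (Finset.mem_univ i), Function.update_self]
    calc _ ≤ (J i * O * G i) * ∏ j ∈ Finset.univ.erase i, G j := by
          refine mul_le_mul' (hosc i b hb c) (Finset.prod_le_prod' fun j hj => ?_)
          rw [Function.update_of_ne (Finset.ne_of_mem_erase hj)]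
          exact hplain j
      _ = J i * O * ∏ j, G j := by rw [← Finset.mul_prod_erase _ _ (Finset.mem_univ i)]; ring
      _ ≤ (1 + ∑ j, J j : ℝ≥0) * O * (Kc * (V ^ (-(1 / q)) * ∏ j, N j)) := by
          gcongr
          exact (Finset.single_le_sum (fun j _ => (zero_le : 0 ≤ J j)) (Finset.mem_univ i)).trans
            (le_add_of_nonneg_left zero_le)
      _ = _ := by push_cast; ring

end Averages


/-! ### Expansion of the commutator -/

section Expansion

/-- Expansion of a map on tuples which is additive in each argument up to a relation, for instance
equality almost everywhere, or `≤`. -/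
lemma rel_expand {ι V M : Type*} [Fintype ι] [DecidableEq ι] [AddCommMonoid V] [AddCommMonoid M]
    {rel : M → M → Prop} (hrefl : ∀ a, rel a a) (htrans : ∀ a b c, rel a b → rel b c → rel a c)
    (hadd : ∀ a b c d, rel a b → rel c d → rel (a + c) (b + d))
    {D : ι → AddSubmonoid V} {F : (ι → V) → M}
    (hF : ∀ f : ι → V, (∀ i, f i ∈ D i) → ∀ j, ∀ g ∈ D j, ∀ h ∈ D j,
      rel (F (Function.update f j (g + h)))
        (F (Function.update f j g) + F (Function.update f j h)))
    {g h : ι → V} (hg : ∀ i, g i ∈ D i) (hh : ∀ i, h i ∈ D i) :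
    rel (F (g + h)) (∑ σ : Finset ι, F (σ.piecewise g h)) := by
  suffices H : ∀ (t : Finset ι) (h : ι → V), (∀ i, h i ∈ D i) →
      rel (F (t.piecewise (g + h) h)) (∑ σ ∈ t.powerset, F (σ.piecewise g h)) by
    simpa using H Finset.univ h hh
  intro t
  induction t using Finset.induction_on with
  | empty => intro h _; simpa using hrefl _
  | insert i t hit ih =>
    intro h hh
    have A : (insert i t).piecewise (g + h) h =
        Function.update (t.piecewise (g + h) h) i (g i + h i) := t.piecewise_insert _ _ _
    have B : Function.update (t.piecewise (g + h) h) i (h i) = t.piecewise (g + h) h := by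
      ext j
      by_cases hj : j = i
      · rw [hj]; simp [hit]
      · simp [hj]
    set h' := Function.update h i (g i) with hh'
    have hh'D : ∀ j, h' j ∈ D j := fun j => by
      by_cases hj : j = i
      · subst hj; simpa [hh'] using hg j
      · simpa [hh', hj] using hh j
    have C : Function.update (t.piecewise (g + h) h) i (g i) = t.piecewise (g + h') h' := by
      ext j
      by_cases hj : j = i
      · rw [hj]; simp [hh', hit]
      · by_cases hjt : j ∈ t <;> simp [hh', hj, hjt]
    have hpw : ∀ j, t.piecewise (g + h) h j ∈ D j := fun j => by
      by_cases hjt : j ∈ t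
      · simpa [hjt] using add_mem (hg j) (hh j)
      · simpa [hjt] using hh j
    have h1 := hF _ hpw i (g i) (hg i) (h i) (hh i)
    rw [B, C] at h1
    rw [A, Finset.sum_powerset_insert hit, add_comm (∑ σ ∈ t.powerset, _)]
    refine htrans _ _ _ h1 (hadd _ _ _ _ ?_ (ih h hh))
    refine htrans _ _ _ (ih h' hh'D) ?_
    rw [Finset.sum_congr rfl fun σ hσ => ?_]
    · exact hrefl _
    · congr 1
      ext j
      by_cases hj : j = i
      · rw [hj]
        simp [hh', Finset.notMem_of_mem_powerset_of_notMem hσ hit]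
      · by_cases hjσ : j ∈ σ <;> simp [hh', hj, hjσ]

variable {𝕜 : Type*} [RCLike 𝕜] {n m : ℕ} {s : ℝ} {D : Fin m → Submodule 𝕜 (Rn n → 𝕜)}

/-- The part of an argument which `splitAt` selects: outside of the ball `2B` if `j ∈ σ`, inside
otherwise. -/
noncomputable def cutPart (σ : Finset (Fin m)) (y : Rn n) (r : ℝ) (j : Fin m) (g : Rn n → 𝕜) : Rn n → 𝕜 :=
  if j ∈ σ then (ball y (2 * r))ᶜ.indicator g else (ball y (2 * r)).indicator g

lemma splitAt_apply (σ : Finset (Fin m)) (y : Rn n) (r : ℝ) (f : Fin m → Rn n → 𝕜) (j : Fin m) :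
    splitAt σ y r f j = cutPart σ y r j (f j) := rfl

lemma cutPart_mul (σ : Finset (Fin m)) (y : Rn n) (r : ℝ) (j : Fin m) (b g : Rn n → 𝕜) :
    cutPart σ y r j (b * g) = b * cutPart σ y r j g := by
  ext x
  simp only [cutPart]
  split_ifs <;> simp [Set.indicator]

lemma cutPart_add (σ : Finset (Fin m)) (y : Rn n) (r : ℝ) (j : Fin m) (g h : Rn n → 𝕜) :
    cutPart σ y r j (g + h) = cutPart σ y r j g + cutPart σ y r j h := by
  unfold cutPart
  split_ifs <;> exact Set.indicator_add' _ _ _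

lemma cutPart_smul (σ : Finset (Fin m)) (y : Rn n) (r : ℝ) (j : Fin m) (c : 𝕜) (g : Rn n → 𝕜) :
    cutPart σ y r j (c • g) = c • cutPart σ y r j g := by
  ext x
  simp only [cutPart]
  split_ifs <;> simp [Set.indicator]

lemma splitAt_update (σ : Finset (Fin m)) (y : Rn n) (r : ℝ) (f : Fin m → Rn n → 𝕜) (j : Fin m)
    (g : Rn n → 𝕜) :
    splitAt σ y r (Function.update f j g) =
      Function.update (splitAt σ y r f) j (cutPart σ y r j g) := by
  ext i : 1
  by_cases h : i = j
  · subst h; simp [splitAt_apply]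
  · simp [splitAt_apply, h]

namespace IsDomain

variable (hD : IsDomain s D)
include hD

lemma cutPart_mem (σ : Finset (Fin m)) (y : Rn n) (r : ℝ) {j : Fin m} {g : Rn n → 𝕜}
    (hg : g ∈ D j) : cutPart σ y r j g ∈ D j := by
  unfold cutPart
  split_ifs
  · rw [Set.indicator_compl]
    exact (D j).sub_mem hg (hD.cut j g hg _ _)
  · exact hD.cut j g hg _ _

lemma splitAt_mem (σ : Finset (Fin m)) (y : Rn n) (r : ℝ) {f : Fin m → Rn n → 𝕜}
    (hf : ∀ j, f j ∈ D j) (j : Fin m) : splitAt σ y r f j ∈ D j :=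
  hD.cutPart_mem σ y r (hf j)

lemma rel_splitAt {M : Type*} [AddCommMonoid M]
    {rel : M → M → Prop} (hrefl : ∀ a, rel a a) (htrans : ∀ a b c, rel a b → rel b c → rel a c)
    (hadd : ∀ a b c d, rel a b → rel c d → rel (a + c) (b + d)) {F : (Fin m → Rn n → 𝕜) → M}
    (hF : ∀ f : Fin m → Rn n → 𝕜, (∀ i, f i ∈ D i) → ∀ j, ∀ g ∈ D j, ∀ h ∈ D j,
      rel (F (Function.update f j (g + h)))
        (F (Function.update f j g) + F (Function.update f j h)))
    {f : Fin m → Rn n → 𝕜} (hf : ∀ j, f j ∈ D j) (y : Rn n) (r : ℝ) :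
    rel (F f) (∑ σ : Finset (Fin m), F (splitAt σ y r f)) := by
  have h := rel_expand (D := fun j => (D j).toAddSubmonoid) hrefl htrans hadd hF
    (g := fun j => cutPart Finset.univ y r j (f j)) (h := fun j => cutPart ∅ y r j (f j))
    (fun j => hD.cutPart_mem _ y r (hf j)) (fun j => hD.cutPart_mem _ y r (hf j))
  have h1 : (fun j => cutPart Finset.univ y r j (f j)) + (fun j => cutPart ∅ y r j (f j)) = f := by
    ext j : 1
    simp [cutPart, Set.indicator_compl]
  rw [h1] at h
  convert h using 4 with σ
  ext j : 1
  by_cases hj : j ∈ σ <;> simp [splitAt_apply, cutPart, hj]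

end IsDomain

lemma CommDomain.update_mem {b f : Fin m → Rn n → 𝕜} (hf : CommDomain D b f) (j : Fin m) (c : 𝕜)
    (i : Fin m) : Function.update f j ((fun z => b j z - c) * f j) i ∈ D i := by
  by_cases h : i = j
  · subst h
    rw [Function.update_self]
    have : (fun z => b i z - c) * f i = b i * f i - c • f i := by
      ext z; simp [sub_mul]
    rw [this]
    exact (D i).sub_mem (hf i).2 ((D i).smul_mem _ (hf i).1)
  · rw [Function.update_of_ne h]
    exact (hf i).1

lemma CommDomain.splitAt {b f : Fin m → Rn n → 𝕜} (hD : IsDomain s D) (hf : CommDomain D b f)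
    (σ : Finset (Fin m)) (y : Rn n) (r : ℝ) : CommDomain D b (splitAt σ y r f) := fun j =>
  ⟨hD.splitAt_mem σ y r (fun j => (hf j).1) j, by
    rw [splitAt_apply, ← cutPart_mul]
    exact hD.cutPart_mem σ y r (hf j).2⟩

/-- `V` is controlled by its local part and by the values of `U` on the remaining pieces of the
tuple; this is what the commutators of linear and of sublinear operators have in common. -/
def IsCommutatorBound (D : Fin m → Submodule 𝕜 (Rn n → 𝕜)) (b : Fin m → Rn n → 𝕜)
    (U V : (Fin m → Rn n → 𝕜) → Rn n → ℝ≥0∞) : Prop :=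
  ∀ f, CommDomain D b f → ∀ (y : Rn n) (r : ℝ) (c : Fin m → 𝕜), ∀ᵐ x,
    V f x ≤ V (splitAt ∅ y r f) x +
      ∑ j, ∑ σ ∈ Finset.univ.erase ∅, (‖b j x - c j‖ₑ * U (splitAt σ y r f) x +
        U (splitAt σ y r (Function.update f j ((fun z => b j z - c j) * f j))) x)

lemma IsMultilinearOp.isCommutatorBound {T : (Fin m → Rn n → 𝕜) → Rn n → 𝕜}
    (hT : IsMultilinearOp D T) (hD : IsDomain s D) (b : Fin m → Rn n → 𝕜) :
    IsCommutatorBound D b (fun f x => ‖T f x‖ₑ) (fun f x => ‖commLin T b f x‖ₑ) := by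
  intro f hf y r c
  have hfD : ∀ j, f j ∈ D j := fun j => (hf j).1
  have hexp : ∀ g : Fin m → Rn n → 𝕜, (∀ j, g j ∈ D j) →
      ∀ᵐ x, T g x = ∑ σ : Finset (Fin m), T (splitAt σ y r g) x := by
    intro g hg
    have h := hD.rel_splitAt (rel := fun u v : Rn n → 𝕜 => u =ᵐ[volume] v)
      (fun _ => Filter.EventuallyEq.rfl) (fun _ _ _ h1 h2 => h1.trans h2)
      (fun _ _ _ _ h1 h2 => h1.add h2) (F := T) (fun f hf j g hg h hh => hT.add f hf j g hg h hh)
      hg y r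
    filter_upwards [h] with x hx
    rw [hx, Finset.sum_apply]
  have hupd : ∀ j i, Function.update f j (b j * f j) i ∈ D i := fun j i => by
    by_cases h : i = j
    · subst h; rw [Function.update_self]; exact (hf i).2
    · rw [Function.update_of_ne h]; exact hfD i
  have hshift : ∀ j (σ : Finset (Fin m)), ∀ᵐ x,
      T (splitAt σ y r (Function.update f j ((fun z => b j z - c j) * f j))) x =
        T (splitAt σ y r (Function.update f j (b j * f j))) x - c j * T (splitAt σ y r f) x := by
    intro j σ
    have hsD := hD.splitAt_mem σ y r hfD
    have h1 := hT.add _ hsD j _ (hD.cutPart_mem σ y r (hf j).2) _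
      ((D j).smul_mem (-c j) (hsD j))
    have h2 := hT.smul _ hsD j _ (hsD j) (-c j)
    filter_upwards [h1, h2] with x hx1 hx2
    have h3 : cutPart σ y r j ((fun z => b j z - c j) * f j) =
        cutPart σ y r j (b j * f j) + (-c j) • splitAt σ y r f j := by
      rw [splitAt_apply, ← cutPart_smul, ← cutPart_add]
      congr 1
      ext z
      simp
      ring
    rw [splitAt_update, splitAt_update, h3, hx1, hx2, Function.update_eq_self]
    ring
  filter_upwards [hexp f hfD, ae_all_iff.2 fun j => hexp _ (hupd j),
    ae_all_iff.2 fun j => ae_all_iff.2 fun σ => hshift j σ] with x h1 h2 h3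
  have h4 : commLin T b f x = commLin T b (splitAt ∅ y r f) x +
      ∑ j, ∑ σ ∈ Finset.univ.erase ∅, ((b j x - c j) * T (splitAt σ y r f) x -
        T (splitAt σ y r (Function.update f j ((fun z => b j z - c j) * f j))) x) := by
    simp only [commLin]
    rw [← Finset.sum_add_distrib]
    refine Finset.sum_congr rfl fun j _ => ?_
    rw [h2 j, h1, Finset.mul_sum, ← Finset.sum_sub_distrib,
      ← Finset.add_sum_erase _ _ (Finset.mem_univ ∅)]
    congr 1
    · rw [splitAt_update, cutPart_mul, splitAt_apply]
    · refine Finset.sum_congr rfl fun σ _ => ?_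
      rw [h3]
      ring
  rw [h4]
  refine (enorm_add_le _ _).trans (add_le_add_right ((enorm_sum_le _ _).trans
    (Finset.sum_le_sum fun j _ => (enorm_sum_le _ _).trans (Finset.sum_le_sum fun σ _ => ?_))) _)
  rw [← enorm_mul]
  exact enorm_sub_le

lemma IsSublinearOp.isCommutatorBound {T : (Fin m → Rn n → 𝕜) → Rn n → ℝ≥0∞}
    (hT : IsSublinearOp D T) (hD : IsDomain s D) (b : Fin m → Rn n → 𝕜) :
    IsCommutatorBound D b T (commSub T b) := by
  intro f hf y r c
  have hfD : ∀ j, f j ∈ D j := fun j => (hf j).1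
  refine Filter.Eventually.of_forall fun x => ?_
  have hexp : ∀ g : Fin m → Rn n → 𝕜, (∀ j, g j ∈ D j) →
      T g x ≤ ∑ σ : Finset (Fin m), T (splitAt σ y r g) x := by
    intro g hg
    exact hD.rel_splitAt (rel := fun u v : ℝ≥0∞ => u ≤ v)
      (fun _ => le_rfl) (fun _ _ _ h1 h2 => h1.trans h2)
      (fun _ _ _ _ h1 h2 => add_le_add h1 h2) (F := fun f => T f x)
      (fun f hf j g hg h hh => hT.add f hf j g hg h hh x) hg y r
  -- splits off the dependence of the argument on the point `x`, since `c j` is a constant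
  have hφ : ∀ j, (fun z => (b j x - b j z) * f j z) =
      (b j x - c j) • f j + (-1 : 𝕜) • ((fun z => b j z - c j) * f j) := by
    intro j
    ext z
    simp
    ring
  simp only [commSub]
  rw [← Finset.sum_add_distrib]
  refine Finset.sum_le_sum fun j _ => ?_
  have hshD : (fun z => b j z - c j) * f j ∈ D j := by
    simpa using hf.update_mem j (c j) j
  have hφD : ∀ i, Function.update f j (fun z => (b j x - b j z) * f j z) i ∈ D i := by
    intro i
    by_cases h : i = j
    · subst h
      rw [Function.update_self, hφ]
      exact (D i).add_mem ((D i).smul_mem _ (hfD i)) ((D i).smul_mem _ hshD)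
    · rw [Function.update_of_ne h]; exact hfD i
  refine (hexp _ hφD).trans ?_
  rw [← Finset.add_sum_erase _ _ (Finset.mem_univ ∅)]
  refine add_le_add (le_of_eq ?_) (Finset.sum_le_sum fun σ _ => ?_)
  · rw [splitAt_update, splitAt_apply]
    congr 2
    exact cutPart_mul ∅ y r j (fun z => b j x - b j z) (f j)
  · have hsD := hD.splitAt_mem σ y r hfD
    rw [splitAt_update, splitAt_update, hφ, cutPart_add, cutPart_smul, cutPart_smul]
    have hshD' := hD.cutPart_mem σ y r hshD
    refine (hT.add _ hsD j _ ((D j).smul_mem _ (hsD j)) _ ((D j).smul_mem _ hshD') x).trans ?_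
    rw [hT.smul _ hsD j _ hshD', splitAt_apply, ← splitAt_apply, hT.smul _ hsD j _ (hsD j),
      Function.update_eq_self]
    simp

end Expansion


/-! ### The local estimate -/

section Size

variable {𝕜 : Type*} [RCLike 𝕜] {n m : ℕ} {s : ℝ} {D : Fin m → Submodule 𝕜 (Rn n → 𝕜)}

/-- Since `|2^{k+1}B| = 2^{nk} |2B|` and `s ≥ 1`, the average over `2B` is at most `2^{nk}` times
the one over `2^{k+1}B`. This is what the factors `2^{-nk}` in the size condition are for. -/
lemma ballAvg_div_le (hs : 1 ≤ s) (f : Rn n → 𝕜) (y : Rn n) {r : ℝ} (hr : 0 < r) (k : ℕ) :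
    ballAvg s f y (2 * r) * (2 ^ (n * k))⁻¹ ≤ ballAvg s f y (2 ^ (k + 1) * r) := by
  have hs0 : 0 < s := by linarith
  have hv : volume (ball y (2 ^ (k + 1) * r)) = 2 ^ (n * k) * volume (ball y (2 * r)) := by
    rw [pow_succ, mul_assoc, volume_ball_mul y y (by positivity),
      ENNReal.ofReal_pow two_pos.le, ENNReal.ofReal_ofNat, ← pow_mul, mul_comm k]
  have h1 : ((2 : ℝ≥0∞) ^ (n * k))⁻¹ ≤ ((2 : ℝ≥0∞) ^ (n * k))⁻¹ ^ (1 / s) := by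
    have := ENNReal.rpow_le_rpow_of_exponent_ge (x := ((2 : ℝ≥0∞) ^ (n * k))⁻¹)
      (ENNReal.inv_le_one.2 (one_le_pow₀ one_le_two)) ((div_le_one hs0).2 hs)
    rwa [ENNReal.rpow_one] at this
  have hinv : (2 ^ (n * k) * volume (ball y (2 * r)))⁻¹ =
      ((2 : ℝ≥0∞) ^ (n * k))⁻¹ * (volume (ball y (2 * r)))⁻¹ :=
    ENNReal.mul_inv (.inl (by simp)) (.inl (by simp))
  have hsub : ball y (2 * r) ⊆ ball y (2 ^ (k + 1) * r) := by
    refine ball_subset_ball (mul_le_mul_of_nonneg_right ?_ hr.le)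
    calc (2 : ℝ) = 2 ^ 1 := by norm_num
      _ ≤ 2 ^ (k + 1) := pow_le_pow_right₀ one_le_two (by omega)
  unfold ballAvg
  calc _ ≤ (⨍⁻ z in ball y (2 * r), ‖f z‖ₑ ^ s ∂volume) ^ (1 / s) *
        ((2 : ℝ≥0∞) ^ (n * k))⁻¹ ^ (1 / s) := by gcongr
    _ = ((∫⁻ z in ball y (2 * r), ‖f z‖ₑ ^ s) / volume (ball y (2 ^ (k + 1) * r))) ^ (1 / s) := by
        rw [← ENNReal.mul_rpow_of_nonneg _ _ (by positivity), setLAverage_eq, hv,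
          ENNReal.div_eq_inv_mul, ENNReal.div_eq_inv_mul, hinv]
        congr 1
        ring
    _ ≤ _ := by
        rw [setLAverage_eq]
        gcongr

/-- The size condition in terms of averages over the balls `2^{k+1}B`. -/
lemma SizeCondition.le_tsum {ε : Type*} [ENorm ε] (hs : 1 ≤ s) {C₁ : ℝ≥0}
    {T : (Fin m → Rn n → 𝕜) → Rn n → ε} (hT : SizeCondition s C₁ D T) {f : Fin m → Rn n → 𝕜}
    (hf : ∀ i, f i ∈ D i) (y : Rn n) {r : ℝ} (hr : 0 < r) {σ : Finset (Fin m)}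
    (hσ : σ.Nonempty) :
    ∀ᵐ x, x ∈ ball y r → ‖T (splitAt σ y r f) x‖ₑ ≤
      C₁ * ∑' k : ℕ, (k : ℝ≥0∞) * ∏ j, ballAvg s (f j) y (2 ^ (k + 1) * r) := by
  have hs0 : 0 < s := by linarith
  filter_upwards [hT f hf y r hr σ hσ] with x hx hxB
  refine (hx hxB).trans ?_
  rw [mul_assoc, ← ENNReal.tsum_mul_left]
  refine mul_le_mul_right (ENNReal.tsum_le_tsum fun k => ?_) _
  have hk : (k : ℝ≥0∞) / 2 ^ (n * k * σᶜ.card) = k * ((2 : ℝ≥0∞) ^ (n * k))⁻¹ ^ σᶜ.card := by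
    rw [pow_mul, div_eq_mul_inv, ENNReal.inv_pow]
  rw [← Finset.prod_compl_mul_prod σ, hk]
  calc _ = (k : ℝ≥0∞) * ((∏ j ∈ σᶜ, (ballAvg s (f j) y (2 * r) * (2 ^ (n * k))⁻¹)) *
        ∏ j ∈ σ, ((volume (ball y (2 ^ (k + 1) * r)))⁻¹ *
          ∫⁻ z in ball y (2 ^ (k + 1) * r) \ ball y (2 ^ k * r), ‖f j z‖ₑ ^ s) ^ (1 / s)) := by
        rw [Finset.prod_mul_distrib, Finset.prod_const]
        simp only [ballAvg]
        ring
    _ ≤ _ := by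
        refine mul_le_mul_right (mul_le_mul' (Finset.prod_le_prod' fun j _ =>
          ballAvg_div_le hs (f j) y hr k) (Finset.prod_le_prod' fun j _ => ?_)) _
        unfold ballAvg
        rw [setLAverage_eq, ENNReal.div_eq_inv_mul]
        exact ENNReal.rpow_le_rpow (mul_le_mul_right (lintegral_mono_set sdiff_subset) _)
          (by positivity)

end Size

section QuasiNorm

lemma sum_rpow_le {ι : Type*} (S : Finset ι) (a : ι → ℝ≥0∞) {u : ℝ} (hu : 0 < u) :
    (∑ i ∈ S, a i) ^ u ≤ (S.card : ℝ≥0∞) ^ u * ∑ i ∈ S, a i ^ u := by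
  have h1 : ∀ i ∈ S, a i ≤ (∑ i ∈ S, a i ^ u) ^ (1 / u) := fun i hi => by
    calc a i = (a i ^ u) ^ (1 / u) := by
          rw [← ENNReal.rpow_mul, mul_one_div_cancel hu.ne', ENNReal.rpow_one]
      _ ≤ _ := ENNReal.rpow_le_rpow (Finset.single_le_sum (f := fun i => a i ^ u)
          (fun _ _ => zero_le) hi) (by positivity)
  calc (∑ i ∈ S, a i) ^ u ≤ (S.card * (∑ i ∈ S, a i ^ u) ^ (1 / u)) ^ u := by
        refine ENNReal.rpow_le_rpow ?_ hu.le
        simpa using Finset.sum_le_card_nsmul _ _ _ h1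
    _ = _ := by
        rw [ENNReal.mul_rpow_of_nonneg _ _ hu.le, ← ENNReal.rpow_mul, one_div_mul_cancel hu.ne',
          ENNReal.rpow_one]

/-- The quasi-triangle inequality in `L^u`, `0 < u < ∞`, for finitely many functions. -/
lemma lintegral_sum_rpow_le {X ι : Type*} [MeasurableSpace X] {μ : Measure X} (S : Finset ι)
    {g : ι → X → ℝ≥0∞} (hg : ∀ i ∈ S, AEMeasurable (g i) μ) {u : ℝ} (hu : 0 < u) :
    (∫⁻ x, (∑ i ∈ S, g i x) ^ u ∂μ) ^ (1 / u) ≤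
      (S.card * (S.card : ℝ≥0∞) ^ (1 / u)) * ∑ i ∈ S, (∫⁻ x, g i x ^ u ∂μ) ^ (1 / u) := by
  have hu' : 0 < 1 / u := by positivity
  calc (∫⁻ x, (∑ i ∈ S, g i x) ^ u ∂μ) ^ (1 / u)
      ≤ (∫⁻ x, (S.card : ℝ≥0∞) ^ u * ∑ i ∈ S, g i x ^ u ∂μ) ^ (1 / u) :=
        ENNReal.rpow_le_rpow (lintegral_mono fun x => sum_rpow_le S _ hu) hu'.le
    _ = S.card * (∑ i ∈ S, ∫⁻ x, g i x ^ u ∂μ) ^ (1 / u) := by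
        rw [lintegral_const_mul' _ _ (ENNReal.rpow_ne_top_of_nonneg hu.le (by simp)),
          lintegral_finsetSum' _ fun i hi => (hg i hi).pow_const _,
          ENNReal.mul_rpow_of_nonneg _ _ hu'.le, ← ENNReal.rpow_mul, mul_one_div_cancel hu.ne',
          ENNReal.rpow_one]
    _ ≤ S.card * ((S.card : ℝ≥0∞) ^ (1 / u) * ∑ i ∈ S, (∫⁻ x, g i x ^ u ∂μ) ^ (1 / u)) :=
        mul_le_mul_right (sum_rpow_le S _ hu') _
    _ = _ := by ring

end QuasiNorm

section Local

variable {𝕜 : Type*} [RCLike 𝕜] {n m : ℕ} {s q : ℝ} {Q : Fin m → ℝ} {w : Fin m → Rn n → ℝ}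

lemma wLqNormOn_eq_powMeasure {ε : Type*} [ENorm ε] {v : Rn n → ℝ}
    (hv : AEMeasurable (fun x => ENNReal.ofReal (v x)) volume) (q : ℝ) {E : Set (Rn n)}
    (hE : MeasurableSet E) (f : Rn n → ε) :
    wLqNormOn q v E f = (∫⁻ x in E, ‖f x‖ₑ ^ q ∂powMeasure v 1) ^ (1 / q) := by
  have hfin : ∀ᵐ x ∂volume.restrict E, ENNReal.ofReal (v x) ^ (1 : ℝ) < ∞ :=
    Filter.Eventually.of_forall fun x => by simp
  rw [wLqNormOn, powMeasure, restrict_withDensity hE,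
    lintegral_withDensity_eq_lintegral_mul_non_measurable₀ _ (hv.pow_const _).restrict hfin]
  congr 1
  refine lintegral_congr fun x => ?_
  simp [mul_comm]

lemma wLqNorm_indicator {q : ℝ} (hq : 0 < q) (v : Rn n → ℝ) {E : Set (Rn n)}
    (hE : MeasurableSet E) (f : Rn n → 𝕜) : wLqNorm q v (E.indicator f) = wLqNormOn q v E f := by
  rw [wLqNorm, wLqNormOn, ← lintegral_indicator hE]
  congr 1
  refine lintegral_congr fun x => ?_
  by_cases hx : x ∈ E <;> simp [hx, hq]

/-- The tail `∑ₖ k (k+2) ν(2^{k+1}B)^{-1/q} ∏ⱼ ‖fⱼ χ_{2^{k+1}B}‖` which controls the contribution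
of the values of the `fⱼ` far from the ball `B = B(y,r)`. -/
noncomputable def tailSum (q : ℝ) (Q : Fin m → ℝ) (w : Fin m → Rn n → ℝ) (f : Fin m → Rn n → 𝕜)
    (y : Rn n) (r : ℝ) : ℝ≥0∞ :=
  ∑' k : ℕ, (k : ℝ≥0∞) * (k + 2) *
    (wMeas (nuWeight q Q w) (ball y (2 ^ (k + 1) * r)) ^ (-(1 / q)) *
      ∏ j, wLqNormOn (Q j) (w j) (ball y (2 ^ (k + 1) * r)) (f j))

/-- The pointwise estimate of the nonlocal part of the commutator. -/
lemma sum_tail_le (𝕜 : Type*) [RCLike 𝕜] (hn : 1 ≤ n) (hm : 1 ≤ m) (hs : 1 ≤ s)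
    (hsQ : ∀ j, s < Q j) (hq0 : 0 < q) (hq : 1 / q = ∑ j, 1 / Q j)
    (hw : MemMultiAp (q / s) (fun j => Q j / s) w) (C₁ : ℝ≥0) :
    ∃ K : ℝ≥0, ∀ (D : Fin m → Submodule 𝕜 (Rn n → 𝕜)) (b : Fin m → Rn n → 𝕜)
      (U : (Fin m → Rn n → 𝕜) → Rn n → ℝ≥0∞), IsDomain s D → (∀ j, MemBMO (b j)) →
      SizeCondition s C₁ D U → ∀ f, CommDomain D b f → ∀ (y : Rn n) (r : ℝ), 0 < r →
      ∀ᵐ x, x ∈ ball y r →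
        ∑ j, ∑ σ ∈ Finset.univ.erase ∅,
          (‖b j x - ⨍ z in ball y r, b j z‖ₑ * U (splitAt σ y r f) x +
            U (splitAt σ y r (Function.update f j
              ((fun z => b j z - ⨍ z in ball y r, b j z) * f j))) x) ≤
        ∑ j, K * tailSum q Q w f y r *
          (‖b j x - ⨍ z in ball y r, b j z‖ₑ + bmoNorm (b j)) := by
  obtain ⟨K, hK⟩ := prod_ballAvg_le 𝕜 hn hm hs hsQ hq0 hq hw
  refine ⟨2 ^ m * C₁ * K * 2 ^ n, fun D b U hD hb hU f hf y r hr => ?_⟩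
  have hfm : ∀ j, AEStronglyMeasurable (f j) volume := fun j => hD.meas j _ (hf j).1
  set c : Fin m → 𝕜 := fun j => ⨍ z in ball y r, b j z
  set N : ℕ → ℝ≥0∞ := fun k => wMeas (nuWeight q Q w) (ball y (2 ^ (k + 1) * r)) ^ (-(1 / q)) *
      ∏ j, wLqNormOn (Q j) (w j) (ball y (2 ^ (k + 1) * r)) (f j)
  have h1 : ∀ σ ∈ (Finset.univ.erase ∅ : Finset (Finset (Fin m))), ∀ᵐ x, x ∈ ball y r →
      U (splitAt σ y r f) x ≤ C₁ * (K * 2 ^ n) * tailSum q Q w f y r := by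
    intro σ hσ
    have hσ' : σ.Nonempty := Finset.nonempty_iff_ne_empty.2 (Finset.ne_of_mem_erase hσ)
    filter_upwards [hU.le_tsum hs (fun j => (hf j).1) y hr hσ'] with x hx hxB
    refine (hx hxB).trans ?_
    rw [mul_assoc]
    refine mul_le_mul_right ?_ _
    rw [tailSum, ← ENNReal.tsum_mul_left]
    refine ENNReal.tsum_le_tsum fun k => ?_
    calc (k : ℝ≥0∞) * ∏ j, ballAvg s (f j) y (2 ^ (k + 1) * r)
        ≤ k * (K * N k) := mul_le_mul_right (hK f hfm y _ (by positivity)).1 _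
      _ = (K * 1) * (k * 1 * N k) := by ring
      _ ≤ (K * 2 ^ n) * (k * (k + 2) * N k) := by
          gcongr
          · exact one_le_pow₀ one_le_two
          · exact one_le_two.trans le_add_self
  have h2 : ∀ j, ∀ σ ∈ (Finset.univ.erase ∅ : Finset (Finset (Fin m))), ∀ᵐ x, x ∈ ball y r →
      U (splitAt σ y r (Function.update f j ((fun z => b j z - c j) * f j))) x ≤
        C₁ * (K * 2 ^ n) * tailSum q Q w f y r * bmoNorm (b j) := by
    intro j σ hσ
    have hσ' : σ.Nonempty := Finset.nonempty_iff_ne_empty.2 (Finset.ne_of_mem_erase hσ)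
    filter_upwards [hU.le_tsum hs (hf.update_mem j (c j)) y hr hσ'] with x hx hxB
    refine (hx hxB).trans ?_
    rw [mul_assoc, mul_assoc]
    refine mul_le_mul_right ?_ _
    rw [tailSum, mul_comm (∑' k : ℕ, _), ← mul_assoc, ← ENNReal.tsum_mul_left]
    refine ENNReal.tsum_le_tsum fun k => ?_
    have h3 := (hK f hfm y (2 ^ (k + 1) * r) (by positivity)).2 j (b j) (hb j) (c j)
    have h4 := enorm_average_sub_average_pow_le (hb j).1 y hr (k + 1)
    rw [← enorm_neg, neg_sub] at h4
    calc _ ≤ (k : ℝ≥0∞) * (K * ((bmoNorm (b j) + (k + 1 : ℕ) * (2 ^ n * bmoNorm (b j))) * N k)) := by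
          refine mul_le_mul_right (h3.trans ?_) _
          gcongr
      _ ≤ (k : ℝ≥0∞) * (K * ((2 ^ n * bmoNorm (b j) +
            (k + 1 : ℕ) * (2 ^ n * bmoNorm (b j))) * N k)) := by
          gcongr
          exact le_mul_of_one_le_left zero_le (one_le_pow₀ one_le_two)
      _ = (K * 2 ^ n) * bmoNorm (b j) * (k * (k + 2) * N k) := by push_cast; ring
  have h1' := (Finset.eventually_all _).2 h1
  have h2' := ae_all_iff.2 fun j => (Finset.eventually_all _).2 (h2 j)
  filter_upwards [h1', h2'] with x hx1 hx2 hxB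
  refine Finset.sum_le_sum fun j _ => ?_
  set S := tailSum q Q w f y r
  calc _ ≤ ∑ σ ∈ (Finset.univ.erase ∅ : Finset (Finset (Fin m))),
        (‖b j x - c j‖ₑ * (C₁ * (K * 2 ^ n) * S) + C₁ * (K * 2 ^ n) * S * bmoNorm (b j)) :=
        Finset.sum_le_sum fun σ hσ => add_le_add (mul_le_mul_right (hx1 σ hσ hxB) _)
          (hx2 j σ hσ hxB)
    _ = ((Finset.univ.erase ∅ : Finset (Finset (Fin m))).card : ℝ≥0∞) *
        (C₁ * (K * 2 ^ n) * S * (‖b j x - c j‖ₑ + bmoNorm (b j))) := by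
        rw [Finset.sum_const, nsmul_eq_mul]; ring
    _ ≤ 2 ^ m * (C₁ * (K * 2 ^ n) * S * (‖b j x - c j‖ₑ + bmoNorm (b j))) := by
        gcongr
        have : (Finset.univ.erase ∅ : Finset (Finset (Fin m))).card ≤ 2 ^ m := by
          refine (Finset.card_le_univ _).trans ?_
          simp
        exact_mod_cast this
    _ = _ := by push_cast; ring

/-- The estimate of the commutator on a single ball `B = B(y,r)`: the boundedness on Lebesgue
spaces controls the local part, and the size condition the remaining ones. -/
theorem wLqNormOn_commutator_le (𝕜 : Type*) [RCLike 𝕜] (hn : 1 ≤ n) (hm : 1 ≤ m) (hs : 1 ≤ s)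
    (hsQ : ∀ j, s < Q j) (hq0 : 0 < q) (hq : 1 / q = ∑ j, 1 / Q j)
    (hw : MemMultiAp (q / s) (fun j => Q j / s) w) (C₀ C₁ : ℝ≥0) :
    ∃ K : ℝ≥0, ∀ (D : Fin m → Submodule 𝕜 (Rn n → 𝕜)) (b : Fin m → Rn n → 𝕜)
      (U V : (Fin m → Rn n → 𝕜) → Rn n → ℝ≥0∞), IsDomain s D → (∀ j, MemBMO (b j)) →
      SizeCondition s C₁ D U → (∀ f, CommDomain D b f → AEMeasurable (V f) volume) →
      IsCommutatorBound D b U V →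
      BoundedLebesgue (CommDomain D b) V Q w q (nuWeight q Q w) (C₀ * ∑ j, bmoNorm (b j)) →
      ∀ f, CommDomain D b f → ∀ (y : Rn n) (r : ℝ), 0 < r →
      (∀ j, wLqNormOn (Q j) (w j) (ball y (2 * r)) (f j) < ∞) →
      wLqNormOn q (nuWeight q Q w) (ball y r) (V f) ≤ K * (∑ j, bmoNorm (b j)) *
        (∏ j, wLqNormOn (Q j) (w j) (ball y (2 * r)) (f j) +
          wMeas (nuWeight q Q w) (ball y r) ^ (1 / q) * tailSum q Q w f y r) := by
  obtain ⟨K₁, hK₁⟩ := sum_tail_le 𝕜 hn hm hs hsQ hq0 hq hw C₁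
  have hν : IsAInfty (powMeasure (nuWeight q Q w) 1) :=
    hw.isAInfty_nuWeight hm (by linarith) hsQ hq0 hq
  obtain ⟨J, hJ⟩ := weighted_john_nirenberg 𝕜 hn hν hq0
  have hwν : AEMeasurable (fun x => ENNReal.ofReal (nuWeight q Q w x)) volume :=
    aemeasurable_nuWeight q Q hw.1
  set N := powMeasure (nuWeight q Q w) 1
  set R : ℝ≥0 := 2 * 2 ^ (1 / q) * (J + 1) with hR
  set M : ℝ≥0 := (m + 1 : ℕ) * ((m + 1 : ℕ) : ℝ≥0) ^ (1 / q) with hM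
  have hq' : 0 < 1 / q := by positivity
  refine ⟨M * (C₀ + K₁ * R), fun D b U V hD hb hU hVm hUV hbd f hf y r hr hfin => ?_⟩
  set S := tailSum q Q w f y r
  set B := ball y r
  set c : Fin m → 𝕜 := fun j => ⨍ z in B, b j z
  set f₀ := splitAt ∅ y r f with hf₀
  have hf₀ind : ∀ j, f₀ j = (ball y (2 * r)).indicator (f j) := fun j => by simp [hf₀, splitAt]
  have hf₀norm : ∀ j, wLqNorm (Q j) (w j) (f₀ j) =
      wLqNormOn (Q j) (w j) (ball y (2 * r)) (f j) := fun j => by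
    rw [hf₀ind, wLqNorm_indicator ((by linarith [hsQ j] : 0 < Q j)) _ measurableSet_ball]
  have hf₀D : CommDomain D b f₀ := hf.splitAt hD ∅ y r
  have hloc : wLqNormOn q (nuWeight q Q w) B (V f₀) ≤ C₀ * (∑ j, bmoNorm (b j)) *
      ∏ j, wLqNormOn (Q j) (w j) (ball y (2 * r)) (f j) := by
    have h1 := (hbd f₀ hf₀D fun j => ⟨hD.meas j _ (hf₀D j).1, by
      rw [hf₀norm]; exact hfin j⟩).2
    simp_rw [hf₀norm] at h1
    exact (ENNReal.rpow_le_rpow (setLIntegral_le_lintegral _ _) hq'.le).trans h1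
  -- the summands of the pointwise estimate, indexed by `Option (Fin m)`
  set g : Option (Fin m) → Rn n → ℝ≥0∞ := fun i => i.elim (V f₀)
    fun j x => K₁ * S * (‖b j x - c j‖ₑ + bmoNorm (b j)) with hg
  have hbm : ∀ j, AEMeasurable (fun x => ‖b j x - c j‖ₑ) (N.restrict B) := fun j =>
    ((hb j).1.aestronglyMeasurable.mono_ac hν.ac).restrict.sub aestronglyMeasurable_const |>.enorm
  have hgm : ∀ i ∈ Finset.univ, AEMeasurable (g i) (N.restrict B) := by
    rintro (_ | j) _
    · exact ((hVm f₀ hf₀D).mono_ac hν.ac).restrict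
    · exact ((hbm j).add_const _).const_mul _
  have hpt : ∀ᵐ x ∂N.restrict B, V f x ≤ ∑ i, g i x := by
    have h1 : ∀ᵐ x, x ∈ B → V f x ≤ ∑ i, g i x := by
      filter_upwards [hUV f hf y r c, hK₁ D b U hD hb hU f hf y r hr] with x hx1 hx2 hxB
      rw [Fintype.sum_option]
      exact hx1.trans (add_le_add_right (hx2 hxB) _)
    exact (ae_restrict_iff' measurableSet_ball).2 (hν.ac.ae_le h1)
  have hosc : ∀ j, (∫⁻ x in B, g (some j) x ^ q ∂N) ^ (1 / q) ≤
      K₁ * R * (bmoNorm (b j) * (N B ^ (1 / q) * S)) := by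
    intro j
    have h1 := lintegral_sum_rpow_le (μ := N.restrict B) Finset.univ
      (g := fun (i : Bool) x => bif i then ‖b j x - c j‖ₑ else bmoNorm (b j))
      (by rintro (_ | _) _
          · exact aemeasurable_const
          · exact hbm j) hq0
    simp only [Fintype.sum_bool, cond_true, cond_false, lintegral_const,
      Measure.restrict_apply_univ, Finset.card_univ, Fintype.card_bool] at h1
    rw [ENNReal.mul_rpow_of_nonneg (bmoNorm (b j) ^ q) _ hq'.le, ← ENNReal.rpow_mul,
      mul_one_div_cancel hq0.ne', ENNReal.rpow_one] at h1
    have h2 := hJ (b j) (hb j) y r hr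
    calc (∫⁻ x in B, g (some j) x ^ q ∂N) ^ (1 / q)
        = K₁ * S * (∫⁻ x in B, (‖b j x - c j‖ₑ + bmoNorm (b j)) ^ q ∂N) ^ (1 / q) := by
          simp only [hg, Option.elim, ENNReal.mul_rpow_of_nonneg _ _ hq0.le]
          rw [lintegral_const_mul'' _ (((hbm j).add_const _).pow_const _),
            ENNReal.mul_rpow_of_nonneg _ _ hq'.le, ← ENNReal.mul_rpow_of_nonneg _ _ hq0.le,
            ← ENNReal.rpow_mul, mul_one_div_cancel hq0.ne', ENNReal.rpow_one]
      _ ≤ K₁ * S * ((2 : ℕ) * ((2 : ℕ) : ℝ≥0∞) ^ (1 / q) *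
            (J * bmoNorm (b j) * N B ^ (1 / q) + bmoNorm (b j) * N B ^ (1 / q))) :=
          mul_le_mul_right (h1.trans (mul_le_mul_right (add_le_add_left h2 _) _)) _
      _ = _ := by
          rw [hR]
          push_cast
          rw [ENNReal.coe_rpow_of_nonneg _ hq'.le]
          push_cast
          ring
  have hcard : (Finset.univ : Finset (Option (Fin m))).card = m + 1 := by simp
  have hMcoe : (M : ℝ≥0∞) = ((m + 1 : ℕ) : ℝ≥0∞) * ((m + 1 : ℕ) : ℝ≥0∞) ^ (1 / q) := by
    rw [hM, ENNReal.coe_mul, ENNReal.coe_rpow_of_nonneg _ hq'.le]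
    simp
  rw [wLqNormOn_eq_powMeasure hwν q measurableSet_ball] at hloc ⊢
  rw [← powMeasure_one_apply _ measurableSet_ball]
  set P₀ := ∏ j, wLqNormOn (Q j) (w j) (ball y (2 * r)) (f j)
  calc (∫⁻ x in B, ‖V f x‖ₑ ^ q ∂N) ^ (1 / q)
      ≤ (∫⁻ x in B, (∑ i, g i x) ^ q ∂N) ^ (1 / q) := by
        refine ENNReal.rpow_le_rpow (lintegral_mono_ae ?_) hq'.le
        filter_upwards [hpt] with x hx
        exact ENNReal.rpow_le_rpow hx hq0.le
    _ ≤ M * ∑ i, (∫⁻ x in B, g i x ^ q ∂N) ^ (1 / q) := by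
        have := lintegral_sum_rpow_le (μ := N.restrict B) Finset.univ hgm hq0
        rwa [hcard, ← hMcoe] at this
    _ ≤ M * (C₀ * (∑ j, bmoNorm (b j)) * P₀ +
          ∑ j, K₁ * R * (bmoNorm (b j) * (N B ^ (1 / q) * S))) := by
        rw [Fintype.sum_option]
        exact mul_le_mul_right (add_le_add hloc (Finset.sum_le_sum fun j _ => hosc j)) _
    _ = M * (∑ j, bmoNorm (b j)) * (C₀ * P₀ + K₁ * R * (N B ^ (1 / q) * S)) := by
        rw [← Finset.mul_sum, ← Finset.sum_mul]
        ring
    _ ≤ M * (∑ j, bmoNorm (b j)) * ((C₀ + K₁ * R) * P₀ + (C₀ + K₁ * R) * (N B ^ (1 / q) * S)) := by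
        gcongr
        · exact le_self_add
        · exact le_add_self
    _ = _ := by push_cast; ring

end Local


/-! ### Norms in the centre of the ball -/

section Lp

variable {X : Type*} [MeasurableSpace X] {μ : Measure X}

lemma ae_lt_top_of_eLpNorm {p : ℝ≥0∞} (hp : p ≠ 0) {φ : X → ℝ≥0∞} (hφ : AEMeasurable φ μ)
    (h : eLpNorm φ p μ < ∞) : ∀ᵐ x ∂μ, φ x < ∞ := by
  rcases eq_or_ne p ∞ with rfl | hp'
  · rw [eLpNorm_exponent_top] at h
    filter_upwards [enorm_ae_le_eLpNormEssSup φ μ] with x hx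
    exact hx.trans_lt h
  · have hpos := ENNReal.toReal_pos hp hp'
    rw [eLpNorm_eq_lintegral_rpow_enorm_toReal hp hp', ENNReal.rpow_lt_top_iff_of_pos
      (by positivity)] at h
    filter_upwards [ae_lt_top' (hφ.enorm.pow_const _) h.ne] with x hx
    rwa [ENNReal.rpow_lt_top_iff_of_pos hpos] at hx

/-- Hölder's inequality for finite products, with exponents `pⱼ = p / θⱼ` in `(0, ∞]`. -/
lemma eLpNorm_prod_le {ι : Type*} [Fintype ι] {p : ℝ≥0∞} (hp : p ≠ 0) {P : ι → ℝ≥0∞}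
    {θ : ι → ℝ} (hθ : ∀ j, 0 < θ j) (hsum : ∑ j, θ j = 1)
    (hP : ∀ j, (P j)⁻¹ = ENNReal.ofReal (θ j) * p⁻¹) {φ : ι → X → ℝ≥0∞}
    (hφ : ∀ j, AEMeasurable (φ j) μ) :
    eLpNorm (fun x => ∏ j, φ j x) p μ ≤ ∏ j, eLpNorm (φ j) (P j) μ := by
  rcases eq_or_ne p ∞ with rfl | hp'
  · have hPj : ∀ j, P j = ∞ := fun j => by
      have := hP j
      rwa [ENNReal.inv_top, mul_zero, ENNReal.inv_eq_zero] at this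
    simp_rw [hPj, eLpNorm_exponent_top]
    refine eLpNormEssSup_le_of_ae_enorm_bound ?_
    filter_upwards [ae_all_iff.2 fun j => enorm_ae_le_eLpNormEssSup (φ j) μ] with x hx
    exact Finset.prod_le_prod' fun j _ => hx j
  · have hpos := ENNReal.toReal_pos hp hp'
    have hPtop : ∀ j, P j ≠ ∞ := fun j h => by
      have := hP j
      rw [h, ENNReal.inv_top, eq_comm, mul_eq_zero, ENNReal.inv_eq_zero] at this
      rcases this with h1 | h1
      · exact (ENNReal.ofReal_pos.2 (hθ j)).ne' h1
      · exact hp' h1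
    have hP0 : ∀ j, P j ≠ 0 := fun j h => by
      have := hP j
      rw [h, ENNReal.inv_zero, eq_comm] at this
      exact ENNReal.mul_ne_top ENNReal.ofReal_ne_top (ENNReal.inv_ne_top.2 hp) this
    have hPr : ∀ j, 1 / (P j).toReal = θ j * (1 / p.toReal) := fun j => by
      have := congrArg ENNReal.toReal (hP j)
      rwa [ENNReal.toReal_mul, ENNReal.toReal_inv, ENNReal.toReal_inv,
        ENNReal.toReal_ofReal (hθ j).le, ← one_div, ← one_div] at this
    have hPpos : ∀ j, 0 < (P j).toReal := fun j => ENNReal.toReal_pos (hP0 j) (hPtop j)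
    rw [eLpNorm_eq_lintegral_rpow_enorm_toReal hp hp']
    simp_rw [fun j => eLpNorm_eq_lintegral_rpow_enorm_toReal (f := φ j) (μ := μ) (hP0 j) (hPtop j),
      enorm_eq_self, hPr]
    calc (∫⁻ x, (∏ j, φ j x) ^ p.toReal ∂μ) ^ (1 / p.toReal)
        = (∫⁻ x, ∏ j, (φ j x ^ (P j).toReal) ^ θ j ∂μ) ^ (1 / p.toReal) := by
          congr 1
          refine lintegral_congr fun x => ?_
          rw [← ENNReal.prod_rpow_of_nonneg hpos.le]
          refine Finset.prod_congr rfl fun j _ => ?_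
          rw [← ENNReal.rpow_mul]
          congr 1
          have h1 := hPr j
          have h2 := (hPpos j).ne'
          field_simp at h1
          linarith
      _ ≤ (∏ j, (∫⁻ x, φ j x ^ (P j).toReal ∂μ) ^ θ j) ^ (1 / p.toReal) := by
          refine ENNReal.rpow_le_rpow ?_ (by positivity)
          exact ENNReal.lintegral_prod_norm_pow_le _ (fun j _ => (hφ j).pow_const _) hsum
            fun j _ => (hθ j).le
      _ = _ := by
          rw [← ENNReal.prod_rpow_of_nonneg (by positivity)]
          simp_rw [← ENNReal.rpow_mul]

/-- The `L^p` quasinorm of a rapidly convergent series, for all `0 < p ≤ ∞` at once: the series is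
at most a constant times `supₖ κ^k Φₖ`, and `(supₖ κ^k Φₖ)^p ≤ ∑ₖ κ^{kp} Φₖ^p` for `p < ∞`. -/
lemma eLpNorm_le_of_tsum {p : ℝ≥0∞} (hp : p ≠ 0) {lam : ℝ≥0} (hlam : lam < 1) :
    ∃ K : ℝ≥0, ∀ (g : X → ℝ≥0∞) (Φ : ℕ → X → ℝ≥0∞) (A c : ℝ≥0∞), (∀ k, AEMeasurable (Φ k) μ) →
      (∀ k, eLpNorm (Φ k) p μ ≤ A) →
      (∀ᵐ x ∂μ, g x ≤ c * ∑' k : ℕ, (k + 1 : ℝ≥0∞) ^ 2 * lam ^ k * Φ k x) →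
      eLpNorm g p μ ≤ c * K * A := by
  set κ : ℝ≥0 := NNReal.sqrt lam with hκ
  have hκ1 : κ < 1 := by
    rw [hκ, ← NNReal.sqrt_one]
    exact NNReal.sqrt_lt_sqrt.2 hlam
  have hκκ : κ * κ = lam := NNReal.mul_self_sqrt lam
  set S : ℝ≥0∞ := ∑' k : ℕ, ((k + 1 : ℕ) : ℝ≥0∞) ^ (2 : ℝ) * (κ : ℝ≥0∞) ^ k with hS
  have hSt : S ≠ ∞ := summable_moment hκ1 2
  -- reduction to the supremum
  have hsup : ∀ (Φ : ℕ → X → ℝ≥0∞) x, ∑' k : ℕ, (k + 1 : ℝ≥0∞) ^ 2 * lam ^ k * Φ k x ≤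
      S * ⨆ k, (κ : ℝ≥0∞) ^ k * Φ k x := by
    intro Φ x
    rw [hS, ← ENNReal.tsum_mul_right]
    refine ENNReal.tsum_le_tsum fun k => ?_
    calc (k + 1 : ℝ≥0∞) ^ 2 * lam ^ k * Φ k x
        = ((k + 1 : ℕ) : ℝ≥0∞) ^ (2 : ℝ) * (κ : ℝ≥0∞) ^ k * ((κ : ℝ≥0∞) ^ k * Φ k x) := by
          rw [← hκκ, ENNReal.rpow_two]
          push_cast
          ring
      _ ≤ _ := by
          gcongr
          exact le_iSup (fun k => (κ : ℝ≥0∞) ^ k * Φ k x) k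
  rcases eq_or_ne p ∞ with rfl | hp'
  · refine ⟨S.toNNReal, fun g Φ A c _ hA hg => ?_⟩
    rw [ENNReal.coe_toNNReal hSt, eLpNorm_exponent_top]
    simp_rw [eLpNorm_exponent_top] at hA
    refine eLpNormEssSup_le_of_ae_enorm_bound ?_
    filter_upwards [hg, ae_all_iff.2 fun k => enorm_ae_le_eLpNormEssSup (Φ k) μ] with x hx hΦ
    refine hx.trans ?_
    rw [mul_assoc]
    refine mul_le_mul_right ((hsup Φ x).trans (mul_le_mul_right (iSup_le fun k => ?_) _)) _
    calc (κ : ℝ≥0∞) ^ k * Φ k x ≤ 1 * A :=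
          mul_le_mul' (pow_le_one₀ zero_le (by exact_mod_cast hκ1.le)) ((hΦ k).trans (hA k))
      _ = A := one_mul A
  · have hpos := ENNReal.toReal_pos hp hp'
    set P := p.toReal
    have hκP : κ ^ P < 1 := NNReal.rpow_lt_one hκ1 hpos
    set T : ℝ≥0∞ := ∑' k : ℕ, ((κ ^ P : ℝ≥0) : ℝ≥0∞) ^ k with hT
    have hTt : T ≠ ∞ := by
      rw [hT, ENNReal.tsum_geometric]
      exact ENNReal.inv_ne_top.2 (tsub_pos_of_lt (by exact_mod_cast hκP)).ne'
    have hKt : S * T ^ (1 / P) ≠ ∞ :=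
      ENNReal.mul_ne_top hSt (ENNReal.rpow_ne_top_of_nonneg (by positivity) hTt)
    refine ⟨(S * T ^ (1 / P)).toNNReal, fun g Φ A c hm hA hg => ?_⟩
    rw [ENNReal.coe_toNNReal hKt, eLpNorm_eq_lintegral_rpow_enorm_toReal hp hp']
    simp_rw [eLpNorm_eq_lintegral_rpow_enorm_toReal hp hp'] at hA
    simp_rw [enorm_eq_self] at hA ⊢
    have hA' : ∀ k, ∫⁻ x, Φ k x ^ P ∂μ ≤ A ^ P := fun k => by
      have := ENNReal.rpow_le_rpow (hA k) hpos.le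
      rwa [← ENNReal.rpow_mul, one_div_mul_cancel hpos.ne', ENNReal.rpow_one] at this
    have hsm : AEMeasurable (fun x => ⨆ k, (κ : ℝ≥0∞) ^ k * Φ k x) μ :=
      .iSup fun k => (hm k).const_mul _
    have hsP : ∫⁻ x, (⨆ k, (κ : ℝ≥0∞) ^ k * Φ k x) ^ P ∂μ ≤ T * A ^ P := by
      calc ∫⁻ x, (⨆ k, (κ : ℝ≥0∞) ^ k * Φ k x) ^ P ∂μ
          ≤ ∫⁻ x, ∑' k, ((κ : ℝ≥0∞) ^ k * Φ k x) ^ P ∂μ := by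
            refine lintegral_mono fun x => ?_
            have h1 : (⨆ k, (κ : ℝ≥0∞) ^ k * Φ k x) ≤
                (∑' k, ((κ : ℝ≥0∞) ^ k * Φ k x) ^ P) ^ (1 / P) := by
              refine iSup_le fun k => ?_
              calc (κ : ℝ≥0∞) ^ k * Φ k x = (((κ : ℝ≥0∞) ^ k * Φ k x) ^ P) ^ (1 / P) := by
                    rw [← ENNReal.rpow_mul, mul_one_div_cancel hpos.ne', ENNReal.rpow_one]
                _ ≤ _ := ENNReal.rpow_le_rpow
                    (ENNReal.le_tsum (f := fun k => ((κ : ℝ≥0∞) ^ k * Φ k x) ^ P) k)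
                    (by positivity)
            have := ENNReal.rpow_le_rpow h1 hpos.le
            rwa [← ENNReal.rpow_mul, one_div_mul_cancel hpos.ne', ENNReal.rpow_one] at this
        _ = ∑' k, ((κ ^ P : ℝ≥0) : ℝ≥0∞) ^ k * ∫⁻ x, Φ k x ^ P ∂μ := by
            rw [lintegral_tsum fun k => ((hm k).const_mul _).pow_const _]
            congr 1
            ext k
            simp_rw [ENNReal.mul_rpow_of_nonneg _ _ hpos.le]
            rw [lintegral_const_mul'' _ ((hm k).pow_const _), ENNReal.coe_rpow_of_nonneg _ hpos.le,
              ← ENNReal.rpow_natCast, ← ENNReal.rpow_natCast, ← ENNReal.rpow_mul,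
              ← ENNReal.rpow_mul, mul_comm P]
        _ ≤ ∑' k : ℕ, ((κ ^ P : ℝ≥0) : ℝ≥0∞) ^ k * A ^ P :=
            ENNReal.tsum_le_tsum fun k => mul_le_mul_right (hA' k) _
        _ = T * A ^ P := by rw [ENNReal.tsum_mul_right]
    calc (∫⁻ x, g x ^ P ∂μ) ^ (1 / P)
        ≤ (∫⁻ x, (c * S) ^ P * (⨆ k, (κ : ℝ≥0∞) ^ k * Φ k x) ^ P ∂μ) ^ (1 / P) := by
          refine ENNReal.rpow_le_rpow (lintegral_mono_ae ?_) (by positivity)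
          filter_upwards [hg] with x hx
          rw [← ENNReal.mul_rpow_of_nonneg _ _ hpos.le, mul_assoc]
          exact ENNReal.rpow_le_rpow (hx.trans (mul_le_mul_right (hsup Φ x) _)) hpos.le
      _ ≤ ((c * S) ^ P * (T * A ^ P)) ^ (1 / P) := by
          rw [lintegral_const_mul'' _ (hsm.pow_const _)]
          gcongr
      _ = c * (S * T ^ (1 / P)) * A := by
          have h1 : 0 ≤ 1 / P := by positivity
          rw [ENNReal.mul_rpow_of_nonneg _ _ h1, ENNReal.mul_rpow_of_nonneg _ _ h1,
            ← ENNReal.rpow_mul, ← ENNReal.rpow_mul, mul_one_div_cancel hpos.ne', ENNReal.rpow_one,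
            ENNReal.rpow_one]
          ring

end Lp

section Measurability

variable {n : ℕ}

lemma measurable_lintegral_ball {g : Rn n → ℝ≥0∞} (hg : AEMeasurable g volume) (r : ℝ) :
    Measurable fun y => ∫⁻ x in ball y r, g x := by
  have h1 : ∀ y, ∫⁻ x in ball y r, g x =
      ∫⁻ x, {z : Rn n × Rn n | dist z.2 z.1 < r}.indicator (fun z => hg.mk g z.2) (y, x) := by
    intro y
    rw [setLIntegral_congr_fun_ae measurableSet_ball
      (hg.ae_eq_mk.mono fun x hx _ => hx), ← lintegral_indicator measurableSet_ball]
    rfl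
  simp_rw [h1]
  refine Measurable.lintegral_prod_right' (ν := volume) (f := fun z : Rn n × Rn n =>
    {z : Rn n × Rn n | dist z.2 z.1 < r}.indicator (fun z => hg.mk g z.2) z) ?_
  refine Measurable.indicator (hg.measurable_mk.comp measurable_snd) ?_
  exact measurableSet_lt (measurable_snd.dist measurable_fst) measurable_const

lemma IsWeight.wMeas_ne_zero {w : Rn n → ℝ} (hw : IsWeight w) (y : Rn n) {r : ℝ} (hr : 0 < r) :
    wMeas w (ball y r) ≠ 0 := by
  intro h
  rw [wMeas, lintegral_eq_zero_iff' hw.aemeasurable.restrict] at h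
  have h1 : ∀ᵐ x ∂volume.restrict (ball y r), False := by
    filter_upwards [h, ae_restrict_of_ae hw.2] with x hx hpos
    simp only [Pi.zero_apply, ENNReal.ofReal_eq_zero] at hx
    linarith
  rw [Filter.eventually_false_iff_eq_bot, ae_eq_bot, Measure.restrict_eq_zero] at h1
  exact volume_ball_ne_zero y hr h1

lemma IsWeight.wMeas_ne_top {w : Rn n → ℝ} (hw : IsWeight w) (y : Rn n) (r : ℝ) :
    wMeas w (ball y r) ≠ ∞ :=
  (integrableOn_ball hw.1 y r).lintegral_lt_top.ne

end Measurability


/-! ### Boundedness on amalgam spaces -/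

section Final

variable {n m : ℕ} {q : ℝ} {Q : Fin m → ℝ} {w : Fin m → Rn n → ℝ}

/-- The function of the centre `y` whose `L^p` norm is the norm of `(L^q(w), L^p)^α` at radius `r`;
here `e = 1/α - 1/q - 1/p`. -/
noncomputable def localNorm {ε : Type*} [ENorm ε] (q : ℝ) (w : Rn n → ℝ) (e r : ℝ) (f : Rn n → ε)
    (y : Rn n) : ℝ≥0∞ :=
  wMeas w (ball y r) ^ e * wLqNormOn q w (ball y r) f

lemma eLpNorm_localNorm_le {ε : Type*} [ENorm ε] (q : ℝ) (w : Rn n → ℝ) (p : ℝ≥0∞) (α : ℝ)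
    (f : Rn n → ε) {r : ℝ} (hr : 0 < r) :
    eLpNorm (localNorm q w (1 / α - 1 / q - (p⁻¹).toReal) r f) p volume ≤
      amalgamNorm q w p α f := by
  unfold amalgamNorm
  exact le_iSup₂_of_le r hr le_rfl

lemma aemeasurable_localNorm {𝕜 : Type*} [RCLike 𝕜] (q : ℝ) {w : Rn n → ℝ} (hw : IsWeight w)
    (e r : ℝ) {f : Rn n → 𝕜} (hf : AEStronglyMeasurable f volume) :
    AEMeasurable (localNorm q w e r f) volume := by
  refine (((measurable_lintegral_ball hw.aemeasurable r).pow_const _).mul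
    ((measurable_lintegral_ball ?_ r).pow_const _)).aemeasurable
  exact (hf.enorm.pow_const _).mul hw.aemeasurable

lemma rpow_le_rpow_of_nonpos {x y : ℝ≥0∞} (h : x ≤ y) {z : ℝ} (hz : z ≤ 0) : y ^ z ≤ x ^ z := by
  have := ENNReal.inv_le_inv.2 (ENNReal.rpow_le_rpow h (neg_nonneg.2 hz))
  rwa [← ENNReal.rpow_neg, ← ENNReal.rpow_neg, neg_neg] at this

/-- The passage from the local estimate to the amalgam norms: for `e = γ - 1/q ≤ 0` and `γ > 0`,
multiplication by `ν(B)^e` turns the local part and the tail into a series of products of local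
norms, in which the reverse doubling of `ν` provides a geometric factor. -/
lemma rpow_mul_tailSum_le (𝕜 : Type*) [RCLike 𝕜] (hn : 1 ≤ n)
    (hν : IsAInfty (powMeasure (nuWeight q Q w) 1)) (hw : ∀ j, MemAinfty (w j))
    (hθ : ∀ j, 0 < q / Q j) (hsum : ∑ j, q / Q j = 1) {e γ : ℝ} (he : e ≤ 0) (hγ : 0 < γ)
    (heγ : e = γ - 1 / q) :
    ∃ K lam : ℝ≥0, lam < 1 ∧ ∀ (f : Fin m → Rn n → 𝕜) (y : Rn n) (r : ℝ), 0 < r →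
      wMeas (nuWeight q Q w) (ball y r) ^ e *
        (∏ j, wLqNormOn (Q j) (w j) (ball y (2 * r)) (f j) +
          wMeas (nuWeight q Q w) (ball y r) ^ (1 / q) * tailSum q Q w f y r) ≤
      K * ∑' k : ℕ, (k + 1 : ℝ≥0∞) ^ 2 * lam ^ k *
        ∏ j, localNorm (Q j) (w j) (q / Q j * e) (2 ^ (k + 1) * r) (f j) y := by
  have hw' : ∀ j, IsWeight (w j) := fun j => (hw j).choose_spec.2.1
  obtain ⟨C, hC⟩ := prod_measure_ball_le hw hθ hsum
  obtain ⟨Kd, hKd⟩ := hν.doubling one_le_two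
  obtain ⟨θ, hθ1, hrev⟩ := hν.reverse_doubling hn
  simp_rw [powMeasure_one_apply _ measurableSet_ball] at hKd hrev
  have hV0 : ∀ y r, 0 < r → wMeas (nuWeight q Q w) (ball y r) ≠ 0 := fun y r hr => by
    rw [← powMeasure_one_apply _ measurableSet_ball]; exact hν.pos y r hr
  have hVt : ∀ y r, wMeas (nuWeight q Q w) (ball y r) ≠ ∞ := fun y r => by
    rw [← powMeasure_one_apply _ measurableSet_ball]; exact hν.fin y r
  set V : Rn n → ℝ → ℝ≥0∞ := fun y r => wMeas (nuWeight q Q w) (ball y r)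
  -- Hölder's inequality can be reversed, and `e ≤ 0`
  have hVe : ∀ y r, 0 < r → V y r ^ e ≤
      ((C + 1 : ℝ≥0) : ℝ≥0∞) ^ (-e) * ∏ j, wMeas (w j) (ball y r) ^ (q / Q j * e) := by
    intro y r hr
    have h1 : ∏ j, wMeas (w j) (ball y r) ^ (q / Q j) ≤ (C + 1 : ℝ≥0) * V y r :=
      (hC y r hr).trans (by gcongr; simp)
    have h2 := rpow_le_rpow_of_nonpos h1 he
    rw [ENNReal.mul_rpow_of_ne_top ENNReal.coe_ne_top (hVt y r), ← ENNReal.prod_rpow_of_ne_top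
      fun j _ => ENNReal.rpow_ne_top_of_nonneg (hθ j).le ((hw' j).wMeas_ne_top y r)] at h2
    simp_rw [← ENNReal.rpow_mul] at h2
    calc V y r ^ e = ((C + 1 : ℝ≥0) : ℝ≥0∞) ^ (-e) * (((C + 1 : ℝ≥0) : ℝ≥0∞) ^ e * V y r ^ e) := by
          rw [← mul_assoc, ← ENNReal.rpow_add _ _ (by simp) ENNReal.coe_ne_top, neg_add_cancel,
            ENNReal.rpow_zero, one_mul]
      _ ≤ _ := mul_le_mul_right h2 _
  have hVd : ∀ y r, 0 < r → V y r ^ e ≤ ((Kd + 1 : ℝ≥0) : ℝ≥0∞) ^ (-e) * V y (2 * r) ^ e := by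
    intro y r hr
    have h1 : V y (2 * r) ≤ (Kd + 1 : ℝ≥0) * V y r := (hKd y r hr).trans (by gcongr; simp)
    have h2 := rpow_le_rpow_of_nonpos h1 he
    rw [ENNReal.mul_rpow_of_ne_top ENNReal.coe_ne_top (hVt y r)] at h2
    calc V y r ^ e = ((Kd + 1 : ℝ≥0) : ℝ≥0∞) ^ (-e) *
          (((Kd + 1 : ℝ≥0) : ℝ≥0∞) ^ e * V y r ^ e) := by
          rw [← mul_assoc, ← ENNReal.rpow_add _ _ (by simp) ENNReal.coe_ne_top, neg_add_cancel,
            ENNReal.rpow_zero, one_mul]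
      _ ≤ _ := mul_le_mul_right h2 _
  set lam : ℝ≥0 := θ ^ γ with hlam
  have hlam1 : lam < 1 := NNReal.rpow_lt_one hθ1 hγ
  have hVk : ∀ y r, 0 < r → ∀ k : ℕ, V y r ^ e * (V y r ^ (1 / q) *
      V y (2 ^ (k + 1) * r) ^ (-(1 / q))) ≤ (lam : ℝ≥0∞) ^ k * V y (2 ^ (k + 1) * r) ^ e := by
    intro y r hr k
    have hrk : 0 < 2 ^ (k + 1) * r := by positivity
    calc V y r ^ e * (V y r ^ (1 / q) * V y (2 ^ (k + 1) * r) ^ (-(1 / q)))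
        = V y r ^ γ * V y (2 ^ (k + 1) * r) ^ (-(1 / q)) := by
          rw [← mul_assoc, ← ENNReal.rpow_add _ _ (hV0 y r hr) (hVt y r), heγ, sub_add_cancel]
      _ ≤ ((θ : ℝ≥0∞) ^ (k + 1) * V y (2 ^ (k + 1) * r)) ^ γ *
            V y (2 ^ (k + 1) * r) ^ (-(1 / q)) := by
          gcongr
          exact hrev y r hr (k + 1)
      _ = (lam : ℝ≥0∞) ^ (k + 1) * V y (2 ^ (k + 1) * r) ^ e := by
          rw [ENNReal.mul_rpow_of_nonneg _ _ hγ.le, mul_assoc,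
            ← ENNReal.rpow_add _ _ (hV0 y _ hrk) (hVt y _), ← sub_eq_add_neg, ← heγ, hlam,
            ENNReal.coe_rpow_of_nonneg _ hγ.le, ← ENNReal.rpow_natCast, ← ENNReal.rpow_natCast,
            ← ENNReal.rpow_mul, ← ENNReal.rpow_mul, mul_comm γ]
      _ ≤ _ := by
          gcongr ?_ * _
          exact pow_le_pow_of_le_one zero_le (by exact_mod_cast hlam1.le) (Nat.le_succ k)
  have hprod : ∀ (f : Fin m → Rn n → 𝕜) y r, 0 < r →
      V y r ^ e * ∏ j, wLqNormOn (Q j) (w j) (ball y r) (f j) ≤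
        ((C + 1 : ℝ≥0) : ℝ≥0∞) ^ (-e) *
          ∏ j, localNorm (Q j) (w j) (q / Q j * e) r (f j) y := by
    intro f y r hr
    simp only [localNorm]
    rw [Finset.prod_mul_distrib, ← mul_assoc]
    gcongr
    exact hVe y r hr
  have hne : 0 ≤ -e := neg_nonneg.2 he
  refine ⟨(C + 1) ^ (-e) * ((Kd + 1) ^ (-e) + 1), lam, hlam1, fun f y r hr => ?_⟩
  set c₁ : ℝ≥0∞ := ((C + 1 : ℝ≥0) : ℝ≥0∞) ^ (-e)
  set c₂ : ℝ≥0∞ := ((Kd + 1 : ℝ≥0) : ℝ≥0∞) ^ (-e)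
  have hcoe : (((C + 1) ^ (-e) * ((Kd + 1) ^ (-e) + 1) : ℝ≥0) : ℝ≥0∞) = c₁ * (c₂ + 1) := by
    rw [ENNReal.coe_mul, ENNReal.coe_add, ENNReal.coe_rpow_of_nonneg _ hne,
      ENNReal.coe_rpow_of_nonneg _ hne, ENNReal.coe_one]
  set Φ : ℕ → ℝ≥0∞ := fun k =>
    ∏ j, localNorm (Q j) (w j) (q / Q j * e) (2 ^ (k + 1) * r) (f j) y with hΦ
  have hlocal : V y r ^ e * ∏ j, wLqNormOn (Q j) (w j) (ball y (2 * r)) (f j) ≤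
      c₁ * (c₂ + 1) * ∑' k : ℕ, (lam : ℝ≥0∞) ^ k * Φ k := by
    calc V y r ^ e * ∏ j, wLqNormOn (Q j) (w j) (ball y (2 * r)) (f j)
        ≤ c₂ * V y (2 * r) ^ e * ∏ j, wLqNormOn (Q j) (w j) (ball y (2 * r)) (f j) :=
          mul_le_mul_left (hVd y r hr) _
      _ ≤ c₂ * (c₁ * ∏ j, localNorm (Q j) (w j) (q / Q j * e) (2 * r) (f j) y) := by
          rw [mul_assoc]
          exact mul_le_mul_right (hprod f y (2 * r) (by positivity)) _
      _ = c₁ * c₂ * ((lam : ℝ≥0∞) ^ 0 * Φ 0) := by simp only [hΦ, zero_add, pow_one]; ring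
      _ ≤ c₁ * (c₂ + 1) * ∑' k : ℕ, (lam : ℝ≥0∞) ^ k * Φ k := by
          gcongr
          · exact le_self_add
          · exact ENNReal.le_tsum (f := fun k => (lam : ℝ≥0∞) ^ k * Φ k) 0
  have htail : V y r ^ e * (V y r ^ (1 / q) * tailSum q Q w f y r) ≤
      c₁ * (c₂ + 1) * ∑' k : ℕ, (k : ℝ≥0∞) * (k + 2) * (lam : ℝ≥0∞) ^ k * Φ k := by
    rw [tailSum, ← mul_assoc, ← ENNReal.tsum_mul_left, ← ENNReal.tsum_mul_left]
    refine ENNReal.tsum_le_tsum fun k => ?_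
    have hrk : 0 < 2 ^ (k + 1) * r := by positivity
    calc V y r ^ e * V y r ^ (1 / q) * (k * (k + 2) * (V y (2 ^ (k + 1) * r) ^ (-(1 / q)) *
          ∏ j, wLqNormOn (Q j) (w j) (ball y (2 ^ (k + 1) * r)) (f j)))
        = k * (k + 2) * (V y r ^ e * (V y r ^ (1 / q) * V y (2 ^ (k + 1) * r) ^ (-(1 / q)))) *
          ∏ j, wLqNormOn (Q j) (w j) (ball y (2 ^ (k + 1) * r)) (f j) := by ring
      _ ≤ k * (k + 2) * ((lam : ℝ≥0∞) ^ k * V y (2 ^ (k + 1) * r) ^ e) *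
          ∏ j, wLqNormOn (Q j) (w j) (ball y (2 ^ (k + 1) * r)) (f j) :=
          mul_le_mul_left (mul_le_mul_right (hVk y r hr k) _) _
      _ = k * (k + 2) * (lam : ℝ≥0∞) ^ k * (V y (2 ^ (k + 1) * r) ^ e *
          ∏ j, wLqNormOn (Q j) (w j) (ball y (2 ^ (k + 1) * r)) (f j)) := by ring
      _ ≤ k * (k + 2) * (lam : ℝ≥0∞) ^ k * (c₁ * Φ k) :=
          mul_le_mul_right (hprod f y _ hrk) _
      _ = c₁ * 1 * (k * (k + 2) * (lam : ℝ≥0∞) ^ k * Φ k) := by ring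
      _ ≤ _ := by gcongr; exact le_add_self
  rw [mul_add, hcoe]
  refine (add_le_add hlocal htail).trans (le_of_eq ?_)
  rw [← mul_add, ← ENNReal.tsum_add]
  congr 2
  ext k
  ring

/-- Boundedness on amalgam spaces for a `[0,∞]`-valued operator `V` that satisfies
`IsCommutatorBound`; linear and sublinear operators are both covered. -/
theorem boundedAmalgam_of_isCommutatorBound (𝕜 : Type*) [RCLike 𝕜] (hn : 1 ≤ n) (hm : 1 ≤ m)
    {s α : ℝ} {p : ℝ≥0∞} {A : Fin m → ℝ} {P : Fin m → ℝ≥0∞}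
    (hs : 1 ≤ s) (hsQ : ∀ j, s < Q j) (hQA : ∀ j, Q j ≤ A j)
    (hAP : ∀ j, ENNReal.ofReal (A j) < P j)
    (hq : 1 / q = ∑ j, 1 / Q j) (hα : 1 / α = ∑ j, 1 / A j) (hp : p⁻¹ = ∑ j, (P j)⁻¹)
    (hPQ : ∀ j, (P j)⁻¹ = ENNReal.ofReal (q / Q j) * p⁻¹) (hQA' : ∀ j, q / Q j = α / A j)
    (hw : MemMultiAp (q / s) (fun j => Q j / s) w) (hw' : ∀ j, MemAinfty (w j)) (C₀ C₁ : ℝ≥0) :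
    ∃ C : ℝ≥0, ∀ (D : Fin m → Submodule 𝕜 (Rn n → 𝕜)) (b : Fin m → Rn n → 𝕜)
      (U V : (Fin m → Rn n → 𝕜) → Rn n → ℝ≥0∞), IsDomain s D → (∀ j, MemBMO (b j)) →
      SizeCondition s C₁ D U → (∀ f, CommDomain D b f → AEMeasurable (V f) volume) →
      IsCommutatorBound D b U V →
      BoundedLebesgue (CommDomain D b) V Q w q (nuWeight q Q w) (C₀ * ∑ j, bmoNorm (b j)) →
      BoundedAmalgam (CommDomain D b) V Q w P A q (nuWeight q Q w) p α
        (C * ∑ j, bmoNorm (b j)) := by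
  have : Nonempty (Fin m) := ⟨⟨0, hm⟩⟩
  have hQ0 : ∀ j, 0 < Q j := fun j => by linarith [hsQ j]
  have hA0 : ∀ j, 0 < A j := fun j => (hQ0 j).trans_le (hQA j)
  have hq0 : 0 < q := by
    rw [← one_div_pos, hq]
    exact Finset.sum_pos (fun j _ => one_div_pos.2 (hQ0 j)) Finset.univ_nonempty
  have hα0 : 0 < α := by
    rw [← one_div_pos, hα]
    exact Finset.sum_pos (fun j _ => one_div_pos.2 (hA0 j)) Finset.univ_nonempty
  have hθ : ∀ j, 0 < q / Q j := fun j => div_pos hq0 (hQ0 j)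
  have hθsum : ∑ j, q / Q j = 1 := by
    simp_rw [← mul_one_div q]
    rw [← Finset.mul_sum, ← hq, mul_one_div_cancel hq0.ne']
  have hP0 : ∀ j, P j ≠ 0 := fun j => (zero_le.trans_lt (hAP j)).ne'
  have hPinv : ∀ j, (P j)⁻¹ ≠ ∞ := fun j => ENNReal.inv_ne_top.2 (hP0 j)
  have hp0 : p ≠ 0 := by
    rw [← ENNReal.inv_ne_top, hp]
    exact ENNReal.sum_ne_top.2 fun j _ => hPinv j
  have hPA : ∀ j, (P j)⁻¹.toReal < 1 / A j := fun j => by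
    have h1 : (P j)⁻¹ < ENNReal.ofReal (1 / A j) := by
      rw [one_div, ENNReal.ofReal_inv_of_pos (hA0 j)]
      exact ENNReal.inv_lt_inv.2 (hAP j)
    exact (ENNReal.lt_ofReal_iff_toReal_lt (hPinv j)).1 h1
  set γ := 1 / α - (p⁻¹).toReal with hγdef
  set e := 1 / α - 1 / q - (p⁻¹).toReal with hedef
  have hγ : 0 < γ := by
    rw [hγdef, sub_pos, hp, hα, ENNReal.toReal_sum fun j _ => hPinv j]
    exact Finset.sum_lt_sum_of_nonempty Finset.univ_nonempty fun j _ => hPA j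
  have he : e ≤ 0 := by
    have h1 : 1 / α ≤ 1 / q := by
      rw [hα, hq]
      exact Finset.sum_le_sum fun j _ => one_div_le_one_div_of_le (hQ0 j) (hQA j)
    have h2 : 0 ≤ (p⁻¹).toReal := ENNReal.toReal_nonneg
    linarith
  have hej : ∀ j, 1 / A j - 1 / Q j - (P j)⁻¹.toReal = q / Q j * e := fun j => by
    have h1 : 1 / A j = q / Q j * (1 / α) := by
      rw [hQA' j]
      have := (hA0 j).ne'
      field_simp
    have h2 : 1 / Q j = q / Q j * (1 / q) := by
      have := (hQ0 j).ne'
      field_simp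
    have h3 : (P j)⁻¹.toReal = q / Q j * (p⁻¹).toReal := by
      rw [hPQ j, ENNReal.toReal_mul, ENNReal.toReal_ofReal (hθ j).le]
    rw [h1, h2, h3, hedef]
    ring
  have hν := hw.isAInfty_nuWeight hm (by linarith) hsQ hq0 hq
  obtain ⟨K₁, hK₁⟩ := wLqNormOn_commutator_le 𝕜 hn hm hs hsQ hq0 hq hw C₀ C₁
  obtain ⟨K₂, lam, hlam, hK₂⟩ := rpow_mul_tailSum_le 𝕜 hn hν hw' hθ hθsum he hγ
    (by rw [hedef, hγdef]; ring)
  obtain ⟨K₃, hK₃⟩ := eLpNorm_le_of_tsum (μ := (volume : Measure (Rn n))) hp0 hlam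
  refine ⟨K₁ * K₂ * K₃, fun D b U V hD hb hU hVm hUV hbd f hf hfA => ?_⟩
  set β := ∑ j, bmoNorm (b j)
  have hfm : ∀ j, AEStronglyMeasurable (f j) volume := fun j => (hfA j).1
  have hφm : ∀ j r, AEMeasurable (localNorm (Q j) (w j) (q / Q j * e) r (f j)) volume :=
    fun j r => aemeasurable_localNorm _ (hw.1 j) _ _ (hfm j)
  have hφle : ∀ j r, 0 < r → eLpNorm (localNorm (Q j) (w j) (q / Q j * e) r (f j)) (P j) volume ≤
      amalgamNorm (Q j) (w j) (P j) (A j) (f j) := fun j r hr => by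
    rw [← hej]
    exact eLpNorm_localNorm_le _ _ _ _ _ hr
  have hmain : amalgamNorm q (nuWeight q Q w) p α (V f) ≤
      (K₁ * K₂ * K₃ : ℝ≥0) * β * ∏ j, amalgamNorm (Q j) (w j) (P j) (A j) (f j) := by
    refine iSup₂_le fun r hr => ?_
    refine (hK₃ _ (fun k y => ∏ j, localNorm (Q j) (w j) (q / Q j * e) (2 ^ (k + 1) * r) (f j) y)
      (∏ j, amalgamNorm (Q j) (w j) (P j) (A j) (f j)) (K₁ * β * K₂) (fun k => ?_) (fun k => ?_)
      ?_).trans (le_of_eq ?_)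
    · exact Finset.aemeasurable_fun_prod _ fun j _ => hφm j _
    · exact (eLpNorm_prod_le hp0 hθ hθsum hPQ fun j => hφm j _).trans
        (Finset.prod_le_prod' fun j _ => hφle j _ (by positivity))
    · -- for almost every centre `y` the `fⱼ` are in `L^{qⱼ}` of the ball `B(y, 2r)`
      have hfin : ∀ᵐ y, ∀ j, wLqNormOn (Q j) (w j) (ball y (2 * r)) (f j) < ∞ := by
        refine ae_all_iff.2 fun j => ?_
        filter_upwards [ae_lt_top_of_eLpNorm (hP0 j) (hφm j (2 * r))
          ((hφle j (2 * r) (by positivity)).trans_lt (hfA j).2)] with y hy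
        have h0 : wMeas (w j) (ball y (2 * r)) ^ (q / Q j * e) ≠ 0 := by
          have h1 := (hw.1 j).wMeas_ne_zero y (show 0 < 2 * r by positivity)
          have h2 := (hw.1 j).wMeas_ne_top y (2 * r)
          exact (ENNReal.rpow_pos (pos_iff_ne_zero.2 h1) h2).ne'
        refine lt_top_iff_ne_top.2 fun h => hy.ne ?_
        rw [localNorm, h, ENNReal.mul_top h0]
      filter_upwards [hfin] with y hy
      calc wMeas (nuWeight q Q w) (ball y r) ^ e * wLqNormOn q (nuWeight q Q w) (ball y r) (V f)
          ≤ wMeas (nuWeight q Q w) (ball y r) ^ e * (K₁ * β *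
            (∏ j, wLqNormOn (Q j) (w j) (ball y (2 * r)) (f j) +
              wMeas (nuWeight q Q w) (ball y r) ^ (1 / q) * tailSum q Q w f y r)) :=
            mul_le_mul_right (hK₁ D b U V hD hb hU hVm hUV hbd f hf y r hr hy) _
        _ = K₁ * β * (wMeas (nuWeight q Q w) (ball y r) ^ e *
            (∏ j, wLqNormOn (Q j) (w j) (ball y (2 * r)) (f j) +
              wMeas (nuWeight q Q w) (ball y r) ^ (1 / q) * tailSum q Q w f y r)) := by ring
        _ ≤ _ := by
            rw [mul_assoc (K₁ * β)]
            exact mul_le_mul_right (hK₂ f y r hr) _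
    · push_cast
      ring
  refine ⟨⟨(hVm f hf).aestronglyMeasurable, hmain.trans_lt ?_⟩, by simpa using hmain⟩
  refine ENNReal.mul_lt_top (ENNReal.mul_lt_top ENNReal.coe_lt_top ?_)
    (ENNReal.prod_lt_top fun j _ => (hfA j).2)
  exact ENNReal.sum_lt_top.2 fun j _ => (hb j).2

end Final

end Amalgam

theorem mainTheorem2 (𝕜 : Type*) [RCLike 𝕜] (n m : ℕ) (hn : 1 ≤ n) (hm : 1 ≤ m)
    (s q α : ℝ) (p : ℝ≥0∞) (Q A : Fin m → ℝ) (P : Fin m → ℝ≥0∞)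
    (hs : 1 ≤ s) (hsQ : ∀ j, s < Q j) (hQA : ∀ j, Q j ≤ A j)
    (hAP : ∀ j, ENNReal.ofReal (A j) < P j)
    (hq : 1 / q = ∑ j, 1 / Q j) (hα : 1 / α = ∑ j, 1 / A j) (hp : p⁻¹ = ∑ j, (P j)⁻¹)
    -- `p / pⱼ = q / qⱼ = α / αⱼ`, the first one in the form `1 / pⱼ = (q / qⱼ) (1 / p)`
    (hPQ : ∀ j, (P j)⁻¹ = ENNReal.ofReal (q / Q j) * p⁻¹) (hQA' : ∀ j, q / Q j = α / A j)
    (w : Fin m → Amalgam.Rn n → ℝ)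
    (hw : Amalgam.MemMultiAp (q / s) (fun j => Q j / s) w)
    (hw' : ∀ j, Amalgam.MemAinfty (w j))
    (C₀ C₁ : ℝ≥0) :
    ∃ C : ℝ≥0, ∀ (D : Fin m → Submodule 𝕜 (Amalgam.Rn n → 𝕜)) (b : Fin m → Amalgam.Rn n → 𝕜),
      Amalgam.IsDomain s D → (∀ j, Amalgam.MemBMO (b j)) →
      -- `m`-linear operators
      (∀ T : (Fin m → Amalgam.Rn n → 𝕜) → Amalgam.Rn n → 𝕜,
        Amalgam.IsMultilinearOp D T → Amalgam.SizeCondition s C₁ D T →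
        Amalgam.BoundedLebesgue (Amalgam.CommDomain D b) (Amalgam.commLin T b)
          Q w q (Amalgam.nuWeight q Q w) (C₀ * ∑ j, Amalgam.bmoNorm (b j)) →
        Amalgam.BoundedAmalgam (Amalgam.CommDomain D b) (Amalgam.commLin T b)
          Q w P A q (Amalgam.nuWeight q Q w) p α (C * ∑ j, Amalgam.bmoNorm (b j))) ∧
      -- `m`-sublinear operators
      (∀ T : (Fin m → Amalgam.Rn n → 𝕜) → Amalgam.Rn n → ℝ≥0∞,
        Amalgam.IsSublinearOp D T → Amalgam.SizeCondition s C₁ D T →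
        (∀ f, Amalgam.CommDomain D b f →
          AEStronglyMeasurable (Amalgam.commSub T b f) volume) →
        Amalgam.BoundedLebesgue (Amalgam.CommDomain D b) (Amalgam.commSub T b)
          Q w q (Amalgam.nuWeight q Q w) (C₀ * ∑ j, Amalgam.bmoNorm (b j)) →
        Amalgam.BoundedAmalgam (Amalgam.CommDomain D b) (Amalgam.commSub T b)
          Q w P A q (Amalgam.nuWeight q Q w) p α (C * ∑ j, Amalgam.bmoNorm (b j))) := by
  obtain ⟨C, hC⟩ := Amalgam.boundedAmalgam_of_isCommutatorBound 𝕜 hn hm hs hsQ hQA hAP hq hα hp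
    hPQ hQA' hw hw' C₀ C₁
  refine ⟨C, fun D b hD hb => ⟨fun T hT hsize hbd => ?_, fun T hT hsize hmeas hbd => ?_⟩⟩
  · have hSm : ∀ f, Amalgam.CommDomain D b f →
        AEStronglyMeasurable (Amalgam.commLin T b f) volume := by
      intro f hf
      refine Finset.aestronglyMeasurable_fun_sum _ fun j _ => ?_
      refine ((hb j).1.aestronglyMeasurable.mul (hT.meas f fun i => (hf i).1)).sub
        (hT.meas _ fun i => ?_)
      by_cases h : i = j
      · subst h
        rw [Function.update_self]
        exact (hf i).2
      · rw [Function.update_of_ne h]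
        exact (hf i).1
    have key := hC D b (fun f x => ‖T f x‖ₑ) (fun f x => ‖Amalgam.commLin T b f x‖ₑ) hD hb
      hsize (fun f hf => (hSm f hf).enorm) (hT.isCommutatorBound hD b)
      (fun f hf hfL => ⟨(hSm f hf).enorm.aestronglyMeasurable, (hbd f hf hfL).2⟩)
    intro f hf hfA
    exact ⟨⟨hSm f hf, (key f hf hfA).1.2⟩, (key f hf hfA).2⟩
  · exact hC D b T (Amalgam.commSub T b) hD hb hsize (fun f hf => (hmeas f hf).aemeasurable)
      (hT.isCommutatorBound hD b) hbd
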